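/- Let $q$ be a prime power. Identify $\mathrm{PG}(6,q)$ with the projective space of the $\mathbb F_q$-vector space $\mathbb F_{q^3}\oplus\mathbb F_{q^3}\oplus\mathbb F_q$, with vectors $(x,y,z)$, let $\Sigma_\infty$ be the hyperplane $z=0$, and let $\ell_\infty$ be the line $z=0$ of $\mathrm{PG}(2,q^3)$. In the Bruck–Bose representation an affine point $(\alpha,\beta,1)$ of $\mathrm{PG}(2,q^3)$ corresponds to the point $(\alpha,\beta,1)$ of $\mathrm{PG}(6,q)$, and a point $(\alpha,\beta,0)$ of $\ell_\infty$ corresponds to the plane $\{(\alpha x,\beta x,0): x\in\mathbb F_{q^3}\}$ of $\Sigma_\infty$; the set corresponding to $X$ is denoted $[X]$. An $n$-dimensional normal rational curve of $\mathrm{PG}(6,q)$ is the image of $\{(s^n,s^{n-1}t,\dots,t^n): (s,t)\in\mathbb F_q^2\setminus\{0\}\}$ under an injective $\mathbb F_q$-linear map $A:\mathbb F_q^{n+1}\to\mathbb F_{q^3}\oplus\mathbb F_{q^3}\oplus\mathbb F_q$; its extension to $\mathrm{PG}(6,q^3)$ is obtained by letting $(s,t)$ range over $\mathbb F_{q^3}^2\setminus\{0\}$.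 A twisted cubic is a $3$-dimensional normal rational curve; it spans the $3$-space given by the image of $A$. (For small $q$, where the points do not determine the curve, "a set of points is a curve of some kind" means that it is the set of $\mathbb F_q$-points of such a curve.) Let $\pi$ be an exterior order-$q$-subplane of $\mathrm{PG}(2,q^3)$, that is, an image of $\mathrm{PG}(2,q)$ under a homography that has no point on $\ell_\infty$. Its exterior splash $\mathbb S$ is the set of points of $\ell_\infty$ on the extended lines of $\pi$, or the corresponding set of planes of $\Sigma_\infty$. A cover of $\mathbb S$ is a set of pairwise disjoint planes of $\Sigma_\infty$ that cover the same points as $\mathbb S$, each of them meeting each plane of $\mathbb S$ in a unique point; there are exactly two. For a set $\mathbb X$ of planes of $\Sigma_\infty$, a transversal line of $\mathbb X$ is a line of the cubic extension $\mathrm{PG}(5,q^3)$ of $\Sigma_\infty$ that meets the extension of every plane of $\mathbb X$; if $\mathbb X$ is $\mathbb S$ or one of its covers, there are exactly three. An $\mathbb X$-special twisted cubic is a twisted cubic in a $3$-space of $\mathrm{PG}(6,q)$, not contained in $\Sigma_\infty$, about a plane of $\mathbb X$, whose extension to $\mathrm{PG}(6,q^3)$ meets the transversal lines of $\mathbb X$.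 The tangent plane of $\pi$ at a point $P$ is the join of the tangent lines at $P$ to the $\mathbb S$-special twisted cubics $[b]$, where $b$ ranges over the lines of $\pi$ through $P$. The tangent cover of $\pi$ is the cover $\mathbb T$ of $\mathbb S$ such that every tangent plane of $\pi$ meets $\Sigma_\infty$ in a line contained in a plane of $\mathbb T$; the other cover $\mathbb C$ of $\mathbb S$ is the conic cover of $\pi$. Let $\mathcal C$ be an irreducible conic of $\pi$, that is, the image, under a homography that maps $\mathrm{PG}(2,q)$ to $\pi$, of the conic of $\mathrm{PG}(2,q)$ defined by an absolutely irreducible quadratic form over $\mathbb F_q$; its extension to $\mathrm{PG}(2,q^3)$ is the image of the conic of $\mathrm{PG}(2,q^3)$ with the same equation. It is a $(\pi,\ell_\infty)$-special conic if its extension contains the three fixed points of the group $\mathrm{PGL}(3,q^3)_{\pi,\ell_\infty}$ of all homographies fixing $\pi$ and $\ell_\infty$. Then $\mathcal C$ is a $(\pi,\ell_\infty)$-special conic of $\pi$ if and only if, in $\mathrm{PG}(6,q)$, $[\mathcal C]$ is a $\mathbb C$-special twisted cubic. Otherwise, $[\mathcal C]$ is a $6$-dimensional normal rational curve of $\mathrm{PG}(6,q)$.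 -/

import Mathlib

open scoped LinearAlgebra.Projectivization TensorProduct

namespace BruckBose

section Plane

/-! Throughout, `F = 𝔽_q` and `K = 𝔽_{q³}`. The plane `PG(2, q³)` is `ℙ K (Fin 3 → K)`, with
homogeneous coordinates `(x, y, z) = (v 0, v 1, v 2)`; a point `P` contains a vector `v` when
`v ∈ P.submodule`. The group `PGL(3, q³)` acts through `GL(3, q³)`, by `g • P`. -/

variable (F : Type*) {K : Type*} [Field F] [Field K] [Algebra F K]

/-- The group of invertible linear maps inducing the homographies of `PG(2, q³)`. -/
abbrev GL3 (K : Type*) [Field K] : Type _ := LinearMap.GeneralLinearGroup K (Fin 3 → K)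

/-- The subplane `PG(2, q)` of `PG(2, q³)`: the points with a coordinate vector over `𝔽_q`. -/
def basePlane (K : Type*) [Field K] [Algebra F K] : Set (ℙ K (Fin 3 → K)) :=
  {P | ∃ v : Fin 3 → F, v ≠ 0 ∧ (fun i => algebraMap F K (v i)) ∈ P.submodule}

/-- An order-`q`-subplane of `PG(2, q³)`, given by its points: the image of `PG(2, q)` under a
homography. -/
def IsSubplane (π : Set (ℙ K (Fin 3 → K))) : Prop :=
  ∃ g : GL3 K, π = (fun P => g • P) '' basePlane F K

/-- The line at infinity `z = 0`, as a subspace of the coordinate space. -/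
def lineInfty (K : Type*) [Field K] : Submodule K (Fin 3 → K) :=
  LinearMap.ker (LinearMap.proj (R := K) (φ := fun _ : Fin 3 => K) 2)

/-- `π` is exterior to the line at infinity. -/
def IsExterior (π : Set (ℙ K (Fin 3 → K))) : Prop :=
  ∀ P ∈ π, ¬ P.submodule ≤ lineInfty K

/-- The points fixed by the group `PGL(3, q³)_{π, ℓ∞}` of all homographies that leave both `π` and
the line at infinity invariant. -/
def fixedPoints (π : Set (ℙ K (Fin 3 → K))) : Set (ℙ K (Fin 3 → K)) :=
  {P | ∀ g : GL3 K, (fun R => g • R) '' π = π →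
    (fun R : ℙ K (Fin 3 → K) => g • R) '' {R | R.submodule ≤ lineInfty K}
      = {R | R.submodule ≤ lineInfty K} →
    g • P = P}

/-- A ternary quadratic form over `F` that is irreducible over the algebraic closure of `F`. -/
def IsIrreducibleQuadratic (Q : MvPolynomial (Fin 3) F) : Prop :=
  Q.IsHomogeneous 2 ∧
    Irreducible (MvPolynomial.map (algebraMap F (AlgebraicClosure F)) Q)

variable {F}

/-- The zero set in `PG(2, q³)` of a form with coefficients in `𝔽_q`. -/
def zeroSet (K : Type*) [Field K] [Algebra F K] (Q : MvPolynomial (Fin 3) F) :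
    Set (ℙ K (Fin 3 → K)) :=
  {P | ∀ v ∈ P.submodule, MvPolynomial.aeval v Q = 0}

variable (F)

/-- `C` is an irreducible conic of the order-`q`-subplane `π`, and `D` is its extension to
`PG(2, q³)`: for a homography taking `PG(2, q)` to `π` and an irreducible quadratic form `Q` over
`𝔽_q`, the set `C` is the image of the conic `Q = 0` of `PG(2, q)`, and `D` is the image of the
conic of `PG(2, q³)` with the same equation. -/
def IsConicWithExtension (π C D : Set (ℙ K (Fin 3 → K))) : Prop :=
  ∃ (g : GL3 K) (Q : MvPolynomial (Fin 3) F), IsIrreducibleQuadratic F Q ∧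
    π = (fun P => g • P) '' basePlane F K ∧
    C = (fun P => g • P) '' (basePlane F K ∩ zeroSet K Q) ∧
    D = (fun P => g • P) '' zeroSet K Q

/-- `C` is an irreducible conic of the order-`q`-subplane `π`. -/
def IsConic (π C : Set (ℙ K (Fin 3 → K))) : Prop :=
  ∃ D, IsConicWithExtension F π C D

/-- `C` is a `(π, ℓ∞)`-special conic: a conic of `π` whose extension to `PG(2, q³)` contains the
fixed points of `PGL(3, q³)_{π, ℓ∞}`. -/
def IsSpecialConic (π C : Set (ℙ K (Fin 3 → K))) : Prop :=
  ∃ D, IsConicWithExtension F π C D ∧ fixedPoints π ⊆ D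

/-- `b` is (the set of points of) a line of the subplane `π`: the set of points of `π` on a line of
`PG(2, q³)` that contains at least two points of `π`. -/
def IsSublineOf (π b : Set (ℙ K (Fin 3 → K))) : Prop :=
  ∃ P ∈ π, ∃ R ∈ π, P ≠ R ∧ b = {X | X ∈ π ∧ X.submodule ≤ P.submodule ⊔ R.submodule}

/-- The exterior splash of `π`: the points at infinity on the extended lines of `π`. -/
def splash (π : Set (ℙ K (Fin 3 → K))) : Set (ℙ K (Fin 3 → K)) :=
  {X | X.submodule ≤ lineInfty K ∧
    ∃ P ∈ π, ∃ R ∈ π, P ≠ R ∧ X.submodule ≤ P.submodule ⊔ R.submodule}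

end Plane

section Space

/-! The space `PG(6, q)` is the projective space of the 7-dimensional `𝔽_q`-space `K × K × F`; an
`𝔽_q`-basis of `K` (such as `1, τ, τ²`) gives the usual coordinates
`(x₀, x₁, x₂, y₀, y₁, y₂, z)`. Its cubic extension `PG(6, q³)` is the projective space of
`K ⊗[F] (K × K × F)`. Subspaces of `PG(6, q)` are `F`-subspaces of `K × K × F`: points, lines,
planes, 3-spaces have vector dimension 1, 2, 3, 4. -/

variable (F K : Type*) [Field F] [Field K] [Algebra F K]

/-- The underlying vector space of `PG(6, q)`. -/
abbrev V6 : Type _ := K × K × F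

/-- The hyperplane `Σ∞` with equation `z = 0`. -/
def hyperInfty : Submodule F (V6 F K) :=
  LinearMap.ker ((LinearMap.snd F K F).comp (LinearMap.snd F K (K × F)))

/-- The inclusion `(x, y, z) ↦ (x, y, z)` of `K × K × F` in `K³`. -/
def incl : V6 F K →ₗ[F] (Fin 3 → K) where
  toFun v := ![v.1, v.2.1, algebraMap F K v.2.2]
  map_add' u v := by
    ext i
    fin_cases i <;> simp
  map_smul' c v := by
    ext i
    fin_cases i <;> simp [Algebra.smul_def]

variable {K}

/-- The Bruck-Bose image `[P]` of a point of `PG(2, q³)`, as a subspace of `PG(6, q)`: the vectors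
`(x, y, z)`, with `z ∈ 𝔽_q`, that are coordinate vectors of `P` (or zero). For an affine point
`P = (α, β, 1)` it is the point `(α, β, 1)`; for `P = (α, β, 0)` it is the plane
`{(α x, β x, 0)}` of the regular spread. -/
def bb (P : ℙ K (Fin 3 → K)) : Submodule F (V6 F K) :=
  (P.submodule.restrictScalars F).comap (incl F K)

/-- The set `[X]` of points of `PG(6, q)` that corresponds to a set `X` of points of `PG(2, q³)`. -/
def bbSet (X : Set (ℙ K (Fin 3 → K))) : Set (ℙ F (V6 F K)) :=
  {p | ∃ P ∈ X, p.submodule ≤ bb F P}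

/-- The planes of `PG(6, q)` that correspond to the points of the exterior splash of `π`. -/
def splashPlanes (π : Set (ℙ K (Fin 3 → K))) : Set (Submodule F (V6 F K)) :=
  bb F '' splash π

variable {F}

/-- `X` is a cover (a switching set) of the set `S` of planes: a set of pairwise disjoint planes of
`Σ∞` that cover the same points as `S`, every plane of `X` meeting every plane of `S` in a unique
point. -/
def IsCover (S X : Set (Submodule F (V6 F K))) : Prop :=
  (∀ α ∈ X, Module.finrank F α = 3 ∧ α ≤ hyperInfty F K) ∧
  (∀ α ∈ X, ∀ β ∈ X, α ≠ β → α ⊓ β = ⊥) ∧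
  (∀ v, (∃ α ∈ X, v ∈ α) ↔ ∃ β ∈ S, v ∈ β) ∧
  (∀ α ∈ X, ∀ β ∈ S, Module.finrank F (α ⊓ β : Submodule F (V6 F K)) = 1)

/-- A transversal line of the set `X` of planes: a line `l` of the extension `PG(5, q³)` of `Σ∞`
that meets the extension of every plane of `X`. -/
def IsTransversal (X : Set (Submodule F (V6 F K))) (l : Submodule K (K ⊗[F] V6 F K)) : Prop :=
  Module.finrank K l = 2 ∧ l ≤ (hyperInfty F K).baseChange K ∧
    ∀ α ∈ X, l ⊓ α.baseChange K ≠ ⊥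

/-! A normal rational curve of degree `n` is given by an injective linear map
`A : Fⁿ⁺¹ → K × K × F`: it is the image under `A` of the standard curve
`(sⁿ, sⁿ⁻¹ t, …, tⁿ)`. -/

/-- The point `(sⁿ, sⁿ⁻¹ t, …, tⁿ)` of the standard normal rational curve, for `x = (s, t)`. -/
def veronese {R : Type*} [CommRing R] (n : ℕ) (x : Fin 2 → R) : Fin (n + 1) → R :=
  fun i => x 0 ^ (n - (i : ℕ)) * x 1 ^ (i : ℕ)

/-- The partial derivative of `veronese` with respect to `s`. -/
def veroneseDs {R : Type*} [CommRing R] (n : ℕ) (x : Fin 2 → R) : Fin (n + 1) → R :=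
  fun i => ((n - (i : ℕ) : ℕ) : R) * (x 0 ^ (n - (i : ℕ) - 1) * x 1 ^ (i : ℕ))

/-- The partial derivative of `veronese` with respect to `t`. -/
def veroneseDt {R : Type*} [CommRing R] (n : ℕ) (x : Fin 2 → R) : Fin (n + 1) → R :=
  fun i => (((i : ℕ) : ℕ) : R) * (x 0 ^ (n - (i : ℕ)) * x 1 ^ ((i : ℕ) - 1))

/-- The points of `PG(6, q)` on the rational curve given by `A`. -/
def curvePoints {n : ℕ} (A : (Fin (n + 1) → F) →ₗ[F] V6 F K) : Set (ℙ F (V6 F K)) :=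
  {p | ∃ x : Fin 2 → F, x ≠ 0 ∧ p.submodule = Submodule.span F {A (veronese n x)}}

/-- The vector, with parameters `x = (s, t)` in `K`, of the extension to `PG(6, q³)` of the rational
curve given by `A`. -/
def extPoint {n : ℕ} (A : (Fin (n + 1) → F) →ₗ[F] V6 F K) (x : Fin 2 → K) : K ⊗[F] V6 F K :=
  ∑ i, veronese n x i ⊗ₜ[F] A (Pi.single i 1)

/-- The tangent line, at the point with parameters `x = (s, t)`, of the rational curve given by
`A`. -/
def tangentLine {n : ℕ} (A : (Fin (n + 1) → F) →ₗ[F] V6 F K) (x : Fin 2 → F) :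
    Submodule F (V6 F K) :=
  Submodule.span F {A (veronese n x), A (veroneseDs n x), A (veroneseDt n x)}

/-- `N` is the set of points of an `n`-dimensional normal rational curve in `PG(6, q)`. -/
def IsNormalRationalCurve (n : ℕ) (N : Set (ℙ F (V6 F K))) : Prop :=
  ∃ A : (Fin (n + 1) → F) →ₗ[F] V6 F K, Function.Injective A ∧ N = curvePoints A

/-- `A` gives an `X`-special twisted cubic: a twisted cubic in a 3-space, not contained in `Σ∞`,
about a plane of `X`, whose extension to `PG(6, q³)` meets the transversal lines of `X`. -/
def IsSpecialCubicMap (X : Set (Submodule F (V6 F K))) (A : (Fin 4 → F) →ₗ[F] V6 F K) : Prop :=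
  Function.Injective A ∧
  (∃ α ∈ X, α ≤ LinearMap.range A) ∧
  ¬ LinearMap.range A ≤ hyperInfty F K ∧
  ∀ l, IsTransversal X l → ∃ x : Fin 2 → K, x ≠ 0 ∧ extPoint (n := 3) A x ∈ l

/-- `N` is (the set of points of) an `X`-special twisted cubic. -/
def IsSpecialTwistedCubic (X : Set (Submodule F (V6 F K))) (N : Set (ℙ F (V6 F K))) : Prop :=
  ∃ A : (Fin 4 → F) →ₗ[F] V6 F K, IsSpecialCubicMap X A ∧ N = curvePoints (n := 3) A

variable (F)

/-- The tangent plane at the point `P` of `π`: the join of the tangent lines at `P` of the special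
twisted cubics `[b]` (special with respect to the exterior splash of `π`) that represent the lines
`b` of `π` through `P`. -/
def tangentPlane (π : Set (ℙ K (Fin 3 → K))) (P : ℙ K (Fin 3 → K)) : Submodule F (V6 F K) :=
  sSup {t | ∃ b, IsSublineOf π b ∧ P ∈ b ∧
    ∃ A : (Fin 4 → F) →ₗ[F] V6 F K,
      IsSpecialCubicMap (splashPlanes F π) A ∧ curvePoints (n := 3) A = bbSet F b ∧
      ∃ x : Fin 2 → F, x ≠ 0 ∧ A (veronese 3 x) ∈ bb F P ∧ t = tangentLine (n := 3) A x}

variable {F}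

/-- `T` is the tangent cover of `π`: the cover of its exterior splash such that every tangent plane
of `π` meets `Σ∞` in a subspace (a line) of a plane of `T`. -/
def IsTangentCover (π : Set (ℙ K (Fin 3 → K))) (T : Set (Submodule F (V6 F K))) : Prop :=
  IsCover (splashPlanes F π) T ∧
    ∀ P ∈ π, ∃ α ∈ T, tangentPlane F π P ⊓ hyperInfty F K ≤ α

/-- `X` is the conic cover of `π`: the cover of its exterior splash other than the tangent cover. -/
def IsConicCover (π : Set (ℙ K (Fin 3 → K))) (X : Set (Submodule F (V6 F K))) : Prop :=
  IsCover (splashPlanes F π) X ∧ ∃ T, IsTangentCover π T ∧ X ≠ T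

end Space

end BruckBose

/-! Write `σ` for the Frobenius map of `K` over `F`, so that an element `w` of `K` has the conjugates
`W = w`, `X = σ w`, `Y = σ² w`. The triples `conj σ w` form an `F`-structure on `K³`, and since the
equation of `ℓ∞` restricts to an isomorphism of the coordinate space of an exterior subplane `π`
with `K`, there are coordinates of `PG(2, q³)`, called a frame, in which `π` is the set of points
`conj σ w` and `ℓ∞` is the line `W = 0` (`exists_isFrame`). In a frame everything in the statement
becomes explicit.

* The point `w` of `π` is represented in `PG(6, q)` by `(σ w / w, σ² w / w, 1)`. The splash consists
  of the planes `u b + σ(u) a = 0` at infinity, for `u ≠ 0`, and its covers are the families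
  `u b + σ(u) ρ(a) = 0` for `ρ = σ` and `ρ = σ²` (`IsCover.eq_planeFamily`). The tangent lines of
  the twisted cubics of the lines through the point `w = 1` give the points
  `(σ x - x, σ² x - x, 0)`, which are not contained in a plane with `ρ = σ`; so `ρ = σ` gives the
  conic cover (`IsFrame.conicCover_eq`).
* The group of `π` and `ℓ∞` is diagonal in `W, X, Y`, and contains the multiplications by elements
  of `K`; so its fixed points are the three coordinate points (`IsFrame.mem_fixedPoints`,
  `IsFrame.exists_of_mem_fixedPoints`). A conic of `π` has an equation in `W, X, Y` that is invariant
  under `σ`. Its extension contains the fixed points when the equation is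
  `β X Y + σ(β) W Y + σ²(β) W X = 0`, that is, when `w ↦ 1 / w` takes the conic to the line
  `Tr(β v) = 0` of `π`.
* A line of `π`, parametrized by `w = s w₁ + t w₂`, gives the curve `(X² Y, X Y², W X Y)`. It is a
  twisted cubic that is special for the splash (`IsConjCurve.isSpecialCubicMap`). On `PG(6, q)`
  the transformation `w ↦ 1 / w` is induced by the linear map `(a, b, z) ↦ (σ b, σ² a, z)`, which
  exchanges the splash and the conic cover (`planeFamily_cremona`). So conics whose extension
  contains the fixed points are represented by twisted cubics that are special for the conic cover.
  Conversely, the 3-space of such a twisted cubic has an equation `u b + σ(u) σ(a) + κ z = 0`, which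
  forces `1 / w` to lie on a line of `π`; a count of points completes the argument
  (`IsSpecialCubicMap.exists_triangleForm`).
* Any conic of `π` has a parametrization `w = ω₀ s² + ω₁ s t + ω₂ t²`, and the same products
  `(X² Y, X Y², W X Y)` are binary forms of degree 6. They give a normal rational curve if and only
  if the seven products `W² X`, …, `Y² W`, `W X Y` of the conjugate quadratic forms span the binary
  sextics. All ten cubic monomials in `W, X, Y` do so, and when the coefficient of `W²` in the
  equation of the conic is not zero, the equation times `W` expresses `W³` by the seven others
  (`IsConjCurve.injective_of_conic`).

Equations are compared by means of the linear independence, for every `q`, of the monomials of degree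
two in `w`, `σ w`, `σ² w` as functions on `K`, and of those of degree three other than the cubes;
this is part of `IsCubicFrobenius`. -/

namespace BruckBose

/-! ### Frobenius and independence of monomials -/

/-- Power functions with distinct exponents, lying in an interval shorter than the order of the
multiplicative group, are linearly independent on the nonzero elements of a finite field. -/
theorem coeff_eq_zero_of_sum_pow {K ι : Type*} [Field K] [Finite K] [Fintype ι] (e : ι → ℕ)
    (c : ι → K) (m : ℕ) (he : Function.Injective e)
    (hm : ∀ i, m ≤ e i ∧ e i < m + (Nat.card K - 1))
    (h : ∀ w : K, w ≠ 0 → ∑ i, c i * w ^ e i = 0) (i : ι) : c i = 0 := by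
  classical
  have := Fintype.ofFinite K
  rw [Nat.card_eq_fintype_card] at hm
  set P : Polynomial K := ∑ i, Polynomial.monomial (e i - m) (c i) with hP
  have hP0 : P = 0 := by
    refine Polynomial.eq_zero_of_natDegree_lt_card_of_eval_eq_zero' P (Finset.univ.erase 0) ?_ ?_
    · intro w hw
      have hw0 : w ≠ 0 := Finset.ne_of_mem_erase hw
      have := h w hw0
      have h2 : w ^ m * P.eval w = 0 := by
        rw [← this, hP, Polynomial.eval_finsetSum, Finset.mul_sum]
        refine Finset.sum_congr rfl fun j _ => ?_
        rw [Polynomial.eval_monomial, mul_left_comm, ← pow_add, Nat.add_sub_cancel' (hm j).1]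
      exact (mul_eq_zero.1 h2).resolve_left (pow_ne_zero _ hw0)
    · rw [Finset.card_erase_of_mem (Finset.mem_univ _), Finset.card_univ]
      have hpos : 0 < Fintype.card K - 1 := by have := hm i; omega
      refine lt_of_le_of_lt (b := Fintype.card K - 1 - 1) ?_ (by omega)
      refine Polynomial.natDegree_sum_le_of_forall_le _ _ fun j _ => ?_
      refine (Polynomial.natDegree_monomial_le _).trans ?_
      have := hm j
      omega
  have h3 : P.coeff (e i - m) = c i := by
    rw [hP, Polynomial.finsetSum_coeff, Finset.sum_eq_single i]
    · simp
    · intro j _ hj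
      rw [Polynomial.coeff_monomial, if_neg]
      intro h4
      apply hj
      apply he
      have := hm i
      have := hm j
      omega
    · simp
  rw [← h3, hP0, Polynomial.coeff_zero]

/-- The properties of the Frobenius automorphism `σ` of a cubic extension of finite fields on which
all later arguments rest: `σ` has order dividing three, its fixed field is `F`, and suitable
monomials in `w`, `σ w`, `σ (σ w)` are linearly independent as functions of `w`. -/
structure IsCubicFrobenius {F K : Type*} [Field F] [Field K] [Algebra F K]
    (σ : K ≃ₐ[F] K) : Prop where
  cube : ∀ x, σ (σ (σ x)) = x
  fixed : ∀ x, σ x = x → ∃ y, algebraMap F K y = x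
  quadratic : ∀ a b c d e f : K, (∀ w, a * w ^ 2 + b * σ w ^ 2 + c * σ (σ w) ^ 2
    + d * (σ w * σ (σ w)) + e * (w * σ (σ w)) + f * (w * σ w) = 0) →
    a = 0 ∧ b = 0 ∧ c = 0 ∧ d = 0 ∧ e = 0 ∧ f = 0
  cubic : ∀ a b₀ b₁ b₂ c₀ c₁ c₂ : K, (∀ w, w ≠ 0 → a * (w * σ w * σ (σ w))
    + b₀ * (w ^ 2 * σ (σ w)) + b₁ * (σ w ^ 2 * w) + b₂ * (σ (σ w) ^ 2 * σ w)
    + c₀ * (w ^ 2 * σ w) + c₁ * (σ w ^ 2 * σ (σ w)) + c₂ * (σ (σ w) ^ 2 * w) = 0) →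
    a = 0 ∧ b₀ = 0 ∧ b₁ = 0 ∧ b₂ = 0 ∧ c₀ = 0 ∧ c₁ = 0 ∧ c₂ = 0

theorem exists_isCubicFrobenius {F K : Type*} [Field F] [Finite F] [Field K] [Algebra F K]
    (hK : Module.finrank F K = 3) : ∃ σ : K ≃ₐ[F] K, IsCubicFrobenius σ := by
  classical
  have := Fintype.ofFinite F
  have hfd : Module.Finite F K := Module.finite_of_finrank_pos (by omega)
  have hKf : Finite K := Module.finite_of_finite F
  have hcard : Nat.card K = Nat.card F ^ 3 := by
    rw [← hK]; exact Module.natCard_eq_pow_finrank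
  set q := Nat.card F with hq
  have hq2 : 2 ≤ q := by
    have : 1 < q := Finite.one_lt_card
    omega
  obtain ⟨Q, hQ⟩ : ∃ Q, q ^ 2 = Q := ⟨_, rfl⟩
  obtain ⟨R, hR⟩ : ∃ R, q ^ 3 = R := ⟨_, rfl⟩
  have hQ2 : 2 * q ≤ Q := by nlinarith
  have hR2 : 2 * Q ≤ R := by
    rw [← hR, ← hQ, pow_succ q 2, mul_comm 2]
    exact Nat.mul_le_mul_left _ hq2
  let σ := FiniteField.frobeniusAlgEquivOfAlgebraic F K
  have h1 : ∀ x, σ x = x ^ q := fun x => by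
    rw [hq, Nat.card_eq_fintype_card]; rfl
  have h2 : ∀ x, σ (σ x) = x ^ Q := fun x => by rw [h1, h1, ← pow_mul, ← hQ, sq]
  have h3 : ∀ x, σ (σ (σ x)) = x := fun x => by
    have := Fintype.ofFinite K
    rw [h1, h2, ← pow_mul, ← hQ, ← pow_succ, ← hcard, Nat.card_eq_fintype_card]
    exact FiniteField.pow_card x
  refine ⟨σ, h3, ?_, ?_, ?_⟩
  · intro x hx
    have := (IsGalois.mem_bot_iff_fixed (F := F) (E := K) x).2 ?_
    · obtain ⟨y, hy⟩ := IntermediateField.mem_bot.1 this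
      exact ⟨y, hy⟩
    · intro f
      obtain ⟨n, rfl⟩ := (FiniteField.bijective_frobeniusAlgEquivOfAlgebraic_pow F K).2 f
      change (σ ^ n.1) x = x
      rw [AlgEquiv.coe_pow]
      exact Function.iterate_fixed hx _
  · intro a b c d e f h
    have key := coeff_eq_zero_of_sum_pow (K := K) ![2, 2 * q, 2 * Q, q + Q, 1 + Q, 1 + q]
      ![a, b, c, d, e, f] 2 ?_ ?_ ?_
    · exact ⟨key 0, key 1, key 2, key 3, key 4, key 5⟩
    · intro i j hij
      fin_cases i <;> fin_cases j <;> simp at hij ⊢ <;> omega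
    · rw [hcard, hR]
      intro i
      fin_cases i <;> simp <;> omega
    · intro w _
      rw [← h w, h2, h1]
      simp only [Fin.sum_univ_six, Matrix.cons_val]
      ring
  · intro a b₀ b₁ b₂ c₀ c₁ c₂ h
    have key := coeff_eq_zero_of_sum_pow (K := K)
      ![1 + q + Q, 2 + Q, 2 * q + 1, 2 * Q + q, 2 + q, 2 * q + Q, 2 * Q + 1]
      ![a, b₀, b₁, b₂, c₀, c₁, c₂] (2 + q) ?_ ?_ ?_
    · exact ⟨key 0, key 1, key 2, key 3, key 4, key 5, key 6⟩
    · intro i j hij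
      fin_cases i <;> fin_cases j <;> simp at hij ⊢ <;> omega
    · rw [hcard, hR]
      intro i
      fin_cases i <;> simp <;> omega
    · intro w hw
      rw [← h w hw, h2, h1]
      simp only [Fin.sum_univ_seven, Matrix.cons_val]
      ring

section Frobenius

variable {F K : Type*} [Field F] [Field K] [Algebra F K] {σ : K ≃ₐ[F] K}

theorem IsCubicFrobenius.linear (hσ : IsCubicFrobenius σ) {a b c : K}
    (h : ∀ w, a * w + b * σ w + c * σ (σ w) = 0) : a = 0 ∧ b = 0 ∧ c = 0 := by
  obtain ⟨h1, -, -, -, h5, h6⟩ := hσ.quadratic a 0 0 0 c b fun w => by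
    linear_combination w * h w
  exact ⟨h1, h6, h5⟩

/-- A semilinear reformulation of `fixed`: a linear map with values fixed by `σ` factors through
the base field. -/
theorem IsCubicFrobenius.exists_lift (hσ : IsCubicFrobenius σ) {M : Type*} [AddCommGroup M]
    [Module F M] (f : M →ₗ[F] K) (hf : ∀ m, σ (f m) = f m) :
    ∃ g : M →ₗ[F] F, ∀ m, algebraMap F K (g m) = f m := by
  choose g hg using fun m => hσ.fixed _ (hf m)
  refine ⟨⟨⟨g, fun x y => ?_⟩, fun r x => ?_⟩, hg⟩
  · apply (algebraMap F K).injective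
    rw [map_add, hg, hg, hg, map_add]
  · apply (algebraMap F K).injective
    rw [hg, map_smul, RingHom.id_apply, smul_eq_mul, map_mul, hg, Algebra.smul_def]

theorem IsCubicFrobenius.exists_notMem (hσ : IsCubicFrobenius σ) : ∃ x, σ x ≠ x := by
  by_contra! h
  have := (hσ.linear (a := 1) (b := -1) (c := 0) fun w => by rw [h, h]; ring).1
  exact one_ne_zero this

theorem IsCubicFrobenius.eq_of_sq (hσ : IsCubicFrobenius σ) {x : K} (h : σ (σ x) = x) :
    σ x = x := by
  have := congrArg σ h
  rw [hσ.cube] at this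
  exact this.symm

variable (σ) in
/-- The conjugate coordinates `(w, σ w, σ² w)` of an element of the cubic extension. In these
coordinates on `K³` the points of `PG(2, q)` are those of the form `conj σ w`. -/
def conj (w : K) : Fin 3 → K := ![w, σ w, σ (σ w)]

@[simp] theorem conj_zero (w : K) : conj σ w 0 = w := rfl
@[simp] theorem conj_one (w : K) : conj σ w 1 = σ w := rfl
@[simp] theorem conj_two (w : K) : conj σ w 2 = σ (σ w) := rfl

theorem conj_ne_zero {w : K} (hw : w ≠ 0) : conj σ w ≠ 0 := fun h => hw (congrFun h 0)

theorem conj_add (v w : K) : conj σ (v + w) = conj σ v + conj σ w := by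
  ext i; fin_cases i <;> simp

theorem conj_smul (s : F) (w : K) : conj σ (s • w) = algebraMap F K s • conj σ w := by
  ext i; fin_cases i <;> simp [Algebra.smul_def]

/-- For an `F`-basis of `K`, given as an isomorphism with `F³`, there is a linear change of
coordinates of `K³` that turns the points over `F` into the points with conjugate coordinates. -/
theorem exists_conj_coordinates (hσ : IsCubicFrobenius σ) (c : (Fin 3 → F) ≃ₗ[F] K) :
    ∃ ν : (Fin 3 → K) ≃ₗ[K] (Fin 3 → K),
      (∀ u k, ν u k = ∑ i, u i * conj σ (c (Pi.single i 1)) k) ∧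
      ∀ v : Fin 3 → F, ν (fun i => algebraMap F K (v i)) = conj σ (c v) := by
  let N : Matrix (Fin 3) (Fin 3) K := Matrix.of fun k i => conj σ (c (Pi.single i 1)) k
  have hc : ∀ v : Fin 3 → F, c v = ∑ i, algebraMap F K (v i) * c (Pi.single i 1) := fun v => by
    conv_lhs => rw [pi_eq_sum_univ' v, map_sum]
    exact Finset.sum_congr rfl fun i _ => by rw [map_smul, Algebra.smul_def]
  have hN : IsUnit N := by
    rw [← Matrix.linearIndependent_rows_iff_isUnit, Fintype.linearIndependent_iff]
    intro g hg
    have h0 : ∀ i, g 0 * c (Pi.single i 1) + g 1 * σ (c (Pi.single i 1))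
        + g 2 * σ (σ (c (Pi.single i 1))) = 0 := fun i => by
      have := congrFun hg i
      simpa [Fin.sum_univ_three, N, Matrix.row] using this
    obtain ⟨h1, h2, h3⟩ := hσ.linear (a := g 0) (b := g 1) (c := g 2) fun w => by
      obtain ⟨v, rfl⟩ := c.surjective w
      rw [hc v]
      simp only [map_add, map_mul, AlgEquiv.commutes, Fin.sum_univ_three]
      linear_combination algebraMap F K (v 0) * h0 0 + algebraMap F K (v 1) * h0 1
        + algebraMap F K (v 2) * h0 2
    intro i
    fin_cases i <;> assumption
  have hNinj : Function.Injective (Matrix.toLin' N) := by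
    rw [Matrix.toLin'_apply']
    exact Matrix.mulVec_injective_of_isUnit hN
  have happ : ∀ u k, Matrix.toLin' N u k = ∑ i, u i * conj σ (c (Pi.single i 1)) k := by
    intro u k
    rw [Matrix.toLin'_apply, Matrix.mulVec, dotProduct]
    exact Finset.sum_congr rfl fun i _ => mul_comm _ _
  refine ⟨LinearEquiv.ofInjectiveEndo _ hNinj, fun u k => happ u k, fun v => ?_⟩
  ext k
  refine (happ _ k).trans ?_
  rw [hc v]
  fin_cases k <;> simp [map_sum]

/-- Every `F`-linear endomorphism of `K` is a `K`-linear combination of the powers of `σ`. -/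
theorem IsCubicFrobenius.exists_linear_eq (hσ : IsCubicFrobenius σ)
    (hK : Module.finrank F K = 3) (f : K →ₗ[F] K) :
    ∃ a b c : K, ∀ w, f w = a * w + b * σ w + c * σ (σ w) := by
  have hfd : Module.Finite F K := Module.finite_of_finrank_pos (by omega)
  let c : (Fin 3 → F) ≃ₗ[F] K := LinearEquiv.ofFinrankEq _ _ (by simp [hK])
  obtain ⟨ν, -, hν⟩ := exists_conj_coordinates hσ c
  let L : (Fin 3 → K) →ₗ[K] K := ∑ i, (f (c (Pi.single i 1))) • LinearMap.proj i
  have hL : ∀ v : Fin 3 → F, L (fun i => algebraMap F K (v i)) = f (c v) := fun v => by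
    conv_rhs => rw [pi_eq_sum_univ' v, map_sum, map_sum]
    simp only [L, LinearMap.sum_apply, LinearMap.smul_apply, LinearMap.proj_apply]
    exact Finset.sum_congr rfl fun i _ => by
      rw [map_smul, map_smul, smul_eq_mul, Algebra.smul_def, mul_comm]
  let L' : (Fin 3 → K) →ₗ[K] K := L ∘ₗ ν.symm.toLinearMap
  refine ⟨L' (Pi.single 0 1), L' (Pi.single 1 1), L' (Pi.single 2 1), fun w => ?_⟩
  obtain ⟨v, rfl⟩ := c.surjective w
  have h1 : f (c v) = L' (conj σ (c v)) := by
    rw [← hL, ← hν]; simp [L']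
  rw [h1]
  conv_lhs => rw [pi_eq_sum_univ' (conj σ (c v)), map_sum]
  simp only [Fin.sum_univ_three, map_smul, smul_eq_mul, conj_zero, conj_one, conj_two]
  ring

end Frobenius

/-! ### Two-dimensional subspaces of the cubic extension -/

section Lines

variable {F K : Type*} [Field F] [Field K] [Algebra F K] {σ : K ≃ₐ[F] K}

variable (σ) in
/-- The trace from `K` to `F` of `β * w`, as an element of `K`. -/
def conjTrace (β w : K) : K := β * w + σ β * σ w + σ (σ β) * σ (σ w)

theorem conj_det_ne_zero (hσ : IsCubicFrobenius σ) {w₁ w₂ : K} (h₁ : w₁ ≠ 0)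
    (h : ∀ s : F, w₂ ≠ s • w₁) : w₁ * σ w₂ - σ w₁ * w₂ ≠ 0 := by
  intro h0
  have h₁' : σ w₁ ≠ 0 := by simpa using h₁
  obtain ⟨s, hs⟩ := hσ.fixed (w₂ / w₁) (by
    rw [map_div₀, div_eq_div_iff h₁' h₁]
    linear_combination h0)
  apply h s
  rw [Algebra.smul_def, hs, div_mul_cancel₀ _ h₁]

/-- The `F`-span of two independent elements `w₁`, `w₂` is the kernel of a trace form, whose
coefficient comes from the cross product of `conj σ w₁` and `conj σ w₂`. -/
theorem conjTrace_eq_zero_iff (hσ : IsCubicFrobenius σ) {w₁ w₂ : K}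
    (h : w₁ * σ w₂ - σ w₁ * w₂ ≠ 0) (w : K) :
    conjTrace σ (σ w₁ * σ (σ w₂) - σ (σ w₁) * σ w₂) w = 0 ↔ ∃ s t : F, w = s • w₁ + t • w₂ := by
  have h' : σ w₁ * σ (σ w₂) - σ (σ w₁) * σ w₂ ≠ 0 := by
    have : σ (w₁ * σ w₂ - σ w₁ * w₂) ≠ 0 := (map_ne_zero σ).2 h
    rwa [map_sub, map_mul, map_mul] at this
  constructor
  · intro hw
    simp only [conjTrace, map_sub, map_mul, hσ.cube] at hw
    obtain ⟨s, hs⟩ := hσ.fixed ((w * σ w₂ - σ w * w₂) / (w₁ * σ w₂ - σ w₁ * w₂)) (by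
      simp only [map_div₀, map_sub, map_mul]
      rw [div_eq_div_iff h' h]
      linear_combination - σ w₂ * hw)
    obtain ⟨t, ht⟩ := hσ.fixed ((w₁ * σ w - σ w₁ * w) / (w₁ * σ w₂ - σ w₁ * w₂)) (by
      simp only [map_div₀, map_sub, map_mul]
      rw [div_eq_div_iff h' h]
      linear_combination σ w₁ * hw)
    refine ⟨s, t, ?_⟩
    rw [Algebra.smul_def, Algebra.smul_def, hs, ht, div_mul_eq_mul_div, div_mul_eq_mul_div,
      ← add_div, eq_div_iff h]
    ring
  · rintro ⟨s, t, rfl⟩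
    simp only [conjTrace, map_sub, map_mul, map_add, hσ.cube, Algebra.smul_def, AlgEquiv.commutes]
    ring

theorem smul_add_smul_eq_zero {w₁ w₂ : K}
    (h : w₁ * σ w₂ - σ w₁ * w₂ ≠ 0) {s t : F} (hst : s • w₁ + t • w₂ = 0) : s = 0 ∧ t = 0 := by
  rw [Algebra.smul_def, Algebra.smul_def] at hst
  have h' := congrArg σ hst
  simp only [map_add, map_mul, AlgEquiv.commutes, map_zero] at h'
  constructor
  · apply (algebraMap F K).injective
    apply mul_right_cancel₀ h
    rw [map_zero]
    linear_combination σ w₂ * hst - w₂ * h'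
  · apply (algebraMap F K).injective
    apply mul_right_cancel₀ h
    rw [map_zero]
    linear_combination w₁ * h' - σ w₁ * hst

/-- The kernel of the trace form of `β ≠ 0` has a basis of two elements; explicitly,
`(σ x - x) / β` lies in it for every `x`. -/
theorem exists_basis_conjTrace (hσ : IsCubicFrobenius σ) {β : K} (hβ : β ≠ 0) :
    ∃ w₁ w₂ : K, w₁ * σ w₂ - σ w₁ * w₂ ≠ 0 ∧
      ∀ w, conjTrace σ β w = 0 ↔ ∃ s t : F, w = s • w₁ + t • w₂ := by
  obtain ⟨x, hx⟩ := hσ.exists_notMem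
  have hx1 : σ x - x ≠ 0 := sub_ne_zero.2 hx
  have hx2 : σ (σ x) - σ x ≠ 0 := fun h => hx (σ.injective (sub_eq_zero.1 h))
  have hx3 : σ (σ x) - x ≠ 0 := fun h => hx (hσ.eq_of_sq (sub_eq_zero.1 h))
  have hβ1 : σ β ≠ 0 := by simpa using hβ
  have hβ2 : σ (σ β) ≠ 0 := by simpa using hβ
  have hdet : (σ x - x) / β * σ ((σ x - x) / β * (σ x + x)) -
      σ ((σ x - x) / β) * ((σ x - x) / β * (σ x + x)) ≠ 0 := by
    have : (σ x - x) / β * σ ((σ x - x) / β * (σ x + x)) -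
        σ ((σ x - x) / β) * ((σ x - x) / β * (σ x + x)) =
        (σ x - x) * (σ (σ x) - σ x) * (σ (σ x) - x) / (β * σ β) := by
      simp only [map_div₀, map_mul, map_sub, map_add]
      field_simp
      ring
    rw [this]
    exact div_ne_zero (mul_ne_zero (mul_ne_zero hx1 hx2) hx3) (mul_ne_zero hβ hβ1)
  refine ⟨_, _, hdet, fun w => ?_⟩
  rw [← conjTrace_eq_zero_iff hσ hdet]
  -- The two trace forms are proportional, by the factor `γ / β`, which is fixed by `σ`.
  have key : conjTrace σ (σ ((σ x - x) / β) * σ (σ ((σ x - x) / β * (σ x + x))) -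
      σ (σ ((σ x - x) / β)) * σ ((σ x - x) / β * (σ x + x))) w =
      (σ x - x) * (σ (σ x) - σ x) * (x - σ (σ x)) * -1 / (β * σ β * σ (σ β)) *
        conjTrace σ β w := by
    simp only [conjTrace, map_div₀, map_mul, map_sub, map_add, hσ.cube]
    field_simp
    ring
  rw [key, mul_eq_zero, or_iff_right]
  refine div_ne_zero (mul_ne_zero (mul_ne_zero (mul_ne_zero hx1 hx2) ?_) (by simp))
    (mul_ne_zero (mul_ne_zero hβ hβ1) hβ2)
  rw [← neg_sub]
  exact neg_ne_zero.2 hx3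

end Lines

/-! ### The three families of planes and the covers of the splash -/

section Covers

variable {F K : Type*} [Field F] [Field K] [Algebra F K] {σ : K ≃ₐ[F] K}

variable (σ) in
/-- The plane `u b + σ(u) ρ(a) = 0`, `z = 0` of `PG(6, q)`, with coordinates `(a, b, z)`. In suitable
coordinates the splash consists of these planes for `ρ = 1`, and its two covers consist of those
for `ρ = σ` and for `ρ = σ²`. -/
def coverPlane (ρ : K ≃ₐ[F] K) (u : K) : Submodule F (V6 F K) where
  carrier := {v | v.2.2 = 0 ∧ u * v.2.1 + σ u * ρ v.1 = 0}
  add_mem' := by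
    rintro a b ⟨ha, ha'⟩ ⟨hb, hb'⟩
    refine ⟨by simp [ha, hb], ?_⟩
    simp only [Prod.snd_add, Prod.fst_add, map_add]
    linear_combination ha' + hb'
  zero_mem' := by simp
  smul_mem' := by
    rintro r a ⟨ha, ha'⟩
    refine ⟨by simp [ha], ?_⟩
    simp only [Prod.smul_snd, Prod.smul_fst, map_smul]
    rw [mul_smul_comm, mul_smul_comm, ← smul_add, ha', smul_zero]

theorem mem_coverPlane {ρ : K ≃ₐ[F] K} {u : K} {v : V6 F K} :
    v ∈ coverPlane σ ρ u ↔ v.2.2 = 0 ∧ u * v.2.1 + σ u * ρ v.1 = 0 := Iff.rfl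

variable (σ) in
/-- The images under the coordinate change `e` of the planes `coverPlane σ ρ u`, for `u ≠ 0`. -/
def planeFamily (e : V6 F K ≃ₗ[F] V6 F K) (ρ : K ≃ₐ[F] K) : Set (Submodule F (V6 F K)) :=
  {α | ∃ u : K, u ≠ 0 ∧ α = (coverPlane σ ρ u).map e.toLinearMap}

theorem mem_map_equiv {e : V6 F K ≃ₗ[F] V6 F K} {α : Submodule F (V6 F K)} {v : V6 F K} :
    e v ∈ α.map e.toLinearMap ↔ v ∈ α := by
  simp

theorem finrank_coverPlane (ρ : K ≃ₐ[F] K) {u : K} (hu : u ≠ 0) :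
    Module.finrank F (coverPlane σ ρ u) = Module.finrank F K := by
  let f : coverPlane σ ρ u →ₗ[F] K := (LinearMap.fst F K (K × F)).comp (Submodule.subtype _)
  refine (LinearEquiv.ofBijective f ⟨?_, fun a => ?_⟩).finrank_eq
  · rw [← LinearMap.ker_eq_bot, LinearMap.ker_eq_bot']
    rintro ⟨v, hv0, hv⟩ h
    have h : v.1 = 0 := h
    rw [h, map_zero, mul_zero, add_zero] at hv
    have hv := (mul_eq_zero.1 hv).resolve_left hu
    ext <;> simp [h, hv, hv0]
  · refine ⟨⟨(a, -(σ u * ρ a) / u, 0), rfl, ?_⟩, rfl⟩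
    simp only
    field_simp
    ring

/-- If the `F`-linear map `f = a + b σ + c σ²` meets every splash plane `y = -σ(u)/u x` outside zero,
then `a = 0` and one of `b`, `c` vanishes: the determinant expressing the condition is a
cubic form in the conjugates of `u` that vanishes identically. -/
theorem IsCubicFrobenius.coeff_of_meets (hσ : IsCubicFrobenius σ) {a b c : K}
    (h : ∀ u : K, u ≠ 0 → ∃ x : K, x ≠ 0 ∧
      u * (a * x + b * σ x + c * σ (σ x)) + σ u * x = 0) : a = 0 ∧ (b = 0 ∨ c = 0) := by
  obtain ⟨-, h1, -, -, -, h2, -⟩ := hσ.cubic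
    (a * σ a * σ (σ a) + 1 + b * σ b * σ (σ b) + c * σ c * σ (σ c)
      - a * σ b * σ (σ c) - σ a * σ (σ b) * c - σ (σ a) * b * σ c)
    a (σ a) (σ (σ a)) (a * σ a - b * σ c) (σ a * σ (σ a) - σ b * σ (σ c))
    (a * σ (σ a) - σ (σ b) * c) fun u hu => by
      obtain ⟨x, hx, e0⟩ := h u hu
      have e1 := congrArg σ e0
      have e2 := congrArg σ e1
      simp only [map_add, map_mul, map_zero, hσ.cube] at e1 e2
      apply mul_right_cancel₀ hx
      rw [zero_mul]
      -- expansion of the determinant along the first column of cofactors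
      linear_combination
        ((σ u * σ a + σ (σ u)) * (σ (σ u) * σ (σ a) + u)
          - (σ u * σ b) * (σ (σ u) * σ (σ c))) * e0
        - ((u * b) * (σ (σ u) * σ (σ a) + u) - (u * c) * (σ (σ u) * σ (σ c))) * e1
        + ((u * b) * (σ u * σ b) - (u * c) * (σ u * σ a + σ (σ u))) * e2
  refine ⟨h1, ?_⟩
  rw [h1, map_zero, zero_mul, zero_sub, neg_eq_zero, mul_eq_zero] at h2
  rcases h2 with h2 | h2
  · left; simpa using h2
  · right; simpa using h2

variable {e : V6 F K ≃ₗ[F] V6 F K} {X : Set (Submodule F (V6 F K))}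

/-- A plane of a cover of the splash is the graph of a linear map. -/
theorem IsCover.exists_graph (hK : Module.finrank F K = 3)
    (hX : IsCover (planeFamily σ e AlgEquiv.refl) X) {α : Submodule F (V6 F K)} (hα : α ∈ X) :
    ∃ f : K →ₗ[F] K, ∀ v, e v ∈ α ↔ v.2.2 = 0 ∧ v.2.1 = f v.1 := by
  obtain ⟨h1, -, h3, -⟩ := hX
  have hfd : Module.Finite F K := Module.finite_of_finrank_pos (by omega)
  have hv0 : ∀ v, e v ∈ α → v.2.2 = 0 ∧ (v.1 = 0 → v.2.1 = 0) := fun v hv => by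
    obtain ⟨β, ⟨u, hu, rfl⟩, hβ⟩ := (h3 (e v)).1 ⟨α, hα, hv⟩
    rw [mem_map_equiv, mem_coverPlane] at hβ
    refine ⟨hβ.1, fun h0 => ?_⟩
    have := hβ.2
    rw [h0, map_zero, mul_zero, add_zero] at this
    exact (mul_eq_zero.1 this).resolve_left hu
  let α' : Submodule F (V6 F K) := α.comap e.toLinearMap
  have hα' : Module.finrank F α' = 3 := by
    rw [← (h1 α hα).1]
    exact (e.submoduleMap α').finrank_eq.trans (by
      rw [show α'.map e.toLinearMap = α from Submodule.map_comap_eq_of_surjective e.surjective _])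
  let f : α' →ₗ[F] K := (LinearMap.fst F K (K × F)).comp (Submodule.subtype _)
  have hf : Function.Injective f := by
    rw [← LinearMap.ker_eq_bot, LinearMap.ker_eq_bot']
    rintro ⟨v, hv⟩ h
    have h : v.1 = 0 := h
    obtain ⟨h5, h6⟩ := hv0 v hv
    have := h6 h
    ext <;> simp [h, h5, this]
  let f' : α' ≃ₗ[F] K := LinearEquiv.ofInjectiveOfFinrankEq f hf (hα'.trans hK.symm)
  have hf' : ∀ v, f' v = (v : V6 F K).1 := fun v => rfl
  refine ⟨(LinearMap.fst F K F).comp ((LinearMap.snd F K (K × F)).comp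
    ((Submodule.subtype _).comp f'.symm.toLinearMap)), fun v => ⟨fun hv => ⟨(hv0 v hv).1, ?_⟩, ?_⟩⟩
  · have : f'.symm v.1 = ⟨v, hv⟩ := by rw [LinearEquiv.symm_apply_eq, hf']
    simp [this]
  · rintro ⟨h5, h6⟩
    have h7 : (f'.symm v.1 : V6 F K).1 = v.1 := by rw [← hf', LinearEquiv.apply_symm_apply]
    have h8 := (f'.symm v.1).2
    have h9 : (f'.symm v.1 : V6 F K) = v := by
      ext
      · exact h7
      · exact h6.symm
      · rw [h5]; exact (hv0 _ h8).1
    rw [h9] at h8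
    exact h8

theorem IsCover.mem_planeFamily (hσ : IsCubicFrobenius σ) (hK : Module.finrank F K = 3)
    (hX : IsCover (planeFamily σ e AlgEquiv.refl) X) {α : Submodule F (V6 F K)} (hα : α ∈ X) :
    α ∈ planeFamily σ e σ ∨ α ∈ planeFamily σ e (σ.trans σ) := by
  obtain ⟨f, hf⟩ := hX.exists_graph hK hα
  obtain ⟨a, b, c, habc⟩ := hσ.exists_linear_eq hK f
  have hmeet : ∀ u : K, u ≠ 0 → ∃ x : K, x ≠ 0 ∧
      u * (a * x + b * σ x + c * σ (σ x)) + σ u * x = 0 := fun u hu => by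
    have h1 := hX.2.2.2 α hα _ ⟨u, hu, rfl⟩
    have h2 : α ⊓ (coverPlane σ AlgEquiv.refl u).map e.toLinearMap ≠ ⊥ := by
      intro h; rw [h, finrank_bot] at h1; omega
    obtain ⟨w, ⟨hw1, hw2⟩, hw0⟩ := Submodule.exists_mem_ne_zero_of_ne_bot h2
    obtain ⟨v, rfl⟩ := e.surjective w
    rw [SetLike.mem_coe, hf] at hw1
    rw [SetLike.mem_coe, mem_map_equiv, mem_coverPlane] at hw2
    refine ⟨v.1, fun h0 => hw0 ?_, ?_⟩
    · have : v = 0 := by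
        ext
        · exact h0
        · rw [hw1.2, h0, map_zero]; rfl
        · exact hw1.1
      rw [this, map_zero]
    · rw [← habc, ← hw1.2]; exact hw2.2
  have hext : ∀ β : Submodule F (V6 F K), (∀ v, e v ∈ α ↔ v ∈ β) → α = β.map e.toLinearMap := by
    intro β h
    ext w
    obtain ⟨v, rfl⟩ := e.surjective w
    rw [h, mem_map_equiv]
  obtain ⟨rfl, hbc⟩ := hσ.coeff_of_meets hmeet
  obtain ⟨x, hx, h1⟩ := hmeet 1 one_ne_zero
  simp only [map_one, zero_mul, zero_add, one_mul] at h1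
  have hx1 : σ x ≠ 0 := by simpa using hx
  have hx2 : σ (σ x) ≠ 0 := by simpa using hx
  rcases hbc with rfl | rfl
  · right
    refine ⟨σ (σ x), hx2, hext _ fun v => ?_⟩
    rw [hf, mem_coverPlane, habc, hσ.cube, AlgEquiv.trans_apply]
    refine and_congr_right fun _ => ?_
    constructor
    · intro h; rw [h]; linear_combination σ (σ v.1) * h1
    · intro h; apply mul_left_cancel₀ hx2; linear_combination h - σ (σ v.1) * h1
  · left
    refine ⟨x⁻¹, inv_ne_zero hx, hext _ fun v => ?_⟩
    rw [hf, mem_coverPlane, habc, map_inv₀]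
    refine and_congr_right fun _ => ?_
    constructor
    · intro h; rw [h]; field_simp; linear_combination σ v.1 * h1
    · intro h
      field_simp at h
      apply mul_left_cancel₀ hx1; linear_combination h - σ v.1 * h1

/-- The splash has at most the two covers given by `ρ = σ` and `ρ = σ²`. -/
theorem IsCover.eq_planeFamily (hσ : IsCubicFrobenius σ) (hK : Module.finrank F K = 3)
    (hX : IsCover (planeFamily σ e AlgEquiv.refl) X) :
    X = planeFamily σ e σ ∨ X = planeFamily σ e (σ.trans σ) := by
  -- planes of different families meet
  have hmeet : ∀ u u' : K, u ≠ 0 → u' ≠ 0 → (coverPlane σ σ u).map e.toLinearMap ∈ X →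
      (coverPlane σ (σ.trans σ) u').map e.toLinearMap ∈ X → False := by
    intro u u' hu hu' h h'
    obtain ⟨a, ha⟩ := σ.surjective (u / u')
    have ha0 : a ≠ 0 := by rintro rfl; rw [map_zero] at ha; exact div_ne_zero hu hu' ha.symm
    have hv : ((a, -(σ u * σ a) / u, 0) : V6 F K) ∈ coverPlane σ σ u := by
      refine ⟨rfl, ?_⟩
      simp only
      field_simp
      ring
    have hv' : ((a, -(σ u * σ a) / u, 0) : V6 F K) ∈ coverPlane σ (σ.trans σ) u' := by
      refine ⟨rfl, ?_⟩
      have hu1 : σ u' ≠ 0 := by simpa using hu'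
      simp only [AlgEquiv.trans_apply, ha, map_div₀]
      field_simp
      ring
    have hne : e (a, -(σ u * σ a) / u, 0) ≠ 0 := by
      rw [Ne, LinearEquiv.map_eq_zero_iff]
      exact fun h => ha0 (congrArg Prod.fst h)
    rw [← mem_map_equiv (e := e)] at hv hv'
    by_cases heq : (coverPlane σ σ u).map e.toLinearMap =
        (coverPlane σ (σ.trans σ) u').map e.toLinearMap
    · -- a common plane would force `σ² x = const * σ x` for all `x`
      have hall : ∀ x, σ u / u * σ x - σ u' / u' * σ (σ x) = 0 := fun x => by
        have h1 : ((x, -(σ u * σ x) / u, 0) : V6 F K) ∈ coverPlane σ σ u := by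
          refine ⟨rfl, ?_⟩
          simp only
          field_simp
          ring
        rw [← mem_map_equiv (e := e), heq, mem_map_equiv, mem_coverPlane] at h1
        have := h1.2
        simp only [AlgEquiv.trans_apply] at this
        field_simp at this ⊢
        linear_combination -this
      have h1 := (hσ.linear (a := 0) (b := σ u / u) (c := -(σ u' / u')) fun x => by
        linear_combination hall x).2.1
      exact div_ne_zero (by simpa using hu) hu h1
    · have := hX.2.1 _ h _ h' heq
      have h2 : e (a, -(σ u * σ a) / u, 0) ∈ (coverPlane σ σ u).map e.toLinearMap ⊓
        (coverPlane σ (σ.trans σ) u').map e.toLinearMap := ⟨hv, hv'⟩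
      rw [this, Submodule.mem_bot] at h2
      exact hne h2
  have hsub : ∀ ρ : K ≃ₐ[F] K, X ⊆ planeFamily σ e ρ → X = planeFamily σ e ρ := by
    intro ρ hρ
    refine hρ.antisymm ?_
    rintro _ ⟨u, hu, rfl⟩
    -- the point of the plane over `a = 1` lies on a splash plane, hence on a plane of the cover
    have hv : ((1, -σ u / u, 0) : V6 F K) ∈ coverPlane σ ρ u := by
      refine ⟨rfl, ?_⟩
      simp only [map_one]
      field_simp
      ring
    have hv' : ((1, -σ u / u, 0) : V6 F K) ∈ coverPlane σ AlgEquiv.refl u := by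
      refine ⟨rfl, ?_⟩
      simp only [map_one]
      field_simp
      ring
    rw [← mem_map_equiv (e := e)] at hv'
    obtain ⟨α, hα, hvα⟩ := (hX.2.2.1 _).2 ⟨_, ⟨u, hu, rfl⟩, hv'⟩
    obtain ⟨u', hu', rfl⟩ := hρ hα
    have h1 := (mem_map_equiv.1 hvα).2
    simp only [map_one] at h1
    convert hα using 2
    ext v
    rw [mem_coverPlane, mem_coverPlane]
    refine and_congr_right fun _ => ?_
    field_simp at h1
    constructor
    · intro h
      apply mul_left_cancel₀ hu
      linear_combination u' * h + ρ v.1 * h1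
    · intro h
      apply mul_left_cancel₀ hu'
      linear_combination u * h - ρ v.1 * h1
  by_cases hex : ∃ u : K, u ≠ 0 ∧ (coverPlane σ σ u).map e.toLinearMap ∈ X
  · left
    obtain ⟨u, hu, huX⟩ := hex
    refine hsub _ fun α hα => ?_
    rcases hX.mem_planeFamily hσ hK hα with h | ⟨u', hu', rfl⟩
    · exact h
    · exact (hmeet u u' hu hu' huX hα).elim
  · right
    refine hsub _ fun α hα => ?_
    rcases hX.mem_planeFamily hσ hK hα with ⟨u, hu, rfl⟩ | h
    · exact (hex ⟨u, hu, hα⟩).elim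
    · exact h

end Covers

/-! ### Coordinates on the cubic extension and transversal lines -/

section Transversals

variable {F K : Type*} [Field F] [Field K] [Algebra F K] {σ : K ≃ₐ[F] K}

variable (σ) in
/-- The map `(a, b, z) ↦ (a, σ a, σ² a, b, σ b, σ² b, z)`. -/
def conjCoord : V6 F K →ₗ[F] (Fin 3 → K) × (Fin 3 → K) × K where
  toFun v := (conj σ v.1, conj σ v.2.1, algebraMap F K v.2.2)
  map_add' v w := by simp [conj_add]
  map_smul' r v := by
    refine Prod.ext ?_ (Prod.ext ?_ ?_)
    · ext k
      simpa [Algebra.smul_def] using congrFun (conj_smul (σ := σ) r v.1) k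
    · ext k
      simpa [Algebra.smul_def] using congrFun (conj_smul (σ := σ) r v.2.1) k
    · simp [Algebra.smul_def]

variable (σ) in
/-- Coordinates on the extension of `PG(6, q)` to `K`, relative to the coordinate change `e`: the
`K`-linear extension of `(a, b, z) ↦ (a, σ a, σ² a, b, σ b, σ² b, z)`. -/
noncomputable def extCoord (e : V6 F K ≃ₗ[F] V6 F K) :
    K ⊗[F] V6 F K →ₗ[K] (Fin 3 → K) × (Fin 3 → K) × K :=
  (conjCoord σ ∘ₗ e.symm.toLinearMap).liftBaseChange K

theorem extCoord_tmul (e : V6 F K ≃ₗ[F] V6 F K) (r : K) (v : V6 F K) :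
    extCoord σ e (r ⊗ₜ e v) = r • (conj σ v.1, conj σ v.2.1, algebraMap F K v.2.2) := by
  simp [extCoord, conjCoord]

theorem extCoord_injective (hσ : IsCubicFrobenius σ) (hK : Module.finrank F K = 3)
    (e : V6 F K ≃ₗ[F] V6 F K) : Function.Injective (extCoord σ e) := by
  have hfd : Module.Finite F K := Module.finite_of_finrank_pos (by omega)
  have hdim : Module.finrank K (K ⊗[F] V6 F K) =
      Module.finrank K ((Fin 3 → K) × (Fin 3 → K) × K) := by
    rw [Module.finrank_baseChange]; simp [hK]
  rw [LinearMap.injective_iff_surjective_of_finrank_eq_finrank hdim, ← LinearMap.range_eq_top]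
  by_contra hne
  obtain ⟨f, hf0, hf⟩ := Submodule.exists_le_ker_of_lt_top _ (lt_top_iff_ne_top.2 hne)
  have hf' : ∀ v : V6 F K, f (conj σ v.1, conj σ v.2.1, algebraMap F K v.2.2) = 0 := fun v => by
    have := hf ⟨(1 : K) ⊗ₜ e v, rfl⟩
    rwa [extCoord_tmul, one_smul] at this
  apply hf0
  have hexp : ∀ g : (Fin 3 → K) →ₗ[K] K, (∀ w, g (conj σ w) = 0) → g = 0 := fun g hg => by
    obtain ⟨h0, h1, h2⟩ := hσ.linear (a := g (Pi.single 0 1)) (b := g (Pi.single 1 1))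
      (c := g (Pi.single 2 1)) fun w => by
        have := hg w
        rw [pi_eq_sum_univ' (conj σ w), map_sum] at this
        simp only [Fin.sum_univ_three, map_smul, smul_eq_mul, conj_zero, conj_one, conj_two] at this
        linear_combination this
    refine LinearMap.pi_ext' fun i => LinearMap.ext_ring ?_
    fin_cases i <;> simpa
  have e1 := hexp (f ∘ₗ LinearMap.inl K _ _) fun w => by
    have := hf' (w, 0, 0)
    have h0 : conj σ (0 : K) = 0 := by ext i; fin_cases i <;> simp
    rw [h0, map_zero] at this
    exact this
  have e2 := hexp (f ∘ₗ LinearMap.inr K _ _ ∘ₗ LinearMap.inl K _ _) fun w => by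
    have := hf' (0, w, 0)
    have h0 : conj σ (0 : K) = 0 := by ext i; fin_cases i <;> simp
    simpa [h0] using this
  have e3 : f (0, 0, 1) = 0 := by
    have := hf' (0, 0, 1)
    have h0 : conj σ (0 : K) = 0 := by ext i; fin_cases i <;> simp
    simpa [h0] using this
  refine LinearMap.prod_ext e1 (LinearMap.prod_ext e2 (LinearMap.ext_ring e3))

/-- If the `2 × 3` matrix with columns `(uᵢ bᵢ + uᵢ₊₁ aᵢ, uᵢ bᵢ' + uᵢ₊₁ aᵢ')` has rank at most one for
all conjugate triples `u`, then the Plücker coordinates mixing different indices vanish: each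
minor is a quadratic form in the conjugates of `u` with distinct monomials. -/
theorem IsCubicFrobenius.minors_eq_zero (hσ : IsCubicFrobenius σ) (a b a' b' : Fin 3 → K)
    (h : ∀ u : K, u ≠ 0 → ∃ x y : K, (x ≠ 0 ∨ y ≠ 0) ∧ ∀ k,
      x * (conj σ u k * b k + conj σ u (k + 1) * a k)
        + y * (conj σ u k * b' k + conj σ u (k + 1) * a' k) = 0)
    {i j : Fin 3} (hij : i ≠ j) :
    a i * a' j - a' i * a j = 0 ∧ a i * b' j - a' i * b j = 0 ∧
      b i * a' j - b' i * a j = 0 ∧ b i * b' j - b' i * b j = 0 := by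
  have hminor : ∀ u : K, ∀ k l : Fin 3,
      (conj σ u k * b k + conj σ u (k + 1) * a k)
        * (conj σ u l * b' l + conj σ u (l + 1) * a' l)
      - (conj σ u k * b' k + conj σ u (k + 1) * a' k)
        * (conj σ u l * b l + conj σ u (l + 1) * a l) = 0 := by
    intro u k l
    by_cases hu : u = 0
    · have h0 : ∀ m, conj σ (0 : K) m = 0 := fun m => by fin_cases m <;> simp
      simp [hu, h0]
    · obtain ⟨x, y, hxy, hk⟩ := h u hu
      have h1 := hk k
      have h2 := hk l
      rcases hxy with hx | hy
      · apply mul_left_cancel₀ hx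
        linear_combination (conj σ u l * b' l + conj σ u (l + 1) * a' l) * h1
          - (conj σ u k * b' k + conj σ u (k + 1) * a' k) * h2
      · apply mul_left_cancel₀ hy
        linear_combination (conj σ u k * b k + conj σ u (k + 1) * a k) * h2
          - (conj σ u l * b l + conj σ u (l + 1) * a l) * h1
  have h01 := hσ.quadratic 0 (a 0 * a' 1 - a' 0 * a 1 - (a 0 * a' 1 - a' 0 * a 1)
    + (a 0 * b' 1 - a' 0 * b 1)) 0 (a 0 * a' 1 - a' 0 * a 1) (b 0 * a' 1 - b' 0 * a 1)
    (b 0 * b' 1 - b' 0 * b 1) fun u => by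
      have := hminor u 0 1
      simp only [show (0 : Fin 3) + 1 = 1 from rfl, show (1 : Fin 3) + 1 = 2 from rfl,
        conj_zero, conj_one, conj_two] at this
      linear_combination this
  have h12 := hσ.quadratic 0 0 (a 1 * b' 2 - a' 1 * b 2) (b 1 * b' 2 - b' 1 * b 2)
    (a 1 * a' 2 - a' 1 * a 2) (b 1 * a' 2 - b' 1 * a 2) fun u => by
      have := hminor u 1 2
      simp only [show (2 : Fin 3) + 1 = 0 from rfl, show (1 : Fin 3) + 1 = 2 from rfl,
        conj_zero, conj_one, conj_two] at this
      linear_combination this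
  have h02 := hσ.quadratic (b 0 * a' 2 - b' 0 * a 2) 0 0 (a 0 * b' 2 - a' 0 * b 2)
    (b 0 * b' 2 - b' 0 * b 2) (a 0 * a' 2 - a' 0 * a 2) fun u => by
      have := hminor u 0 2
      simp only [show (2 : Fin 3) + 1 = 0 from rfl, show (0 : Fin 3) + 1 = 1 from rfl,
        conj_zero, conj_one, conj_two] at this
      linear_combination this
  obtain ⟨-, p1, -, p2, p3, p4⟩ := h01
  obtain ⟨-, -, q1, q2, q3, q4⟩ := h12
  obtain ⟨r1, -, -, r2, r3, r4⟩ := h02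
  fin_cases i <;> fin_cases j <;> simp at hij ⊢
  · exact ⟨p2, by linear_combination p1, p3, p4⟩
  · exact ⟨r4, r2, r1, r3⟩
  · exact ⟨by linear_combination -p2, by linear_combination -p3, by linear_combination -p1,
      by linear_combination -p4⟩
  · exact ⟨q3, q1, q4, q2⟩
  · exact ⟨by linear_combination -r4, by linear_combination -r1, by linear_combination -r2,
      by linear_combination -r3⟩
  · exact ⟨by linear_combination -q3, by linear_combination -q4, by linear_combination -q1,
      by linear_combination -q2⟩

theorem exists_basis_of_finrank_two {K M : Type*} [Field K] [AddCommGroup M] [Module K M]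
    (l : Submodule K M) (hl : Module.finrank K l = 2) : ∃ p ∈ l, ∃ p' ∈ l,
      (∀ s t : K, s • p + t • p' = 0 → s = 0 ∧ t = 0) ∧ ∀ x ∈ l, ∃ s t : K, x = s • p + t • p' := by
  have : Module.Finite K l := Module.finite_of_finrank_pos (by omega)
  let B := Module.finBasisOfFinrankEq K l hl
  refine ⟨B 0, (B 0).2, B 1, (B 1).2, fun s t h => ?_, fun x hx => ⟨B.repr ⟨x, hx⟩ 0,
    B.repr ⟨x, hx⟩ 1, ?_⟩⟩
  · have h' : ∑ i, ![s, t] i • B i = 0 := by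
      apply Subtype.ext; simpa using h
    have := Fintype.linearIndependent_iff.1 B.linearIndependent _ h'
    exact ⟨this 0, this 1⟩
  · have := congrArg Subtype.val (B.sum_repr ⟨x, hx⟩)
    rw [Fin.sum_univ_two] at this
    exact this.symm

/-- A transversal line of the splash contains, hence is, one of the three lines on which only the
two coordinates `aᵢ`, `bᵢ` do not vanish. -/
theorem IsTransversal.exists_index (hσ : IsCubicFrobenius σ) (hK : Module.finrank F K = 3)
    {e : V6 F K ≃ₗ[F] V6 F K} (he : ∀ v, (e v).2.2 = v.2.2)
    {l : Submodule K (K ⊗[F] V6 F K)} (hl : IsTransversal (planeFamily σ e AlgEquiv.refl) l) :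
    ∃ i : Fin 3, ∀ x, (∀ k, k ≠ i → (extCoord σ e x).1 k = 0 ∧ (extCoord σ e x).2.1 k = 0) →
      (extCoord σ e x).2.2 = 0 → x ∈ l := by
  obtain ⟨hl2, hlinf, hmeet⟩ := hl
  have hinj := extCoord_injective hσ hK e
  have hz : ∀ x ∈ l, (extCoord σ e x).2.2 = 0 := by
    suffices (hyperInfty F K).baseChange K ≤ LinearMap.ker
        ((LinearMap.snd K _ _ ∘ₗ LinearMap.snd K _ _) ∘ₗ extCoord σ e) from
      fun x hx => this (hlinf hx)
    rw [Submodule.baseChange_eq_span, Submodule.span_le]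
    rintro _ ⟨w, hw, rfl⟩
    obtain ⟨v, rfl⟩ := e.surjective w
    have hv : v.2.2 = 0 := by rw [← he]; exact hw
    change (extCoord σ e (1 ⊗ₜ e v)).2.2 = 0
    rw [extCoord_tmul]
    simp [hv]
  have hplane : ∀ u : K, ∀ x ∈ ((coverPlane σ AlgEquiv.refl u).map e.toLinearMap).baseChange K,
      ∀ k, conj σ u k * (extCoord σ e x).2.1 k + conj σ u (k + 1) * (extCoord σ e x).1 k = 0 := by
    intro u x hx k
    let f : (Fin 3 → K) × (Fin 3 → K) × K →ₗ[K] K :=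
      conj σ u k • (LinearMap.proj k ∘ₗ LinearMap.fst K _ _ ∘ₗ LinearMap.snd K _ _)
        + conj σ u (k + 1) • (LinearMap.proj k ∘ₗ LinearMap.fst K _ _)
    suffices ((coverPlane σ AlgEquiv.refl u).map e.toLinearMap).baseChange K ≤
        LinearMap.ker (f ∘ₗ extCoord σ e) from this hx
    rw [Submodule.baseChange_eq_span, Submodule.span_le]
    rintro _ ⟨w, hw, rfl⟩
    obtain ⟨v, rfl⟩ := e.surjective w
    obtain ⟨-, hv⟩ := mem_map_equiv.1 hw
    change conj σ u k * (extCoord σ e (1 ⊗ₜ e v)).2.1 k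
      + conj σ u (k + 1) * (extCoord σ e (1 ⊗ₜ e v)).1 k = 0
    rw [extCoord_tmul, one_smul]
    have hv1 := congrArg σ hv
    have hv2 := congrArg σ hv1
    simp only [AlgEquiv.coe_refl, id, map_add, map_mul, map_zero, hσ.cube] at hv hv1 hv2
    fin_cases k
    · exact hv
    · exact hv1
    · exact hv2
  obtain ⟨p, hp, p', hp', hpp, hlin⟩ := exists_basis_of_finrank_two l hl2
  obtain ⟨⟨a, b, z⟩, hP⟩ : ∃ P, extCoord σ e p = P := ⟨_, rfl⟩
  obtain ⟨⟨a', b', z'⟩, hP'⟩ : ∃ P, extCoord σ e p' = P := ⟨_, rfl⟩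
  have hz0 : z = 0 := by have := hz p hp; rwa [hP] at this
  have hz0' : z' = 0 := by have := hz p' hp'; rwa [hP'] at this
  have hcomb : ∀ s t : K, extCoord σ e (s • p + t • p') =
      (s • a + t • a', s • b + t • b', 0) := fun s t => by
    rw [map_add, map_smul, map_smul, hP, hP', hz0, hz0']; simp
  have hM := fun {i j : Fin 3} (hij : i ≠ j) => hσ.minors_eq_zero a b a' b' (fun u hu => by
    obtain ⟨x, ⟨hx, hx'⟩, hx0⟩ := Submodule.exists_mem_ne_zero_of_ne_bot
      (hmeet _ ⟨u, hu, rfl⟩)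
    obtain ⟨s, t, rfl⟩ := hlin x hx
    refine ⟨s, t, ?_, fun k => ?_⟩
    · by_contra! h; simp [h.1, h.2] at hx0
    · have := hplane u _ hx' k
      rw [hcomb] at this
      simp only [Pi.add_apply, Pi.smul_apply, smul_eq_mul] at this
      linear_combination this) hij
  obtain ⟨i, hi⟩ : ∃ i, a i * b' i - a' i * b i ≠ 0 := by
    by_contra! h
    have hzero : ∀ s t : K, (∀ k, s * a k + t * a' k = 0 ∧ s * b k + t * b' k = 0) →
        s = 0 ∧ t = 0 := fun s t hst => by
      apply hpp
      apply hinj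
      rw [hcomb, map_zero]
      refine Prod.ext ?_ (Prod.ext ?_ rfl)
      · ext k; exact (hst k).1
      · ext k; exact (hst k).2
    have haa : ∀ k j, a k * a' j - a' k * a j = 0 := fun k j => by
      by_cases hkj : k = j
      · rw [hkj]; ring
      · exact (hM hkj).1
    have hab : ∀ k j, a k * b' j - a' k * b j = 0 := fun k j => by
      by_cases hkj : k = j
      · rw [hkj]; exact h j
      · exact (hM hkj).2.1
    have hbb : ∀ k j, b k * b' j - b' k * b j = 0 := fun k j => by
      by_cases hkj : k = j
      · rw [hkj]; ring
      · exact (hM hkj).2.2.2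
    have ha : ∀ j, a j = 0 ∧ a' j = 0 := fun j => by
      have := hzero (a' j) (-a j) fun k =>
        ⟨by linear_combination haa k j, by linear_combination -hab j k⟩
      exact ⟨neg_eq_zero.1 this.2, this.1⟩
    have hb : ∀ j, b j = 0 ∧ b' j = 0 := fun j => by
      have := hzero (b' j) (-b j) fun k =>
        ⟨by linear_combination hab k j, by linear_combination hbb k j⟩
      exact ⟨neg_eq_zero.1 this.2, this.1⟩
    exact one_ne_zero (hzero 1 1 fun k => by simp [ha, hb]).1
  have hvan : ∀ c c' : K, a i * c' - a' i * c = 0 → b i * c' - b' i * c = 0 → c = 0 ∧ c' = 0 := by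
    intro c c' h1 h2
    constructor
    · apply mul_left_cancel₀ hi; linear_combination b i * h1 - a i * h2
    · apply mul_left_cancel₀ hi; linear_combination b' i * h1 - a' i * h2
  have hak : ∀ k, k ≠ i → a k = 0 ∧ a' k = 0 := fun k hk =>
    hvan _ _ (hM hk.symm).1 (hM hk.symm).2.2.1
  have hbk : ∀ k, k ≠ i → b k = 0 ∧ b' k = 0 := fun k hk =>
    hvan _ _ (hM hk.symm).2.1 (hM hk.symm).2.2.2
  refine ⟨i, fun x hx hxz => ?_⟩
  set D := a i * b' i - a' i * b i with hD
  set α := (extCoord σ e x).1 i with hα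
  set β := (extCoord σ e x).2.1 i with hβ
  have hx' : x = ((α * b' i - β * a' i) / D) • p
      + ((a i * β - b i * α) / D) • p' := by
    apply hinj
    rw [hcomb]
    refine Prod.ext ?_ (Prod.ext ?_ hxz)
    · ext k
      by_cases hk : k = i
      · subst hk
        simp only [Pi.add_apply, Pi.smul_apply, smul_eq_mul]
        rw [div_mul_eq_mul_div, div_mul_eq_mul_div, ← add_div, eq_div_iff hi, ← hα]
        ring
      · simp [(hx k hk).1, hak k hk]
    · ext k
      by_cases hk : k = i
      · subst hk
        simp only [Pi.add_apply, Pi.smul_apply, smul_eq_mul]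
        rw [div_mul_eq_mul_div, div_mul_eq_mul_div, ← add_div, eq_div_iff hi, ← hβ]
        ring
      · simp [(hx k hk).2, hbk k hk]
  rw [hx']
  exact l.add_mem (l.smul_mem _ hp) (l.smul_mem _ hp')

end Transversals

/-! ### Trilinear forms attached to binary forms -/

section Tri

variable {K : Type*} [Field K] {n d : ℕ}

/-- A linear functional `x` on binary forms of degree `n = 3 d`, given by its values on the monomials
`s^(n-m) t^m`, applied to the product of three binary forms of degree `d` with coefficients `p`, `q`,
`r`. The index `i + j + l` never exceeds `n` when `n = 3 d`. -/
def tri (x : Fin (n + 1) → K) (p q r : Fin (d + 1) → K) : K :=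
  ∑ i, ∑ j, ∑ l, p i * q j * r l * x (Fin.ofNat (n + 1) (i + j + l))

theorem tri_comm₁₂ (x : Fin (n + 1) → K) (p q r : Fin (d + 1) → K) :
    tri x p q r = tri x q p r := by
  unfold tri
  rw [Finset.sum_comm]
  refine Finset.sum_congr rfl fun i _ => Finset.sum_congr rfl fun j _ =>
    Finset.sum_congr rfl fun l _ => ?_
  rw [mul_comm (p j), add_comm (j : ℕ)]

theorem tri_comm₂₃ (x : Fin (n + 1) → K) (p q r : Fin (d + 1) → K) :
    tri x p q r = tri x p r q := by
  unfold tri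
  refine Finset.sum_congr rfl fun i _ => ?_
  rw [Finset.sum_comm]
  refine Finset.sum_congr rfl fun j _ => Finset.sum_congr rfl fun l _ => ?_
  rw [mul_right_comm (p i) (q l), add_right_comm]

theorem tri_add (x : Fin (n + 1) → K) (p p' q r : Fin (d + 1) → K) :
    tri x (p + p') q r = tri x p q r + tri x p' q r := by
  simp only [tri, Pi.add_apply, add_mul, Finset.sum_add_distrib]

theorem tri_smul (x : Fin (n + 1) → K) (c : K) (p q r : Fin (d + 1) → K) :
    tri x (c • p) q r = c * tri x p q r := by
  simp only [tri, Pi.smul_apply, smul_eq_mul, mul_assoc, Finset.mul_sum]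

theorem tri_add_functional (x y : Fin (n + 1) → K) (p q r : Fin (d + 1) → K) :
    tri (x + y) p q r = tri x p q r + tri y p q r := by
  simp only [tri, Pi.add_apply, mul_add, Finset.sum_add_distrib]

theorem tri_smul_functional (c : K) (x : Fin (n + 1) → K) (p q r : Fin (d + 1) → K) :
    tri (c • x) p q r = c * tri x p q r := by
  simp only [tri, Pi.smul_apply, smul_eq_mul, mul_left_comm _ c, Finset.mul_sum]

theorem tri_eq_sum (x : Fin (n + 1) → K) (p q r : Fin (d + 1) → K) :
    tri x p q r = ∑ m, x m * tri (Pi.single m 1) p q r := by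
  have h : ∀ s : Finset (Fin (n + 1)), tri (∑ m ∈ s, x m • Pi.single m (1 : K)) p q r =
      ∑ m ∈ s, x m * tri (Pi.single m 1) p q r := fun s => by
    classical
    induction s using Finset.induction_on with
    | empty => simp [tri]
    | insert a s ha ih =>
      rw [Finset.sum_insert ha, Finset.sum_insert ha, tri_add_functional, tri_smul_functional, ih]
  rw [← h, ← pi_eq_sum_univ']

theorem map_tri {L : Type*} [Field L] (f : K →+* L) (x : Fin (n + 1) → K)
    (p q r : Fin (d + 1) → K) : f (tri x p q r) =
      tri (fun i => f (x i)) (fun i => f (p i)) (fun i => f (q i)) (fun i => f (r i)) := by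
  simp only [tri, map_sum, map_mul]

theorem tri_veronese (hn : n = 3 * d) (s : Fin 2 → K) (p q r : Fin (d + 1) → K) :
    tri (veronese n s) p q r = (∑ i, p i * veronese d s i) * (∑ i, q i * veronese d s i) *
      (∑ i, r i * veronese d s i) := by
  unfold tri
  rw [Finset.sum_mul_sum, Finset.sum_mul]
  refine Finset.sum_congr rfl fun i _ => ?_
  rw [Finset.sum_mul]
  refine Finset.sum_congr rfl fun j _ => ?_
  rw [Finset.mul_sum]
  refine Finset.sum_congr rfl fun l _ => ?_
  have hi := i.is_lt
  have hj := j.is_lt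
  have hl := l.is_lt
  have h1 : ((Fin.ofNat (n + 1) (i + j + l) : Fin (n + 1)) : ℕ) = i + j + l := by
    rw [Fin.val_ofNat, Nat.mod_eq_of_lt (by omega)]
  have h2 : n - (i + j + l : ℕ) = (d - i) + (d - j) + (d - l) := by omega
  simp only [veronese]
  rw [h1, h2, pow_add, pow_add, pow_add, pow_add]
  ring

/-- A functional on forms of degree `3 d` that vanishes on all triple products of a spanning set of
the forms of degree `d` is zero. -/
theorem eq_zero_of_tri (hn : n = 3 * d) (x : Fin (n + 1) → K) {ι : Type*}
    (P : ι → Fin (d + 1) → K) (hP : Submodule.span K (Set.range P) = ⊤)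
    (h : ∀ i j k, tri x (P i) (P j) (P k) = 0) : x = 0 := by
  have step : ∀ q r, (∀ i, tri x (P i) q r = 0) → ∀ p, tri x p q r = 0 := fun q r hqr p => by
    have hp : p ∈ Submodule.span K (Set.range P) := hP ▸ Submodule.mem_top
    induction hp using Submodule.span_induction with
    | mem p hp => obtain ⟨i, rfl⟩ := hp; exact hqr i
    | zero => simp [tri]
    | add p p' _ _ h1 h2 => rw [tri_add, h1, h2, add_zero]
    | smul c p _ h1 => rw [tri_smul, h1, mul_zero]
  have h1 : ∀ j k p, tri x p (P j) (P k) = 0 := fun j k => step _ _ fun i => h i j k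
  have h2 : ∀ k p q, tri x p q (P k) = 0 := fun k p q => by
    rw [tri_comm₁₂]
    exact step _ _ (fun i => by rw [tri_comm₁₂]; exact h1 i k p) q
  have h3 : ∀ p q r, tri x p q r = 0 := fun p q r => by
    rw [tri_comm₂₃, tri_comm₁₂]
    exact step _ _ (fun i => by rw [tri_comm₁₂, tri_comm₂₃]; exact h2 i p q) r
  ext m
  have hm := m.is_lt
  obtain ⟨i, j, l, hi, hj, hl, hijl⟩ : ∃ i j l : ℕ, i < d + 1 ∧ j < d + 1 ∧ l < d + 1 ∧
      i + j + l = m := by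
    rcases le_total (m : ℕ) d with h | h
    · exact ⟨m, 0, 0, by omega, by omega, by omega, by omega⟩
    rcases le_total (m : ℕ) (2 * d) with h' | h'
    · exact ⟨d, m - d, 0, by omega, by omega, by omega, by omega⟩
    · exact ⟨d, d, m - 2 * d, by omega, by omega, by omega, by omega⟩
  have := h3 (Pi.single ⟨i, hi⟩ 1) (Pi.single ⟨j, hj⟩ 1) (Pi.single ⟨l, hl⟩ 1)
  unfold tri at this
  rw [Finset.sum_eq_single ⟨i, hi⟩, Finset.sum_eq_single ⟨j, hj⟩,
    Finset.sum_eq_single ⟨l, hl⟩] at this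
  · simp only [Pi.single_eq_same, one_mul, hijl] at this
    rw [Pi.zero_apply, ← this]
    congr 1
    ext
    rw [Fin.val_ofNat, Nat.mod_eq_of_lt hm]
  · intro b _ hb; simp [hb]
  · simp
  · intro b _ hb; simp [hb]
  · simp
  · intro b _ hb; simp [hb]
  · simp

end Tri

/-! ### Rational curves on the surface of the subplane -/

section Curves

variable {F K : Type*} [Field F] [Field K] [Algebra F K] {σ : K ≃ₐ[F] K} {n d : ℕ}

variable (σ) in
/-- The conjugates of a binary form with coefficients `ω` over `K`. -/
def conjForm (ω : Fin (d + 1) → K) (k : Fin 3) : Fin (d + 1) → K := fun i => conj σ (ω i) k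

variable (σ) in
/-- `A` is the parametrization `(s, t) ↦ (X² Y, X Y², W X Y)` of a rational curve, where `W` is the
binary form of degree `d` with coefficients `ω` and `X`, `Y` are its conjugates; it takes the
functional `x` on forms of degree `n` to the values of `x` on these three products. -/
def IsConjCurve (ω : Fin (d + 1) → K) (A : (Fin (n + 1) → F) →ₗ[F] V6 F K) : Prop :=
  ∀ x : Fin (n + 1) → F,
    (A x).1 = tri (fun i => algebraMap F K (x i)) (conjForm σ ω 1) (conjForm σ ω 1)
      (conjForm σ ω 2) ∧
    (A x).2.1 = tri (fun i => algebraMap F K (x i)) (conjForm σ ω 1) (conjForm σ ω 2)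
      (conjForm σ ω 2) ∧
    algebraMap F K (A x).2.2 = tri (fun i => algebraMap F K (x i)) (conjForm σ ω 0)
      (conjForm σ ω 1) (conjForm σ ω 2)

theorem map_conj_apply (hσ : IsCubicFrobenius σ) (w : K) (k : Fin 3) :
    σ (conj σ w k) = conj σ w (k + 1) := by
  fin_cases k
  · rfl
  · rfl
  · exact hσ.cube w

theorem map_tri_conj (hσ : IsCubicFrobenius σ) (x : Fin (n + 1) → F) (ω : Fin (d + 1) → K)
    (i j k : Fin 3) :
    σ (tri (fun i => algebraMap F K (x i)) (conjForm σ ω i) (conjForm σ ω j) (conjForm σ ω k)) =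
      tri (fun i => algebraMap F K (x i)) (conjForm σ ω (i + 1)) (conjForm σ ω (j + 1))
        (conjForm σ ω (k + 1)) := by
  have hc : ∀ k, (fun i => σ (conjForm σ ω k i)) = conjForm σ ω (k + 1) := fun k =>
    funext fun i => map_conj_apply hσ _ _
  have hx : (fun i => σ (algebraMap F K (x i))) = fun i => algebraMap F K (x i) :=
    funext fun i => σ.commutes _
  refine (map_tri (σ : K →+* K) (fun i => algebraMap F K (x i)) (conjForm σ ω i) (conjForm σ ω j)
    (conjForm σ ω k)).trans ?_
  change tri (fun i => σ (algebraMap F K (x i))) (fun l => σ (conjForm σ ω i l))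
    (fun l => σ (conjForm σ ω j l)) (fun l => σ (conjForm σ ω k l)) = _
  rw [hx, hc, hc, hc]

theorem exists_isConjCurve (hσ : IsCubicFrobenius σ) (n : ℕ) (ω : Fin (d + 1) → K) :
    ∃ A : (Fin (n + 1) → F) →ₗ[F] V6 F K, IsConjCurve σ ω A := by
  let T : Fin 3 → Fin 3 → Fin 3 → (Fin (n + 1) → F) →ₗ[F] K := fun i j k =>
    { toFun := fun x => tri (fun i => algebraMap F K (x i)) (conjForm σ ω i) (conjForm σ ω j)
        (conjForm σ ω k)
      map_add' := fun x y => by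
        rw [← tri_add_functional]
        congr 1
        ext i
        simp
      map_smul' := fun c x => by
        rw [RingHom.id_apply, Algebra.smul_def c (tri _ _ _ _), ← tri_smul_functional]
        congr 1
        ext i
        simp }
  have hT : ∀ i j k x, T i j k x = tri (fun i => algebraMap F K (x i)) (conjForm σ ω i)
      (conjForm σ ω j) (conjForm σ ω k) := fun _ _ _ _ => rfl
  have hfix : ∀ x, σ (T 0 1 2 x) = T 0 1 2 x := fun x => by
    rw [hT, map_tri_conj hσ, tri_comm₂₃, tri_comm₁₂, show (2 : Fin 3) + 1 = 0 from rfl,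
      show (1 : Fin 3) + 1 = 2 from rfl, show (0 : Fin 3) + 1 = 1 from rfl]
  obtain ⟨g, hg⟩ := hσ.exists_lift (T 0 1 2) hfix
  refine ⟨(T 1 1 2).prod ((T 1 2 2).prod g), fun x => ⟨hT 1 1 2 x, hT 1 2 2 x, ?_⟩⟩
  rw [← hT 0 1 2 x, ← hg x]
  rfl

theorem IsConjCurve.injective (hσ : IsCubicFrobenius σ) {ω : Fin (d + 1) → K}
    {A : (Fin (n + 1) → F) →ₗ[F] V6 F K} (hA : IsConjCurve σ ω A) (hn : n = 3 * d)
    (hω : Submodule.span K (Set.range (conjForm σ ω)) = ⊤)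
    (hcube : ∀ x : Fin (n + 1) → K,
      (∀ i j, i ≠ j → tri x (conjForm σ ω i) (conjForm σ ω i) (conjForm σ ω j) = 0) →
      tri x (conjForm σ ω 0) (conjForm σ ω 1) (conjForm σ ω 2) = 0 →
      tri x (conjForm σ ω 0) (conjForm σ ω 0) (conjForm σ ω 0) = 0) : Function.Injective A := by
  rw [← LinearMap.ker_eq_bot, LinearMap.ker_eq_bot']
  intro x hx
  obtain ⟨h1, h2, h3⟩ := hA x
  rw [hx] at h1 h2 h3
  simp only [Prod.fst_zero, Prod.snd_zero, map_zero] at h1 h2 h3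
  have a1 := congrArg σ h1
  have a2 := congrArg σ a1
  have b1 := congrArg σ h2
  have b2 := congrArg σ b1
  simp only [map_tri_conj hσ, map_zero, show (2 : Fin 3) + 1 = 0 from rfl,
    show (1 : Fin 3) + 1 = 2 from rfl, show (0 : Fin 3) + 1 = 1 from rfl] at a1 a2 b1 b2
  have hsq : ∀ i j, i ≠ j → tri (fun i => algebraMap F K (x i)) (conjForm σ ω i) (conjForm σ ω i)
      (conjForm σ ω j) = 0 := by
    intro i j hij
    fin_cases i <;> fin_cases j <;> simp at hij ⊢
    · exact a2.symm
    · rw [tri_comm₂₃, tri_comm₁₂, ← b1]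
    · rw [tri_comm₂₃, tri_comm₁₂, ← b2]
    · exact h1.symm
    · exact a1.symm
    · rw [tri_comm₂₃, tri_comm₁₂, ← h2]
  have c0 := hcube _ hsq h3.symm
  have c1 := congrArg σ c0
  have c2 := congrArg σ c1
  simp only [map_tri_conj hσ, map_zero, show (1 : Fin 3) + 1 = 2 from rfl,
    show (0 : Fin 3) + 1 = 1 from rfl] at c1 c2
  have hall := eq_zero_of_tri hn _ (conjForm σ ω) hω fun i j k => by
    by_cases hij : i = j
    · subst hij
      by_cases hik : i = k
      · subst hik
        fin_cases i
        · exact c0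
        · exact c1
        · exact c2
      · exact hsq i k hik
    · by_cases hik : i = k
      · subst hik; rw [tri_comm₂₃]; exact hsq i j hij
      · by_cases hjk : j = k
        · subst hjk; rw [tri_comm₁₂, tri_comm₂₃]; exact hsq j i (Ne.symm hij)
        · fin_cases i <;> fin_cases j <;> fin_cases k <;> simp at hij hik hjk ⊢
          · exact h3.symm
          · rw [tri_comm₂₃]; exact h3.symm
          · rw [tri_comm₁₂]; exact h3.symm
          · rw [tri_comm₂₃, tri_comm₁₂]; exact h3.symm
          · rw [tri_comm₁₂, tri_comm₂₃]; exact h3.symm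
          · rw [tri_comm₁₂, tri_comm₂₃, tri_comm₁₂]; exact h3.symm
  ext i
  exact (algebraMap F K).injective (by simpa using congrFun hall i)

/-- The value `W(s, t)` of the binary form with coefficients `ω`. -/
def evalForm (ω : Fin (d + 1) → K) (s : Fin 2 → K) : K := ∑ i, ω i * veronese d s i

theorem algebraMap_veronese (n : ℕ) (s : Fin 2 → F) :
    (fun i => algebraMap F K (veronese n s i)) = veronese n fun i => algebraMap F K (s i) := by
  ext i; simp [veronese]

theorem evalForm_conjForm (ω : Fin (d + 1) → K) (s : Fin 2 → F)
    (k : Fin 3) : evalForm (conjForm σ ω k) (fun i => algebraMap F K (s i)) =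
      conj σ (evalForm ω fun i => algebraMap F K (s i)) k := by
  have h : ∀ i, σ (veronese d (fun i => algebraMap F K (s i)) i) =
      veronese d (fun i => algebraMap F K (s i)) i := fun i => by simp [veronese]
  fin_cases k <;> simp [evalForm, conjForm, h]

/-- The point `(X² Y, X Y², W X Y)` of the curve at parameters in the base field. -/
theorem IsConjCurve.apply_veronese {ω : Fin (d + 1) → K}
    {A : (Fin (n + 1) → F) →ₗ[F] V6 F K} (hA : IsConjCurve σ ω A) (hn : n = 3 * d)
    (s : Fin 2 → F) {w : K} (hw : w = evalForm ω fun i => algebraMap F K (s i)) :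
    (A (veronese n s)).1 = σ w * σ w * σ (σ w) ∧
    (A (veronese n s)).2.1 = σ w * σ (σ w) * σ (σ w) ∧
    algebraMap F K (A (veronese n s)).2.2 = w * σ w * σ (σ w) := by
  obtain ⟨h1, h2, h3⟩ := hA (veronese n s)
  rw [algebraMap_veronese, tri_veronese hn] at h1 h2 h3
  have h := evalForm_conjForm (σ := σ) ω s
  rw [← hw] at h
  simp only [evalForm] at h
  rw [h, h] at h1 h2 h3
  rw [h] at h3
  exact ⟨h1, h2, h3⟩

theorem IsConjCurve.extCoord_extPoint (hσ : IsCubicFrobenius σ) {ω : Fin (d + 1) → K}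
    {A : (Fin (n + 1) → F) →ₗ[F] V6 F K} (hA : IsConjCurve σ ω A) (hn : n = 3 * d)
    (e : V6 F K ≃ₗ[F] V6 F K) (s : Fin 2 → K) :
    extCoord σ e (extPoint (e.toLinearMap ∘ₗ A) s) =
      (fun k => evalForm (conjForm σ ω (k + 1)) s * evalForm (conjForm σ ω (k + 1)) s
        * evalForm (conjForm σ ω (k + 2)) s,
       fun k => evalForm (conjForm σ ω (k + 1)) s * evalForm (conjForm σ ω (k + 2)) s
        * evalForm (conjForm σ ω (k + 2)) s,
       evalForm (conjForm σ ω 0) s * evalForm (conjForm σ ω 1) s * evalForm (conjForm σ ω 2) s) := by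
  have hsingle : ∀ m : Fin (n + 1), (fun i => algebraMap F K ((Pi.single m (1 : F) : _ → F) i)) =
      Pi.single m (1 : K) := fun m => by
    ext i
    by_cases h : i = m
    · subst h; simp
    · simp [h]
  have hA1 : ∀ m k, conj σ (A (Pi.single m 1)).1 k = tri (Pi.single m 1) (conjForm σ ω (k + 1))
      (conjForm σ ω (k + 1)) (conjForm σ ω (k + 2)) := fun m k => by
    have := (hA (Pi.single m 1)).1
    have h1 := congrArg σ this
    have h2 := congrArg σ h1
    rw [map_tri_conj hσ] at h1 h2
    rw [map_tri_conj hσ] at h2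
    rw [hsingle] at this h1 h2
    fin_cases k
    · exact this
    · exact h1
    · exact h2
  have hA2 : ∀ m k, conj σ (A (Pi.single m 1)).2.1 k = tri (Pi.single m 1) (conjForm σ ω (k + 1))
      (conjForm σ ω (k + 2)) (conjForm σ ω (k + 2)) := fun m k => by
    have := (hA (Pi.single m 1)).2.1
    have h1 := congrArg σ this
    have h2 := congrArg σ h1
    rw [map_tri_conj hσ] at h1 h2
    rw [map_tri_conj hσ] at h2
    rw [hsingle] at this h1 h2
    fin_cases k
    · exact this
    · exact h1
    · exact h2
  have hA3 : ∀ m, algebraMap F K (A (Pi.single m 1)).2.2 = tri (Pi.single m 1) (conjForm σ ω 0)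
      (conjForm σ ω 1) (conjForm σ ω 2) := fun m => by
    rw [(hA (Pi.single m 1)).2.2, hsingle]
  have hx : extCoord σ e (extPoint (e.toLinearMap ∘ₗ A) s) = ∑ m, veronese n s m •
      (conj σ (A (Pi.single m 1)).1, conj σ (A (Pi.single m 1)).2.1,
        algebraMap F K (A (Pi.single m 1)).2.2) := by
    rw [extPoint, map_sum]
    exact Finset.sum_congr rfl fun m _ => extCoord_tmul e _ _
  rw [hx]
  simp only [evalForm, ← tri_veronese hn]
  refine Prod.ext ?_ (Prod.ext ?_ ?_)
  · ext k
    simp [Prod.fst_sum, hA1]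
    exact (tri_eq_sum _ _ _ _).symm
  · ext k
    simp [Prod.fst_sum, Prod.snd_sum, hA2]
    exact (tri_eq_sum _ _ _ _).symm
  · simp [Prod.snd_sum, hA3]
    exact (tri_eq_sum _ _ _ _).symm

end Curves

/-! ### Twisted cubics from lines -/

section LineCurves

variable {F K : Type*} [Field F] [Field K] [Algebra F K] {σ : K ≃ₐ[F] K}

theorem evalForm_one (w₁ w₂ : K) (s : Fin 2 → K) :
    evalForm (d := 1) ![w₁, w₂] s = w₁ * s 0 + w₂ * s 1 := by
  simp [evalForm, veronese]

theorem conjForm_one (w₁ w₂ : K) (k : Fin 3) :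
    conjForm (d := 1) σ ![w₁, w₂] k = ![conj σ w₁ k, conj σ w₂ k] := by
  ext i; fin_cases i <;> rfl

/-- The linear relation between the conjugates of a linear form `s w₁ + t w₂`. -/
theorem exists_conjForm_relation (hσ : IsCubicFrobenius σ) {w₁ w₂ : K}
    (h : w₁ * σ w₂ - σ w₁ * w₂ ≠ 0) : ∃ β : K, β ≠ 0 ∧
      β • conjForm (d := 1) σ ![w₁, w₂] 0 + σ β • conjForm (d := 1) σ ![w₁, w₂] 1
        + σ (σ β) • conjForm (d := 1) σ ![w₁, w₂] 2 = 0 := by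
  refine ⟨σ w₁ * σ (σ w₂) - σ (σ w₁) * σ w₂, ?_, ?_⟩
  · have : σ (w₁ * σ w₂ - σ w₁ * w₂) ≠ 0 := (map_ne_zero σ).2 h
    rwa [map_sub, map_mul, map_mul] at this
  · have h1 := (conjTrace_eq_zero_iff hσ h w₁).2 ⟨1, 0, by simp⟩
    have h2 := (conjTrace_eq_zero_iff hσ h w₂).2 ⟨0, 1, by simp⟩
    ext i
    fin_cases i
    · simpa [conjForm_one, conjTrace] using h1
    · simpa [conjForm_one, conjTrace] using h2

theorem IsConjCurve.injective_of_line (hσ : IsCubicFrobenius σ) {w₁ w₂ : K}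
    (h : w₁ * σ w₂ - σ w₁ * w₂ ≠ 0) {A : (Fin 4 → F) →ₗ[F] V6 F K}
    (hA : IsConjCurve (d := 1) (n := 3) σ ![w₁, w₂] A) : Function.Injective A := by
  obtain ⟨β, hβ, hrel⟩ := exists_conjForm_relation hσ h
  refine hA.injective (d := 1) hσ rfl ?_ fun x hx _ => ?_
  · rw [eq_top_iff]
    intro p _
    have h0 : p = ((p 0 * σ w₂ - p 1 * σ w₁) / (w₁ * σ w₂ - σ w₁ * w₂)) •
        conjForm (d := 1) σ ![w₁, w₂] 0 + ((w₁ * p 1 - w₂ * p 0) / (w₁ * σ w₂ - σ w₁ * w₂)) •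
        conjForm (d := 1) σ ![w₁, w₂] 1 := by
      rw [conjForm_one, conjForm_one]
      ext i
      simp only [Pi.add_apply, Pi.smul_apply, smul_eq_mul]
      rw [div_mul_eq_mul_div, div_mul_eq_mul_div, ← add_div, eq_div_iff h]
      fin_cases i <;> simp <;> ring
    rw [h0]
    exact Submodule.add_mem _ (Submodule.smul_mem _ _ (Submodule.subset_span ⟨0, rfl⟩))
      (Submodule.smul_mem _ _ (Submodule.subset_span ⟨1, rfl⟩))
  · have h1 : tri x (β • conjForm (d := 1) σ ![w₁, w₂] 0 + σ β • conjForm (d := 1) σ ![w₁, w₂] 1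
        + σ (σ β) • conjForm (d := 1) σ ![w₁, w₂] 2) (conjForm σ ![w₁, w₂] 0)
        (conjForm σ ![w₁, w₂] 0) = 0 := by
      rw [hrel]; simp [tri]
    rw [tri_add, tri_add, tri_smul, tri_smul, tri_smul] at h1
    have h2 := hx 0 1 (by decide)
    have h3 := hx 0 2 (by decide)
    rw [tri_comm₂₃, tri_comm₁₂] at h2 h3
    rw [h2, h3, mul_zero, mul_zero, add_zero, add_zero] at h1
    exact (mul_eq_zero.1 h1).resolve_left hβ

/-- The curve of a line is a twisted cubic that is special for the splash: its 3-space is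
`β z + σ(β) a + σ²(β) b = 0`, and it meets a transversal line at a zero of `W`, `X` or `Y`. -/
theorem IsConjCurve.isSpecialCubicMap (hσ : IsCubicFrobenius σ) (hK : Module.finrank F K = 3)
    {e : V6 F K ≃ₗ[F] V6 F K} (he : ∀ v, (e v).2.2 = v.2.2) {w₁ w₂ : K}
    (h : w₁ * σ w₂ - σ w₁ * w₂ ≠ 0) {A : (Fin 4 → F) →ₗ[F] V6 F K}
    (hA : IsConjCurve (d := 1) (n := 3) σ ![w₁, w₂] A) :
    IsSpecialCubicMap (planeFamily σ e AlgEquiv.refl) (e.toLinearMap ∘ₗ A) := by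
  have hfd : Module.Finite F K := Module.finite_of_finrank_pos (by omega)
  have hinj := hA.injective_of_line hσ h
  have hinj' : Function.Injective (e.toLinearMap ∘ₗ A) := e.injective.comp hinj
  refine ⟨hinj', ?_, ?_, ?_⟩
  · obtain ⟨β, hβ, hrel⟩ := exists_conjForm_relation hσ h
    have hβ1 : σ β ≠ 0 := by simpa using hβ
    have hβ2 : σ (σ β) ≠ 0 := by simpa using hβ
    let f : V6 F K →ₗ[F] K :=
      LinearMap.mulLeft F β ∘ₗ Algebra.linearMap F K ∘ₗ LinearMap.snd F K F ∘ₗ LinearMap.snd F K _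
      + LinearMap.mulLeft F (σ β) ∘ₗ LinearMap.fst F K _
      + LinearMap.mulLeft F (σ (σ β)) ∘ₗ LinearMap.fst F K F ∘ₗ LinearMap.snd F K _
    have hf : ∀ v, f v = β * algebraMap F K v.2.2 + σ β * v.1 + σ (σ β) * v.2.1 := fun v => rfl
    have hle : LinearMap.range A ≤ LinearMap.ker f := by
      rintro _ ⟨x, rfl⟩
      rw [LinearMap.mem_ker, hf]
      obtain ⟨h1, h2, h3⟩ := hA x
      rw [h1, h2, h3]
      have h4 : tri (fun i => algebraMap F K (x i)) (β • conjForm (d := 1) σ ![w₁, w₂] 0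
          + σ β • conjForm (d := 1) σ ![w₁, w₂] 1
          + σ (σ β) • conjForm (d := 1) σ ![w₁, w₂] 2) (conjForm σ ![w₁, w₂] 1)
          (conjForm σ ![w₁, w₂] 2) = 0 := by
        rw [hrel]; simp [tri]
      rw [tri_add, tri_add, tri_smul, tri_smul, tri_smul,
        tri_comm₁₂ _ (conjForm σ ![w₁, w₂] 2)] at h4
      exact h4
    have hker : Module.finrank F (LinearMap.ker f) ≤ 4 := by
      let g : LinearMap.ker f →ₗ[F] K × F :=
        (LinearMap.prod (LinearMap.fst F K (K × F))
          (LinearMap.snd F K F ∘ₗ LinearMap.snd F K _)) ∘ₗ Submodule.subtype _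
      have hg : Function.Injective g := by
        rw [← LinearMap.ker_eq_bot, LinearMap.ker_eq_bot']
        rintro ⟨v, hv⟩ hgv
        have h1 : v.1 = 0 := congrArg Prod.fst hgv
        have h2 : v.2.2 = 0 := congrArg Prod.snd hgv
        rw [LinearMap.mem_ker, hf, h1, h2, map_zero, mul_zero, mul_zero, zero_add, zero_add] at hv
        have h3 := (mul_eq_zero.1 hv).resolve_left hβ2
        ext <;> simp [h1, h2, h3]
      refine (LinearMap.finrank_le_finrank_of_injective hg).trans ?_
      simp [hK]
    have hrange : LinearMap.range A = LinearMap.ker f := by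
      refine Submodule.eq_of_le_of_finrank_le hle ?_
      rw [LinearMap.finrank_range_of_inj hinj]
      simpa using hker
    refine ⟨_, ⟨(σ β)⁻¹, inv_ne_zero hβ1, rfl⟩, ?_⟩
    rw [LinearMap.range_comp]
    refine Submodule.map_mono ?_
    rw [hrange]
    rintro v ⟨hv0, hv⟩
    rw [LinearMap.mem_ker, hf, hv0]
    simp only [map_inv₀, AlgEquiv.coe_refl, id] at hv
    field_simp at hv
    rw [map_zero]
    linear_combination hv
  · intro hle
    have h1 : e (A (veronese 3 ![1, 0])) ∈ hyperInfty F K := hle ⟨_, rfl⟩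
    have h2 : (A (veronese 3 ![1, 0])).2.2 = 0 := by rw [← he]; exact h1
    obtain ⟨-, -, h3⟩ := hA.apply_veronese (d := 1) rfl ![1, 0] (w := w₁) (by simp [evalForm_one])
    rw [h2, map_zero] at h3
    have hw : w₁ ≠ 0 := by rintro rfl; simp at h
    exact mul_ne_zero (mul_ne_zero hw (by simpa using hw)) (by simpa using hw) h3.symm
  · intro l hl
    obtain ⟨i, hi⟩ := hl.exists_index hσ hK he
    have h0 : evalForm (d := 1) (conjForm (d := 1) σ ![w₁, w₂] i)
        ![-conj σ w₂ i, conj σ w₁ i] = 0 := by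
      rw [conjForm_one, evalForm_one]; simp; ring
    refine ⟨![-conj σ w₂ i, conj σ w₁ i], ?_, hi _ ?_ ?_⟩
    · intro hzero
      have h1 : conj σ w₂ i = 0 := by simpa using congrFun hzero 0
      have h2 : conj σ w₁ i = 0 := by simpa using congrFun hzero 1
      have hz : ∀ w, conj σ w i = 0 → w = 0 := fun w hw => by
        fin_cases i <;> simpa using hw
      rw [hz _ h1, hz _ h2] at h
      simp at h
    · intro k hk
      rw [hA.extCoord_extPoint (d := 1) hσ rfl]
      have hik : ∀ i k : Fin 3, k ≠ i → i = k + 1 ∨ i = k + 2 := by decide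
      rcases hik i k hk with rfl | rfl <;> simp [h0]
    · rw [hA.extCoord_extPoint (d := 1) hσ rfl]
      fin_cases i
      · simp at h0; simp [h0]
      · simp at h0; simp [h0]
      · simp at h0; simp [h0]

end LineCurves

/-! ### Sextics from conics -/

section Ternary

/-- The ternary quadratic form
`q₀ x² + q₁ y² + q₂ z² + q₃ y z + q₄ x z + q₅ x y`. -/
def ternary {R : Type*} [CommRing R] (q : Fin 6 → R) (v : Fin 3 → R) : R :=
  q 0 * v 0 ^ 2 + q 1 * v 1 ^ 2 + q 2 * v 2 ^ 2 + q 3 * (v 1 * v 2) + q 4 * (v 0 * v 2)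
    + q 5 * (v 0 * v 1)

/-- The polar form of `ternary q`. -/
def ternaryPolar {R : Type*} [CommRing R] (q : Fin 6 → R) (u v : Fin 3 → R) : R :=
  2 * q 0 * u 0 * v 0 + 2 * q 1 * u 1 * v 1 + 2 * q 2 * u 2 * v 2
    + q 3 * (u 1 * v 2 + u 2 * v 1) + q 4 * (u 0 * v 2 + u 2 * v 0)
    + q 5 * (u 0 * v 1 + u 1 * v 0)

theorem ternary_add {R : Type*} [CommRing R] (q : Fin 6 → R) (u v : Fin 3 → R) :
    ternary q (u + v) = ternary q u + ternary q v + ternaryPolar q u v := by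
  simp only [ternary, ternaryPolar, Pi.add_apply]; ring

theorem ternary_smul {R : Type*} [CommRing R] (q : Fin 6 → R) (c : R) (v : Fin 3 → R) :
    ternary q (c • v) = c ^ 2 * ternary q v := by
  simp only [ternary, Pi.smul_apply, smul_eq_mul]; ring

theorem map_ternary {R S : Type*} [CommRing R] [CommRing S] (f : R →+* S) (q : Fin 6 → R)
    (v : Fin 3 → R) : f (ternary q v) = ternary (fun i => f (q i)) (fun i => f (v i)) := by
  simp [ternary]

theorem map_ternaryPolar {R S : Type*} [CommRing R] [CommRing S] (f : R →+* S) (q : Fin 6 → R)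
    (u v : Fin 3 → R) : f (ternaryPolar q u v) =
      ternaryPolar (fun i => f (q i)) (fun i => f (u i)) (fun i => f (v i)) := by
  have h2 : f 2 = 2 := map_ofNat f 2
  simp [ternaryPolar, h2]

variable {F K : Type*} [Field F] [Field K] [Algebra F K] {σ : K ≃ₐ[F] K}

/-- If the conic `q = 0` contains the rational curve `(W, X, Y)`, that is, if the coefficients of
the quartic `q(W, X, Y)` in `s`, `t` all vanish, then `q(W, X, Y) R` is annihilated by every
functional, for all quadratic forms `R`. -/
theorem tri_relation_of_conic (q : Fin 6 → K) (c : Fin 3 → Fin 3 → K)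
    (h0 : ternary q (c 0) = 0) (h1 : ternaryPolar q (c 0) (c 1) = 0)
    (h2 : ternaryPolar q (c 0) (c 2) + ternary q (c 1) = 0)
    (h3 : ternaryPolar q (c 1) (c 2) = 0) (h4 : ternary q (c 2) = 0)
    (x : Fin 7 → K) (r : Fin 3 → K) :
    let P : Fin 3 → Fin 3 → K := fun k i => c i k
    q 0 * tri (n := 6) (d := 2) x (P 0) (P 0) r + q 1 * tri (n := 6) (d := 2) x (P 1) (P 1) r
      + q 2 * tri (n := 6) (d := 2) x (P 2) (P 2) r
      + q 3 * tri (n := 6) (d := 2) x (P 1) (P 2) r + q 4 * tri (n := 6) (d := 2) x (P 0) (P 2) r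
      + q 5 * tri (n := 6) (d := 2) x (P 0) (P 1) r = 0 := by
  intro P
  have htri : ∀ a b : Fin 3 → K, tri (n := 6) (d := 2) x a b r =
      a 0 * b 0 * (r 0 * x 0 + r 1 * x 1 + r 2 * x 2)
      + (a 0 * b 1 + a 1 * b 0) * (r 0 * x 1 + r 1 * x 2 + r 2 * x 3)
      + (a 0 * b 2 + a 1 * b 1 + a 2 * b 0) * (r 0 * x 2 + r 1 * x 3 + r 2 * x 4)
      + (a 1 * b 2 + a 2 * b 1) * (r 0 * x 3 + r 1 * x 4 + r 2 * x 5)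
      + a 2 * b 2 * (r 0 * x 4 + r 1 * x 5 + r 2 * x 6) := by
    intro a b
    change ∑ i : Fin 3, ∑ j : Fin 3, ∑ l : Fin 3,
      a i * b j * r l * x (Fin.ofNat 7 (i + j + l)) = _
    simp only [Fin.sum_univ_three]
    change
      (a 0 * b 0 * r 0 * x 0 + a 0 * b 0 * r 1 * x 1 + a 0 * b 0 * r 2 * x 2
      + (a 0 * b 1 * r 0 * x 1 + a 0 * b 1 * r 1 * x 2 + a 0 * b 1 * r 2 * x 3)
      + (a 0 * b 2 * r 0 * x 2 + a 0 * b 2 * r 1 * x 3 + a 0 * b 2 * r 2 * x 4))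
      + (a 1 * b 0 * r 0 * x 1 + a 1 * b 0 * r 1 * x 2 + a 1 * b 0 * r 2 * x 3
      + (a 1 * b 1 * r 0 * x 2 + a 1 * b 1 * r 1 * x 3 + a 1 * b 1 * r 2 * x 4)
      + (a 1 * b 2 * r 0 * x 3 + a 1 * b 2 * r 1 * x 4 + a 1 * b 2 * r 2 * x 5))
      + (a 2 * b 0 * r 0 * x 2 + a 2 * b 0 * r 1 * x 3 + a 2 * b 0 * r 2 * x 4
      + (a 2 * b 1 * r 0 * x 3 + a 2 * b 1 * r 1 * x 4 + a 2 * b 1 * r 2 * x 5)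
      + (a 2 * b 2 * r 0 * x 4 + a 2 * b 2 * r 1 * x 5 + a 2 * b 2 * r 2 * x 6)) = _
    ring
  simp only [htri, P]
  simp only [ternary, ternaryPolar] at h0 h1 h2 h3 h4
  linear_combination (r 0 * x 0 + r 1 * x 1 + r 2 * x 2) * h0
    + (r 0 * x 1 + r 1 * x 2 + r 2 * x 3) * h1 + (r 0 * x 2 + r 1 * x 3 + r 2 * x 4) * h2
    + (r 0 * x 3 + r 1 * x 4 + r 2 * x 5) * h3 + (r 0 * x 4 + r 1 * x 5 + r 2 * x 6) * h4

/-- The curve of a conic avoiding the point `(1, 0, 0)`, given by a basis `ω` of `K`, spans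
`PG(6, q)`: the equation of the conic allows the form `W³` to be expressed by the other products. -/
theorem IsConjCurve.injective_of_conic (hσ : IsCubicFrobenius σ) (q : Fin 6 → K) (hq : q 0 ≠ 0)
    (ω : Fin 3 → K) (hω : ∀ w : K, ∃ c : Fin 3 → F, w = ∑ i, algebraMap F K (c i) * ω i)
    (h0 : ternary q (conj σ (ω 0)) = 0) (h1 : ternaryPolar q (conj σ (ω 0)) (conj σ (ω 1)) = 0)
    (h2 : ternaryPolar q (conj σ (ω 0)) (conj σ (ω 2)) + ternary q (conj σ (ω 1)) = 0)
    (h3 : ternaryPolar q (conj σ (ω 1)) (conj σ (ω 2)) = 0)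
    (h4 : ternary q (conj σ (ω 2)) = 0)
    {A : (Fin 7 → F) →ₗ[F] V6 F K} (hA : IsConjCurve (d := 2) (n := 6) σ ω A) :
    Function.Injective A := by
  refine hA.injective (d := 2) hσ rfl ?_ fun x hx hx' => ?_
  · have hli : LinearIndependent K (conjForm (d := 2) σ ω) := by
      rw [Fintype.linearIndependent_iff]
      intro g hg
      have hi : ∀ i, g 0 * ω i + g 1 * σ (ω i) + g 2 * σ (σ (ω i)) = 0 := fun i => by
        have := congrFun hg i
        simpa [Fin.sum_univ_three, conjForm] using this
      obtain ⟨h1, h2, h3⟩ := hσ.linear (a := g 0) (b := g 1) (c := g 2) fun w => by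
        obtain ⟨c, rfl⟩ := hω w
        simp only [map_add, map_mul, AlgEquiv.commutes, Fin.sum_univ_three]
        linear_combination algebraMap F K (c 0) * hi 0 + algebraMap F K (c 1) * hi 1
          + algebraMap F K (c 2) * hi 2
      intro i
      fin_cases i <;> assumption
    exact hli.span_eq_top_of_card_eq_finrank' (by simp)
  · have key := tri_relation_of_conic q (fun i => conj σ (ω i)) h0 h1 h2 h3 h4 x
      (conjForm (d := 2) σ ω 0)
    change q 0 * tri (n := 6) (d := 2) x (conjForm (d := 2) σ ω 0) (conjForm (d := 2) σ ω 0) _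
      + q 1 * tri (n := 6) (d := 2) x (conjForm (d := 2) σ ω 1) (conjForm (d := 2) σ ω 1) _
      + q 2 * tri (n := 6) (d := 2) x (conjForm (d := 2) σ ω 2) (conjForm (d := 2) σ ω 2) _
      + q 3 * tri (n := 6) (d := 2) x (conjForm (d := 2) σ ω 1) (conjForm (d := 2) σ ω 2) _
      + q 4 * tri (n := 6) (d := 2) x (conjForm (d := 2) σ ω 0) (conjForm (d := 2) σ ω 2) _
      + q 5 * tri (n := 6) (d := 2) x (conjForm (d := 2) σ ω 0) (conjForm (d := 2) σ ω 1) _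
      = 0 at key
    have e1 := hx 1 0 (by decide)
    have e2 := hx 2 0 (by decide)
    have e3 : tri (n := 6) (d := 2) x (conjForm (d := 2) σ ω 1) (conjForm (d := 2) σ ω 2)
        (conjForm (d := 2) σ ω 0) = 0 := by
      rw [tri_comm₂₃, tri_comm₁₂]; exact hx'
    have e4 : tri (n := 6) (d := 2) x (conjForm (d := 2) σ ω 0) (conjForm (d := 2) σ ω 2)
        (conjForm (d := 2) σ ω 0) = 0 := by
      rw [tri_comm₂₃]; exact hx 0 2 (by decide)
    have e5 : tri (n := 6) (d := 2) x (conjForm (d := 2) σ ω 0) (conjForm (d := 2) σ ω 1)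
        (conjForm (d := 2) σ ω 0) = 0 := by
      rw [tri_comm₂₃]; exact hx 0 1 (by decide)
    rw [e1, e2, e3, e4, e5] at key
    simp only [mul_zero, add_zero] at key
    exact (mul_eq_zero.1 key).resolve_left hq

end Ternary

/-! ### Exterior subplanes in conjugate coordinates -/

section Projective

variable {K V : Type*} [Field K] [AddCommGroup V] [Module K V]

theorem mem_submodule_iff {P : ℙ K V} {v : V} (hv : v ≠ 0) :
    v ∈ P.submodule ↔ P = Projectivization.mk K v hv := by
  constructor
  · intro h
    induction P using Projectivization.ind with
    | h u hu =>
      rw [Projectivization.submodule_mk, Submodule.mem_span_singleton] at h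
      obtain ⟨a, ha⟩ := h
      exact ((Projectivization.mk_eq_mk_iff' _ _ _ _ _).2 ⟨a, ha⟩).symm
  · rintro rfl
    rw [Projectivization.submodule_mk]
    exact Submodule.mem_span_singleton_self v

theorem submodule_eq_span {P : ℙ K V} {v : V} (hv : v ≠ 0) (h : v ∈ P.submodule) :
    P.submodule = Submodule.span K {v} := by
  rw [(mem_submodule_iff hv).1 h, Projectivization.submodule_mk]

theorem eq_of_submodule_le {P R : ℙ K V} (h : P.submodule ≤ R.submodule) : P = R := by
  have h1 : P.rep ∈ P.submodule := by
    rw [Projectivization.submodule_eq]; exact Submodule.mem_span_singleton_self _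
  rw [(mem_submodule_iff P.rep_nonzero).1 h1, (mem_submodule_iff P.rep_nonzero).1 (h h1)]

theorem eq_of_mem_submodule {P R : ℙ K V} {v : V} (hv : v ≠ 0) (h : v ∈ P.submodule)
    (h' : v ∈ R.submodule) : P = R := by
  rw [(mem_submodule_iff hv).1 h, (mem_submodule_iff hv).1 h']

theorem exists_mem_submodule (h : V ≃ₗ[K] V) (P : ℙ K V) : ∃ u, u ≠ 0 ∧ h u ∈ P.submodule := by
  refine ⟨h.symm P.rep, ?_, ?_⟩
  · rw [Ne, LinearEquiv.map_eq_zero_iff]; exact P.rep_nonzero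
  · rw [LinearEquiv.apply_symm_apply, Projectivization.submodule_eq]
    exact Submodule.mem_span_singleton_self _

theorem mem_smul_submodule (g : LinearMap.GeneralLinearGroup K V) {P : ℙ K V} {v : V} :
    g • v ∈ (g • P).submodule ↔ v ∈ P.submodule := by
  by_cases hv : v = 0
  · subst hv; rw [smul_zero]; simp
  · have hgv : g • v ≠ 0 := (smul_ne_zero_iff_ne g).2 hv
    rw [mem_submodule_iff hv, mem_submodule_iff hgv]
    constructor
    · intro h
      apply MulAction.injective g
      exact h
    · rintro rfl
      rfl

theorem mem_iff_smul (h : V ≃ₗ[K] V) {P : ℙ K V} {u v : V} (hu : u ≠ 0)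
    (huP : h u ∈ P.submodule) : h v ∈ P.submodule ↔ ∃ c : K, v = c • u := by
  have hu' : h u ≠ 0 := by rwa [Ne, LinearEquiv.map_eq_zero_iff]
  rw [submodule_eq_span hu' huP, Submodule.mem_span_singleton]
  refine exists_congr fun c => ?_
  rw [← map_smul, h.injective.eq_iff, eq_comm]

end Projective

section Frame

variable {F K : Type*} [Field F] [Field K] [Algebra F K] {σ : K ≃ₐ[F] K}

variable (σ) in
/-- The subplane `π` consists of the points `h (w, σ w, σ² w)`, for `w ≠ 0` in `K`, where `h` is a
homography that takes the line with equation `u₀ = 0` to the line at infinity. -/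
structure IsFrame (π : Set (ℙ K (Fin 3 → K))) (h : (Fin 3 → K) ≃ₗ[K] (Fin 3 → K)) : Prop where
  line : ∀ u, h u 2 = u 0
  mem_iff : ∀ P, P ∈ π ↔ ∃ w : K, w ≠ 0 ∧ h (conj σ w) ∈ P.submodule

/-- Every coordinate system of an exterior subplane gives rise to conjugate coordinates: the last
coordinate is an isomorphism `c` of `F³` with `K`. -/
theorem exists_isFrame (hσ : IsCubicFrobenius σ) (hK : Module.finrank F K = 3)
    {π : Set (ℙ K (Fin 3 → K))} (hext : IsExterior π) (g : GL3 K)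
    (hg : π = (fun P => g • P) '' basePlane F K) :
    ∃ (c : (Fin 3 → F) ≃ₗ[F] K) (ν h : (Fin 3 → K) ≃ₗ[K] (Fin 3 → K)),
      (∀ u k, ν u k = ∑ i, u i * conj σ (c (Pi.single i 1)) k) ∧
      (∀ v : Fin 3 → F, ν (fun i => algebraMap F K (v i)) = conj σ (c v)) ∧
      (∀ u, h (ν u) = g • u) ∧ IsFrame σ π h := by
  have hfd : Module.Finite F K := Module.finite_of_finrank_pos (by omega)
  let ι : (Fin 3 → F) →ₗ[F] (Fin 3 → K) :=
    { toFun := fun v i => algebraMap F K (v i)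
      map_add' := fun u v => by ext i; simp
      map_smul' := fun r v => by ext i; simp [Algebra.smul_def] }
  have hι : ∀ v, ι v = fun i => algebraMap F K (v i) := fun v => rfl
  have hι0 : ∀ v, v ≠ 0 → ι v ≠ 0 := fun v hv h0 => hv (by
    ext i
    exact (algebraMap F K).injective (by
      rw [Pi.zero_apply, map_zero]; exact congrFun h0 i))
  let G := g.toLinearEquiv
  have hG : ∀ u, G u = g • u := fun u => rfl
  let c₀ : (Fin 3 → F) →ₗ[F] K :=
    (LinearMap.proj 2 : (Fin 3 → K) →ₗ[F] K) ∘ₗ (G.toLinearMap.restrictScalars F) ∘ₗ ι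
  have hc₀ : ∀ v, c₀ v = G (ι v) 2 := fun v => rfl
  have hc₀inj : Function.Injective c₀ := by
    rw [← LinearMap.ker_eq_bot, LinearMap.ker_eq_bot']
    intro v hv
    by_contra hv0
    have h1 : G (ι v) ≠ 0 := by rw [Ne, LinearEquiv.map_eq_zero_iff]; exact hι0 v hv0
    refine hext (Projectivization.mk K _ h1) ?_ ?_
    · rw [hg]
      refine ⟨Projectivization.mk K (ι v) (hι0 v hv0), ⟨v, hv0, ?_⟩, rfl⟩
      rw [Projectivization.submodule_mk]
      exact Submodule.mem_span_singleton_self _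
    · rw [Projectivization.submodule_mk, Submodule.span_singleton_le_iff_mem]
      exact hv
  let c : (Fin 3 → F) ≃ₗ[F] K := LinearEquiv.ofInjectiveOfFinrankEq c₀ hc₀inj (by simp [hK])
  have hc : ∀ v, c v = G (ι v) 2 := fun v => rfl
  obtain ⟨ν, hν1, hν2⟩ := exists_conj_coordinates hσ c
  refine ⟨c, ν, ν.symm.trans G, hν1, hν2, fun u => by simp [hG], ?_, ?_⟩
  · intro u
    obtain ⟨u, rfl⟩ := ν.surjective u
    have h2 : (LinearMap.proj 2 ∘ₗ G.toLinearMap : (Fin 3 → K) →ₗ[K] K) =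
        LinearMap.proj 0 ∘ₗ ν.toLinearMap := by
      refine LinearMap.pi_ext' fun i => LinearMap.ext_ring ?_
      have h3 : ι (Pi.single i 1) = Pi.single i 1 := by
        ext j
        by_cases hj : j = i
        · subst hj; simp [hι]
        · simp [hι, hj]
      have h4 := congrFun (hν2 (Pi.single i 1)) 0
      have h5 := hc (Pi.single i 1)
      rw [← hι, h3] at h4
      rw [h3] at h5
      change G (Pi.single i 1) 2 = ν (Pi.single i 1) 0
      rw [h4, conj_zero, h5]
    have := LinearMap.congr_fun h2 u
    simpa using this
  · intro P
    rw [hg]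
    constructor
    · rintro ⟨R, ⟨v, hv, hvR⟩, rfl⟩
      refine ⟨c v, by simpa using hv, ?_⟩
      rw [← hν2, LinearEquiv.trans_apply, LinearEquiv.symm_apply_apply]
      exact (mem_smul_submodule g).2 hvR
    · rintro ⟨w, hw, hwP⟩
      obtain ⟨v, rfl⟩ := c.surjective w
      rw [← hν2, LinearEquiv.trans_apply, LinearEquiv.symm_apply_apply] at hwP
      refine ⟨g⁻¹ • P, ⟨v, by simpa using hw, ?_⟩, smul_inv_smul g P⟩
      rw [← mem_smul_submodule g, smul_inv_smul]
      exact hwP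

/-- The coordinate change of `PG(6, q)` that corresponds to the homography `h`. -/
theorem IsFrame.exists_equiv (hK : Module.finrank F K = 3) {π : Set (ℙ K (Fin 3 → K))}
    {h : (Fin 3 → K) ≃ₗ[K] (Fin 3 → K)} (hh : IsFrame σ π h) :
    ∃ e : V6 F K ≃ₗ[F] V6 F K, (∀ v, (e v).2.2 = v.2.2) ∧
      ∀ (P : ℙ K (Fin 3 → K)) v, e v ∈ bb F P ↔
        h ![algebraMap F K v.2.2, v.1, v.2.1] ∈ P.submodule := by
  have hfd : Module.Finite F K := Module.finite_of_finrank_pos (by omega)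
  let j : V6 F K →ₗ[F] (Fin 3 → K) :=
    { toFun := fun v => ![algebraMap F K v.2.2, v.1, v.2.1]
      map_add' := fun u v => by ext i; fin_cases i <;> simp
      map_smul' := fun r v => by ext i; fin_cases i <;> simp [Algebra.smul_def] }
  let f : V6 F K →ₗ[F] (Fin 3 → K) := h.toLinearMap.restrictScalars F ∘ₗ j
  let e₀ : V6 F K →ₗ[F] V6 F K := LinearMap.prod (LinearMap.proj 0 ∘ₗ f)
    (LinearMap.prod (LinearMap.proj 1 ∘ₗ f) (LinearMap.snd F K F ∘ₗ LinearMap.snd F K _))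
  have he₀ : ∀ v, incl F K (e₀ v) = h ![algebraMap F K v.2.2, v.1, v.2.1] := fun v => by
    ext i
    fin_cases i
    · rfl
    · rfl
    · exact (hh.line ![algebraMap F K v.2.2, v.1, v.2.1]).symm
  have hinj : Function.Injective e₀ := by
    rw [← LinearMap.ker_eq_bot, LinearMap.ker_eq_bot']
    intro v hv
    have h1 := he₀ v
    rw [hv, map_zero, eq_comm, LinearEquiv.map_eq_zero_iff] at h1
    ext
    · exact congrFun h1 1
    · exact congrFun h1 2
    · exact (algebraMap F K).injective (by simpa using congrFun h1 0)
  refine ⟨LinearEquiv.ofInjectiveEndo e₀ hinj, fun v => rfl, fun P v => ?_⟩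
  rw [← he₀]
  rfl

/-- In a frame, the Bruck–Bose image of the affine point `w` is spanned by any vector
`(a, b, z)` with `a : b : z = σ w : σ² w : w`. -/
theorem bb_eq_span {h : (Fin 3 → K) ≃ₗ[K] (Fin 3 → K)} {e : V6 F K ≃ₗ[F] V6 F K}
    (he : ∀ (P : ℙ K (Fin 3 → K)) v, e v ∈ bb F P ↔
        h ![algebraMap F K v.2.2, v.1, v.2.1] ∈ P.submodule)
    {P : ℙ K (Fin 3 → K)} {w : K} (hw : w ≠ 0) (hP : h (conj σ w) ∈ P.submodule) {v : V6 F K}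
    (hv1 : w * v.1 = σ w * algebraMap F K v.2.2)
    (hv2 : w * v.2.1 = σ (σ w) * algebraMap F K v.2.2) (hz : v.2.2 ≠ 0) :
    bb F P = Submodule.span F {e v} := by
  have hz' : algebraMap F K v.2.2 ≠ 0 := by simpa using hz
  ext x
  obtain ⟨y, rfl⟩ := e.surjective x
  rw [he, mem_iff_smul h (conj_ne_zero hw) hP, Submodule.mem_span_singleton]
  constructor
  · rintro ⟨c, hc⟩
    have h0 : algebraMap F K y.2.2 = c * w := congrFun hc 0
    have h1 : y.1 = c * σ w := congrFun hc 1
    have h2 : y.2.1 = c * σ (σ w) := congrFun hc 2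
    refine ⟨y.2.2 / v.2.2, ?_⟩
    rw [← map_smul]
    congr 1
    ext
    · rw [Prod.smul_fst, Algebra.smul_def, map_div₀]
      apply mul_left_cancel₀ hw
      rw [h0, h1]; field_simp; linear_combination c * hv1
    · rw [Prod.smul_snd, Prod.smul_fst, Algebra.smul_def, map_div₀]
      apply mul_left_cancel₀ hw
      rw [h0, h2]; field_simp; linear_combination c * hv2
    · simp [hz]
  · rintro ⟨r, hr⟩
    rw [← map_smul, e.injective.eq_iff] at hr
    subst hr
    refine ⟨algebraMap F K r * algebraMap F K v.2.2 / w, ?_⟩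
    ext i
    fin_cases i
    · simp; field_simp
    · simp [Algebra.smul_def]; field_simp; linear_combination algebraMap F K r * hv1
    · simp [Algebra.smul_def]; field_simp; linear_combination algebraMap F K r * hv2

/-- A parametrized curve represents the set of points given by the same parametrization `w` in the
frame. -/
theorem curvePoints_eq_bbSet {h : (Fin 3 → K) ≃ₗ[K] (Fin 3 → K)} {e : V6 F K ≃ₗ[F] V6 F K}
    (he : ∀ (P : ℙ K (Fin 3 → K)) v, e v ∈ bb F P ↔
        h ![algebraMap F K v.2.2, v.1, v.2.1] ∈ P.submodule)
    {n : ℕ} (B : (Fin (n + 1) → F) →ₗ[F] V6 F K) (w : (Fin 2 → F) → K)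
    (hw : ∀ s, s ≠ 0 → w s ≠ 0)
    (h1 : ∀ s, s ≠ 0 → w s * (B (veronese n s)).1 =
      σ (w s) * algebraMap F K (B (veronese n s)).2.2)
    (h2 : ∀ s, s ≠ 0 → w s * (B (veronese n s)).2.1 =
      σ (σ (w s)) * algebraMap F K (B (veronese n s)).2.2)
    (h3 : ∀ s, s ≠ 0 → (B (veronese n s)).2.2 ≠ 0)
    {C : Set (ℙ K (Fin 3 → K))}
    (hC : ∀ P, P ∈ C ↔ ∃ s, s ≠ 0 ∧ h (conj σ (w s)) ∈ P.submodule) :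
    curvePoints (e.toLinearMap ∘ₗ B) = bbSet F C := by
  have hne : ∀ s, s ≠ 0 → h (conj σ (w s)) ≠ 0 := fun s hs => by
    rw [Ne, LinearEquiv.map_eq_zero_iff]; exact conj_ne_zero (hw s hs)
  ext p
  constructor
  · rintro ⟨s, hs, hp⟩
    have hmem : h (conj σ (w s)) ∈ (Projectivization.mk K _ (hne s hs)).submodule :=
      (mem_submodule_iff (hne s hs)).2 rfl
    refine ⟨Projectivization.mk K _ (hne s hs), (hC _).2 ⟨s, hs, hmem⟩, ?_⟩
    rw [bb_eq_span he (hw s hs) hmem (h1 s hs) (h2 s hs) (h3 s hs), hp]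
    rfl
  · rintro ⟨P, hP, hp⟩
    obtain ⟨s, hs, hmem⟩ := (hC P).1 hP
    rw [bb_eq_span he (hw s hs) hmem (h1 s hs) (h2 s hs) (h3 s hs)] at hp
    refine ⟨s, hs, ?_⟩
    have h0 : e (B (veronese n s)) ≠ 0 := by
      rw [Ne, LinearEquiv.map_eq_zero_iff]
      intro h0
      apply h3 s hs
      rw [h0]; rfl
    rw [← Projectivization.submodule_mk _ h0] at hp
    rw [eq_of_submodule_le hp, Projectivization.submodule_mk]
    rfl

theorem ne_of_conj_det {h : (Fin 3 → K) ≃ₗ[K] (Fin 3 → K)} {P R : ℙ K (Fin 3 → K)} {w₁ w₂ : K}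
    (h₁ : w₁ ≠ 0) (hP : h (conj σ w₁) ∈ P.submodule)
    (hR : h (conj σ w₂) ∈ R.submodule) (hdet : w₁ * σ w₂ - σ w₁ * w₂ ≠ 0) : P ≠ R := by
  rintro rfl
  obtain ⟨c, hc⟩ := (mem_iff_smul h (conj_ne_zero h₁) hP).1 hR
  apply hdet
  have e0 := congrFun hc 0
  have e1 := congrFun hc 1
  simp only [conj_zero, conj_one, Pi.smul_apply, smul_eq_mul] at e0 e1
  rw [e1, e0]; ring

theorem conj_det_ne_zero_of_ne (hσ : IsCubicFrobenius σ) {h : (Fin 3 → K) ≃ₗ[K] (Fin 3 → K)}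
    {P R : ℙ K (Fin 3 → K)} {w₁ w₂ : K} (h₁ : w₁ ≠ 0) (h₂ : w₂ ≠ 0)
    (hP : h (conj σ w₁) ∈ P.submodule) (hR : h (conj σ w₂) ∈ R.submodule) (hne : P ≠ R) :
    w₁ * σ w₂ - σ w₁ * w₂ ≠ 0 := by
  refine conj_det_ne_zero hσ h₁ fun s hs => hne ?_
  have h0 : h (conj σ w₂) ≠ 0 := by
    rw [Ne, LinearEquiv.map_eq_zero_iff]; exact conj_ne_zero h₂
  refine eq_of_mem_submodule h0 ?_ hR
  rw [hs, conj_smul, map_smul]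
  exact Submodule.smul_mem _ _ hP

theorem coverPlane_congr (ρ : K ≃ₐ[F] K) {u u' : K} (hu : u ≠ 0) (hu' : u' ≠ 0)
    (h : u * σ u' = u' * σ u) : coverPlane σ ρ u = coverPlane σ ρ u' := by
  ext v
  rw [mem_coverPlane, mem_coverPlane]
  refine and_congr_right fun _ => ?_
  constructor
  · intro h'
    apply mul_left_cancel₀ hu
    linear_combination u' * h' + ρ v.1 * h
  · intro h'
    apply mul_left_cancel₀ hu'
    linear_combination u * h' - ρ v.1 * h

/-- In conjugate coordinates, the splash consists of the planes of the family for `ρ = 1`. -/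
theorem IsFrame.splashPlanes_eq (hσ : IsCubicFrobenius σ) {π : Set (ℙ K (Fin 3 → K))}
    {h : (Fin 3 → K) ≃ₗ[K] (Fin 3 → K)} (hh : IsFrame σ π h) {e : V6 F K ≃ₗ[F] V6 F K}
    (he : ∀ (P : ℙ K (Fin 3 → K)) v, e v ∈ bb F P ↔
        h ![algebraMap F K v.2.2, v.1, v.2.1] ∈ P.submodule) :
    splashPlanes F π = planeFamily σ e AlgEquiv.refl := by
  -- the point at infinity of the line joining the points `w₁` and `w₂`
  have hbb : ∀ D : K, D ≠ 0 → ∀ X : ℙ K (Fin 3 → K), h ![0, D, -σ (σ D)] ∈ X.submodule →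
      bb F X = (coverPlane σ AlgEquiv.refl (σ (σ D))⁻¹).map e.toLinearMap := by
    intro D hD X hX
    have hD2 : σ (σ D) ≠ 0 := by simpa using hD
    ext x
    obtain ⟨v, rfl⟩ := e.surjective x
    rw [he, mem_map_equiv, mem_coverPlane, mem_iff_smul h (fun h0 => hD (congrFun h0 1)) hX]
    simp only [map_inv₀, hσ.cube, AlgEquiv.coe_refl, id]
    constructor
    · rintro ⟨c, hc⟩
      have h0 := congrFun hc 0
      have h1 : v.1 = c * D := congrFun hc 1
      have h2 : v.2.1 = c * -σ (σ D) := congrFun hc 2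
      refine ⟨by simpa using h0, ?_⟩
      rw [h1, h2]; field_simp; ring
    · rintro ⟨h0, h1⟩
      refine ⟨v.1 / D, ?_⟩
      field_simp at h1
      ext i
      fin_cases i
      · simp [h0]
      · simp; field_simp
      · simp; field_simp; linear_combination h1
  have hcomb : ∀ w₁ w₂ : K, ![0, w₁ * σ w₂ - σ w₁ * w₂, -σ (σ (w₁ * σ w₂ - σ w₁ * w₂))] =
      (-w₂) • conj σ w₁ + w₁ • conj σ w₂ := by
    intro w₁ w₂
    ext i
    fin_cases i
    · simp; ring
    · simp; ring
    · simp [hσ.cube]; ring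
  ext α
  constructor
  · rintro ⟨X, ⟨hXinf, P, hP, R, hR, hne, hX⟩, rfl⟩
    obtain ⟨w₁, hw₁, hP⟩ := (hh.mem_iff P).1 hP
    obtain ⟨w₂, hw₂, hR⟩ := (hh.mem_iff R).1 hR
    have hD := conj_det_ne_zero_of_ne hσ hw₁ hw₂ hP hR hne
    have hD2 : σ (σ (w₁ * σ w₂ - σ w₁ * w₂)) ≠ 0 :=
      (map_ne_zero σ).2 ((map_ne_zero σ).2 hD)
    refine ⟨_, inv_ne_zero hD2, hbb _ hD X ?_⟩
    obtain ⟨u, hu, huX⟩ := exists_mem_submodule h X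
    have hu0 : u 0 = 0 := by rw [← hh.line u]; exact hXinf huX
    have h1 := hX huX
    rw [submodule_eq_span (by rw [Ne, LinearEquiv.map_eq_zero_iff]; exact conj_ne_zero hw₁) hP,
      submodule_eq_span (by rw [Ne, LinearEquiv.map_eq_zero_iff]; exact conj_ne_zero hw₂) hR,
      ← Submodule.span_union, Set.singleton_union, Submodule.mem_span_pair] at h1
    obtain ⟨a, b, hab⟩ := h1
    rw [← map_smul, ← map_smul, ← map_add, h.injective.eq_iff] at hab
    rw [mem_iff_smul h hu huX, hcomb]
    have h2 : a * w₁ + b * w₂ = 0 := by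
      have := congrFun hab 0
      rw [hu0] at this
      exact this
    -- `(a, b)` is proportional to `(-w₂, w₁)`
    have hb : b ≠ 0 := by
      rintro rfl
      have ha : a = 0 := by simpa [hw₁] using h2
      apply hu
      rw [← hab, ha]; simp
    refine ⟨w₁ / b, ?_⟩
    rw [← hab, smul_add, smul_smul, smul_smul, div_mul_cancel₀ _ hb]
    congr 2
    field_simp
    linear_combination -h2
  · rintro ⟨u, hu, rfl⟩
    obtain ⟨β, hβ⟩ := σ.surjective u⁻¹
    have hβ0 : β ≠ 0 := by rintro rfl; rw [map_zero] at hβ; exact inv_ne_zero hu hβ.symm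
    have hσβ : σ β ≠ 0 := by simpa using hβ0
    obtain ⟨w₁, w₂, hD, hw⟩ := exists_basis_conjTrace hσ hβ0
    have e1 := (hw w₁).2 ⟨1, 0, by simp⟩
    have e2 := (hw w₂).2 ⟨0, 1, by simp⟩
    have hw₁ : w₁ ≠ 0 := by rintro rfl; simp at hD
    have hw₂ : w₂ ≠ 0 := by rintro rfl; simp at hD
    have hD2 : σ (σ (w₁ * σ w₂ - σ w₁ * w₂)) ≠ 0 :=
      (map_ne_zero σ).2 ((map_ne_zero σ).2 hD)
    have hn1 : h (conj σ w₁) ≠ 0 := by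
      rw [Ne, LinearEquiv.map_eq_zero_iff]; exact conj_ne_zero hw₁
    have hn2 : h (conj σ w₂) ≠ 0 := by
      rw [Ne, LinearEquiv.map_eq_zero_iff]; exact conj_ne_zero hw₂
    have hn3 : h ![0, w₁ * σ w₂ - σ w₁ * w₂, -σ (σ (w₁ * σ w₂ - σ w₁ * w₂))] ≠ 0 := by
      rw [Ne, LinearEquiv.map_eq_zero_iff]; exact fun h0 => hD (congrFun h0 1)
    have hm1 := (mem_submodule_iff (P := Projectivization.mk K _ hn1) hn1).2 rfl
    have hm2 := (mem_submodule_iff (P := Projectivization.mk K _ hn2) hn2).2 rfl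
    have hm3 := (mem_submodule_iff (P := Projectivization.mk K _ hn3) hn3).2 rfl
    refine ⟨Projectivization.mk K _ hn3, ⟨?_, Projectivization.mk K _ hn1,
      (hh.mem_iff _).2 ⟨w₁, hw₁, hm1⟩, Projectivization.mk K _ hn2,
      (hh.mem_iff _).2 ⟨w₂, hw₂, hm2⟩, ne_of_conj_det hw₁ hm1 hm2 hD, ?_⟩, ?_⟩
    · rw [Projectivization.submodule_mk, Submodule.span_singleton_le_iff_mem]
      exact hh.line ![0, w₁ * σ w₂ - σ w₁ * w₂, -σ (σ (w₁ * σ w₂ - σ w₁ * w₂))]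
    · rw [Projectivization.submodule_mk, Submodule.span_singleton_le_iff_mem, hcomb, map_add,
        map_smul, map_smul]
      exact Submodule.add_mem_sup (Submodule.smul_mem _ _ hm1) (Submodule.smul_mem _ _ hm2)
    · rw [hbb _ hD _ hm3]
      congr 1
      refine coverPlane_congr _ (inv_ne_zero hD2) hu ?_
      have hu' : u = (σ β)⁻¹ := by rw [hβ, inv_inv]
      have hβ2 : σ (σ β) ≠ 0 := by simpa using hβ0
      rw [hu']
      simp only [map_inv₀, hσ.cube]
      rw [← mul_inv, ← mul_inv, inv_inj]
      simp only [map_sub, map_mul, hσ.cube]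
      simp only [conjTrace] at e1 e2
      linear_combination w₂ * e1 - w₁ * e2

end Frame

/-! ### The fixed points of the group of the subplane and the line at infinity -/

section FixedPoints

variable {F K : Type*} [Field F] [Field K] [Algebra F K] {σ : K ≃ₐ[F] K}

theorem image_smul_eq {K V : Type*} [Field K] [AddCommGroup V] [Module K V]
    (g : LinearMap.GeneralLinearGroup K V) (S : Set (ℙ K V)) (h1 : ∀ R ∈ S, g • R ∈ S)
    (h2 : ∀ R ∈ S, g⁻¹ • R ∈ S) : (fun R => g • R) '' S = S := by
  ext R
  constructor
  · rintro ⟨R, hR, rfl⟩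
    exact h1 R hR
  · intro hR
    exact ⟨g⁻¹ • R, h2 R hR, smul_inv_smul g R⟩

theorem conj_mul (a b : K) (k : Fin 3) : conj σ (a * b) k = conj σ a k * conj σ b k := by
  fin_cases k <;> simp

theorem conj_apply_ne_zero {a : K} (ha : a ≠ 0) (k : Fin 3) : conj σ a k ≠ 0 := by
  fin_cases k <;> simpa using ha

variable (σ) in
/-- The coordinatewise multiplication by the conjugates of `a`, which extends the multiplication by
`a` on the points `conj σ w`. -/
def conjMul (a : K) (ha : a ≠ 0) : (Fin 3 → K) ≃ₗ[K] (Fin 3 → K) where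
  toFun u k := conj σ a k * u k
  map_add' u v := by ext k; simp [mul_add]
  map_smul' r u := by ext k; simp [mul_left_comm]
  invFun u k := (conj σ a k)⁻¹ * u k
  left_inv u := by ext k; exact inv_mul_cancel_left₀ (conj_apply_ne_zero ha k) _
  right_inv u := by ext k; exact mul_inv_cancel_left₀ (conj_apply_ne_zero ha k) _

theorem conjMul_apply (a : K) (ha : a ≠ 0) (u : Fin 3 → K) (k : Fin 3) :
    conjMul σ a ha u k = conj σ a k * u k := rfl

theorem conjMul_conj (a : K) (ha : a ≠ 0) (w : K) :
    conjMul σ a ha (conj σ w) = conj σ (a * w) := by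
  ext k; rw [conjMul_apply, conj_mul]

theorem conjMul_symm_apply (a : K) (ha : a ≠ 0) (u : Fin 3 → K) (k : Fin 3) :
    (conjMul σ a ha).symm u k = (conj σ a k)⁻¹ * u k := rfl

theorem conjMul_symm_conj (a : K) (ha : a ≠ 0) (w : K) :
    (conjMul σ a ha).symm (conj σ w) = conj σ (a⁻¹ * w) := by
  rw [LinearEquiv.symm_apply_eq, conjMul_conj, mul_inv_cancel_left₀ ha]

variable {π : Set (ℙ K (Fin 3 → K))} {h : (Fin 3 → K) ≃ₗ[K] (Fin 3 → K)}

theorem le_lineInfty_iff (hh : IsFrame σ π h) {R : ℙ K (Fin 3 → K)} {u : Fin 3 → K} (hu : u ≠ 0)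
    (huR : h u ∈ R.submodule) : R.submodule ≤ lineInfty K ↔ u 0 = 0 := by
  rw [submodule_eq_span (by rwa [Ne, LinearEquiv.map_eq_zero_iff]) huR,
    Submodule.span_singleton_le_iff_mem, ← hh.line u]
  rfl

/-- A point fixed by the group of `π` and the line at infinity is one of the three points with a
single nonzero conjugate coordinate: the group contains the multiplications by elements of `K`,
which are diagonal, with distinct eigenvalues. -/
theorem IsFrame.exists_of_mem_fixedPoints (hσ : IsCubicFrobenius σ) (hh : IsFrame σ π h)
    {P : ℙ K (Fin 3 → K)} (hP : P ∈ fixedPoints π) :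
    ∃ i : Fin 3, h (Pi.single i 1) ∈ P.submodule := by
  obtain ⟨a, ha⟩ := hσ.exists_notMem
  have ha0 : a ≠ 0 := by rintro rfl; simp at ha
  let L : (Fin 3 → K) ≃ₗ[K] (Fin 3 → K) := (h.symm.trans (conjMul σ a ha0)).trans h
  let g : GL3 K := LinearMap.GeneralLinearGroup.ofLinearEquiv L
  have hg : ∀ u, g • h u = h (conjMul σ a ha0 u) := fun u => by
    change L (h u) = _
    simp [L]
  have hg' : ∀ u, g⁻¹ • h u = h ((conjMul σ a ha0).symm u) := fun u => by
    rw [inv_smul_eq_iff, hg, LinearEquiv.apply_symm_apply]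
  have hfix : g • P = P := by
    refine hP g (image_smul_eq g π ?_ ?_) (image_smul_eq g _ ?_ ?_)
    · intro R hR
      obtain ⟨w, hw, hwR⟩ := (hh.mem_iff R).1 hR
      refine (hh.mem_iff _).2 ⟨a * w, mul_ne_zero ha0 hw, ?_⟩
      rw [← conjMul_conj a ha0, ← hg]
      exact (mem_smul_submodule g).2 hwR
    · intro R hR
      obtain ⟨w, hw, hwR⟩ := (hh.mem_iff R).1 hR
      refine (hh.mem_iff _).2 ⟨a⁻¹ * w, mul_ne_zero (inv_ne_zero ha0) hw, ?_⟩
      rw [← conjMul_symm_conj a ha0, ← hg']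
      exact (mem_smul_submodule g⁻¹).2 hwR
    · intro R hR
      obtain ⟨u, hu, huR⟩ := exists_mem_submodule h R
      have h1 : h (conjMul σ a ha0 u) ∈ (g • R).submodule := by
        rw [← hg]; exact (mem_smul_submodule g).2 huR
      rw [Set.mem_ofPred_eq, le_lineInfty_iff hh (by simpa using hu) h1, conjMul_apply,
        (le_lineInfty_iff hh hu huR).1 hR, mul_zero]
    · intro R hR
      obtain ⟨u, hu, huR⟩ := exists_mem_submodule h R
      have h1 : h ((conjMul σ a ha0).symm u) ∈ (g⁻¹ • R).submodule := by
        rw [← hg']; exact (mem_smul_submodule g⁻¹).2 huR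
      rw [Set.mem_ofPred_eq, le_lineInfty_iff hh (by simpa using hu) h1, conjMul_symm_apply,
        (le_lineInfty_iff hh hu huR).1 hR, mul_zero]
  obtain ⟨u, hu, huP⟩ := exists_mem_submodule h P
  have h1 : h (conjMul σ a ha0 u) ∈ P.submodule := by
    have h2 := (mem_smul_submodule g).2 huP
    rwa [hfix, hg] at h2
  obtain ⟨c, hc⟩ := (mem_iff_smul h hu huP).1 h1
  have hne : ∀ j k, j ≠ k → conj σ a j ≠ conj σ a k := by
    have h01 : a ≠ σ a := Ne.symm ha
    have h02 : a ≠ σ (σ a) := fun h => ha (hσ.eq_of_sq h.symm)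
    intro j k hjk
    fin_cases j <;> fin_cases k <;> simp at hjk ⊢
    exacts [h01, h02, ha, h01, h02.symm, ha]
  obtain ⟨i, hi⟩ := Function.ne_iff.1 hu
  have hi : u i ≠ 0 := hi
  refine ⟨i, (mem_iff_smul h hu huP).2 ⟨(u i)⁻¹, ?_⟩⟩
  have hci : conj σ a i = c := mul_right_cancel₀ hi (congrFun hc i)
  ext j
  by_cases hj : j = i
  · subst hj; simp [hi]
  · have h2 : conj σ a j * u j = c * u j := congrFun hc j
    have h3 : u j = 0 := by
      by_contra h0
      exact hne j i hj ((mul_right_cancel₀ h0 h2).trans hci.symm)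
    simp [hj, h3]

/-- A linear map that fixes the form `u₀` up to a factor and maps points with conjugate coordinates
to such points is diagonal, by comparison of quadratic forms in the conjugates. -/
theorem IsCubicFrobenius.diagonal_of_preserves (hσ : IsCubicFrobenius σ)
    (M : (Fin 3 → K) ≃ₗ[K] (Fin 3 → K)) (hM0 : ∀ u, u 0 = 0 → M u 0 = 0)
    (hM : ∀ w, w ≠ 0 → ∃ μ w' : K, M (conj σ w) = μ • conj σ w') (i : Fin 3) :
    ∃ c : K, M (Pi.single i 1) = c • Pi.single i 1 := by
  have hexp : ∀ u k, M u k = u 0 * M (Pi.single 0 1) k + u 1 * M (Pi.single 1 1) k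
      + u 2 * M (Pi.single 2 1) k := fun u k => by
    conv_lhs => rw [pi_eq_sum_univ' u, map_sum]
    simp [Fin.sum_univ_three]
  obtain ⟨m, hm⟩ : ∃ m, M (Pi.single 0 1) 0 = m := ⟨_, rfl⟩
  have hm1 : M (Pi.single 1 1) 0 = 0 := hM0 _ (by simp)
  have hm2 : M (Pi.single 2 1) 0 = 0 := hM0 _ (by simp)
  obtain ⟨x₀, hx₀⟩ : ∃ m, M (Pi.single 0 1) 1 = m := ⟨_, rfl⟩
  obtain ⟨x₁, hx₁⟩ : ∃ m, M (Pi.single 1 1) 1 = m := ⟨_, rfl⟩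
  obtain ⟨x₂, hx₂⟩ : ∃ m, M (Pi.single 2 1) 1 = m := ⟨_, rfl⟩
  obtain ⟨y₀, hy₀⟩ : ∃ m, M (Pi.single 0 1) 2 = m := ⟨_, rfl⟩
  obtain ⟨y₁, hy₁⟩ : ∃ m, M (Pi.single 1 1) 2 = m := ⟨_, rfl⟩
  obtain ⟨y₂, hy₂⟩ : ∃ m, M (Pi.single 2 1) 2 = m := ⟨_, rfl⟩
  have hm0 : m ≠ 0 := by
    rintro rfl
    obtain ⟨u, hu⟩ := M.surjective (Pi.single 0 1)
    have h1 := hexp u 0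
    rw [hu, hm, hm1, hm2] at h1
    simp at h1
  have hσm : σ m ≠ 0 := by simpa using hm0
  have key : ∀ w, (y₀ * w + y₁ * σ w + y₂ * σ (σ w)) * σ w * σ m
      - (x₀ * w + x₁ * σ w + x₂ * σ (σ w)) * σ (x₀ * w + x₁ * σ w + x₂ * σ (σ w)) = 0 := by
    intro w
    by_cases hw : w = 0
    · subst hw; simp
    obtain ⟨μ, w', hμ⟩ := hM w hw
    have e0 := (hexp (conj σ w) 0).symm.trans (congrFun hμ 0)
    have e1 := (hexp (conj σ w) 1).symm.trans (congrFun hμ 1)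
    have e2 := (hexp (conj σ w) 2).symm.trans (congrFun hμ 2)
    simp only [conj_zero, conj_one, conj_two, hm, hm1, hm2, hx₀, hx₁, hx₂, hy₀, hy₁, hy₂,
      mul_zero, add_zero, Pi.smul_apply, smul_eq_mul] at e0 e1 e2
    have e0' := congrArg σ e0
    rw [map_mul, map_mul] at e0'
    rw [show x₀ * w + x₁ * σ w + x₂ * σ (σ w) = μ * σ w' by rw [← e1]; ring,
      show y₀ * w + y₁ * σ w + y₂ * σ (σ w) = μ * σ (σ w') by rw [← e2]; ring, map_mul]
    linear_combination μ * σ (σ w') * e0'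
  obtain ⟨q1, q2, q3, q4, q5, q6⟩ := hσ.quadratic (-(x₀ * σ x₂)) (y₁ * σ m - x₁ * σ x₀)
    (-(x₂ * σ x₁)) (y₂ * σ m - x₁ * σ x₁ - x₂ * σ x₀) (-(x₀ * σ x₁) - x₂ * σ x₂)
    (y₀ * σ m - x₀ * σ x₀ - x₁ * σ x₂) fun w => by
      have := key w
      simp only [map_add, map_mul, hσ.cube] at this
      linear_combination this
  have hx2 : x₂ = 0 := by
    by_contra h0
    have h2 : σ x₂ ≠ 0 := by simpa using h0
    have h1 : x₀ = 0 := (mul_eq_zero.1 (neg_eq_zero.1 q1)).resolve_right h2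
    rw [h1] at q5
    exact mul_ne_zero h0 h2 (by linear_combination -q5)
  subst hx2
  have hx1 : x₁ ≠ 0 := by
    intro h0
    subst h0
    have hy1 : y₁ = 0 := (mul_eq_zero.1 (by linear_combination q2)).resolve_right hσm
    have : M (Pi.single 1 1) = 0 := by
      ext k
      fin_cases k
      · exact hm1
      · exact hx₁
      · exact hy₁.trans hy1
    rw [LinearEquiv.map_eq_zero_iff] at this
    simpa using congrFun this 1
  have hx0 : x₀ = 0 := by
    have : x₀ * σ x₁ = 0 := by rw [map_zero, mul_zero] at q5; linear_combination -q5
    exact (mul_eq_zero.1 this).resolve_right (by simpa using hx1)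
  subst hx0
  have hy1 : y₁ = 0 := by
    rw [map_zero, mul_zero, sub_zero] at q2
    exact (mul_eq_zero.1 q2).resolve_right hσm
  have hy0 : y₀ = 0 := by
    rw [map_zero, mul_zero, mul_zero, sub_zero, sub_zero] at q6
    exact (mul_eq_zero.1 q6).resolve_right hσm
  fin_cases i
  · refine ⟨m, ?_⟩
    ext k; fin_cases k <;> simp [hm, hx₀, hy₀, hy0]
  · refine ⟨x₁, ?_⟩
    ext k; fin_cases k <;> simp [hm1, hx₁, hy₁, hy1]
  · refine ⟨y₂, ?_⟩
    ext k; fin_cases k <;> simp [hm2, hx₂, hy₂]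

theorem IsFrame.mem_fixedPoints (hσ : IsCubicFrobenius σ) (hh : IsFrame σ π h)
    {P : ℙ K (Fin 3 → K)} {i : Fin 3} (hP : h (Pi.single i 1) ∈ P.submodule) :
    P ∈ fixedPoints π := by
  intro g hgπ hgl
  let M : (Fin 3 → K) ≃ₗ[K] (Fin 3 → K) := (h.trans g.toLinearEquiv).trans h.symm
  have hM : ∀ u, h (M u) = g • h u := fun u => by
    change h (h.symm (g • h u)) = _
    rw [LinearEquiv.apply_symm_apply]
  obtain ⟨c, hc⟩ := hσ.diagonal_of_preserves M (fun u hu0 => by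
    by_cases hu : u = 0
    · rw [hu, map_zero]; rfl
    have hne : h u ≠ 0 := by rwa [Ne, LinearEquiv.map_eq_zero_iff]
    have hmem := (mem_submodule_iff (P := Projectivization.mk K _ hne) hne).2 rfl
    have h1 : g • Projectivization.mk K _ hne ∈ {R | R.submodule ≤ lineInfty K} := by
      rw [← hgl]
      exact ⟨_, (le_lineInfty_iff hh hu hmem).2 hu0, rfl⟩
    have h2 : h (M u) ∈ (g • Projectivization.mk K _ hne).submodule := by
      rw [hM]; exact (mem_smul_submodule g).2 hmem
    exact (le_lineInfty_iff hh (by simpa using hu) h2).1 h1) (fun w hw => by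
    have hne : h (conj σ w) ≠ 0 := by
      rw [Ne, LinearEquiv.map_eq_zero_iff]; exact conj_ne_zero hw
    have hmem := (mem_submodule_iff (P := Projectivization.mk K _ hne) hne).2 rfl
    have h1 : g • Projectivization.mk K _ hne ∈ π := by
      rw [← hgπ]
      exact ⟨_, (hh.mem_iff _).2 ⟨w, hw, hmem⟩, rfl⟩
    obtain ⟨w', hw', h2⟩ := (hh.mem_iff _).1 h1
    have h3 : h (M (conj σ w)) ∈ (g • Projectivization.mk K _ hne).submodule := by
      rw [hM]; exact (mem_smul_submodule g).2 hmem
    obtain ⟨c, hc⟩ := (mem_iff_smul h (conj_ne_zero hw') h2).1 h3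
    exact ⟨c, w', hc⟩) i
  have h1 : h (M (Pi.single i 1)) ∈ (g • P).submodule := by
    rw [hM]; exact (mem_smul_submodule g).2 hP
  have hne : M (Pi.single i 1) ≠ 0 := by
    rw [Ne, LinearEquiv.map_eq_zero_iff]
    exact fun h0 => one_ne_zero (α := K) (by simpa using congrFun h0 i)
  refine eq_of_mem_submodule (v := h (M (Pi.single i 1)))
    (by rwa [Ne, LinearEquiv.map_eq_zero_iff]) h1 ?_
  rw [hc, map_smul]
  exact Submodule.smul_mem _ _ hP

end FixedPoints

/-! ### The tangent cover -/

section Tangent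

variable {F K : Type*} [Field F] [Field K] [Algebra F K] {σ : K ≃ₐ[F] K}
  {π : Set (ℙ K (Fin 3 → K))} {h : (Fin 3 → K) ≃ₗ[K] (Fin 3 → K)}

/-- The line of `π` joining two of its points consists of the points whose coordinates lie in the
`F`-span of the coordinates `w₁`, `w₂`. -/
theorem IsFrame.mem_line_iff (hσ : IsCubicFrobenius σ) (hh : IsFrame σ π h) {w₁ w₂ : K}
    (hdet : w₁ * σ w₂ - σ w₁ * w₂ ≠ 0) {P R : ℙ K (Fin 3 → K)}
    (hP : h (conj σ w₁) ∈ P.submodule) (hR : h (conj σ w₂) ∈ R.submodule) (X : ℙ K (Fin 3 → K)) :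
    (X ∈ π ∧ X.submodule ≤ P.submodule ⊔ R.submodule) ↔
      ∃ s : Fin 2 → F, s ≠ 0 ∧ h (conj σ (s 0 • w₁ + s 1 • w₂)) ∈ X.submodule := by
  have hw₁ : w₁ ≠ 0 := by rintro rfl; simp at hdet
  have hw₂ : w₂ ≠ 0 := by rintro rfl; simp at hdet
  have hn₁ : h (conj σ w₁) ≠ 0 := by
    rw [Ne, LinearEquiv.map_eq_zero_iff]; exact conj_ne_zero hw₁
  have hn₂ : h (conj σ w₂) ≠ 0 := by
    rw [Ne, LinearEquiv.map_eq_zero_iff]; exact conj_ne_zero hw₂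
  constructor
  · rintro ⟨hX, hle⟩
    obtain ⟨w, hw, hwX⟩ := (hh.mem_iff X).1 hX
    have h1 := hle hwX
    rw [submodule_eq_span hn₁ hP, submodule_eq_span hn₂ hR, ← Submodule.span_union,
      Set.singleton_union, Submodule.mem_span_pair] at h1
    obtain ⟨a, b, hab⟩ := h1
    rw [← map_smul, ← map_smul, ← map_add, h.injective.eq_iff] at hab
    have e0 : a * w₁ + b * w₂ = w := congrFun hab 0
    have e1 : a * σ w₁ + b * σ w₂ = σ w := congrFun hab 1
    have e2 : a * σ (σ w₁) + b * σ (σ w₂) = σ (σ w) := congrFun hab 2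
    obtain ⟨s, t, rfl⟩ := (conjTrace_eq_zero_iff hσ hdet w).1 (by
      simp only [conjTrace, map_sub, map_mul, hσ.cube]
      linear_combination -(σ w₁ * σ (σ w₂) - σ (σ w₁) * σ w₂) * e0
        - (σ (σ w₁) * w₂ - w₁ * σ (σ w₂)) * e1 - (w₁ * σ w₂ - σ w₁ * w₂) * e2)
    refine ⟨![s, t], fun h0 => hw ?_, hwX⟩
    have hs : s = 0 := congrFun h0 0
    have ht : t = 0 := congrFun h0 1
    rw [hs, ht]; simp
  · rintro ⟨s, hs, hX⟩
    have hw : s 0 • w₁ + s 1 • w₂ ≠ 0 := fun h0 => hs (by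
      obtain ⟨h1, h2⟩ := smul_add_smul_eq_zero hdet h0
      ext i; fin_cases i <;> assumption)
    refine ⟨(hh.mem_iff X).2 ⟨_, hw, hX⟩, ?_⟩
    rw [submodule_eq_span (by rw [Ne, LinearEquiv.map_eq_zero_iff]; exact conj_ne_zero hw) hX,
      Submodule.span_singleton_le_iff_mem, conj_add, conj_smul, conj_smul, map_add, map_smul,
      map_smul]
    exact Submodule.add_mem_sup (Submodule.smul_mem _ _ hP) (Submodule.smul_mem _ _ hR)

theorem evalForm_algebraMap (w₁ w₂ : K) (s : Fin 2 → F) :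
    evalForm (d := 1) ![w₁, w₂] (fun i => algebraMap F K (s i)) = s 0 • w₁ + s 1 • w₂ := by
  rw [evalForm_one, Algebra.smul_def, Algebra.smul_def, mul_comm w₁, mul_comm w₂]

/-- The tangent plane of `π` at the point `w = 1` contains the points at infinity
`(σ x - x, σ² x - x, 0)`: such a point is on the tangent line of the cubic of the line joining `1`
and `x`. -/
theorem IsFrame.mem_tangentPlane (hσ : IsCubicFrobenius σ) (hK : Module.finrank F K = 3)
    (hh : IsFrame σ π h) {e : V6 F K ≃ₗ[F] V6 F K} (hez : ∀ v, (e v).2.2 = v.2.2)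
    (he : ∀ (P : ℙ K (Fin 3 → K)) v, e v ∈ bb F P ↔
        h ![algebraMap F K v.2.2, v.1, v.2.1] ∈ P.submodule)
    {P : ℙ K (Fin 3 → K)} (hP : h (conj σ 1) ∈ P.submodule) (x : K) :
    e (σ x - x, σ (σ x) - x, 0) ∈ tangentPlane F π P := by
  by_cases hx : σ x = x
  · rw [hx, hx, sub_self]
    have : e ((0, 0, 0) : V6 F K) = 0 := map_zero e
    rw [this]
    exact Submodule.zero_mem _
  have hdet : (1 : K) * σ x - σ 1 * x ≠ 0 := by
    rw [map_one, one_mul, one_mul]; exact sub_ne_zero.2 hx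
  have hx0 : x ≠ 0 := by rintro rfl; simp at hx
  obtain ⟨A, hA⟩ := exists_isConjCurve (d := 1) hσ 3 ![1, x]
  have hn : h (conj σ x) ≠ 0 := by
    rw [Ne, LinearEquiv.map_eq_zero_iff]; exact conj_ne_zero hx0
  have hR := (mem_submodule_iff (P := Projectivization.mk K _ hn) hn).2 rfl
  have hPπ : P ∈ π := (hh.mem_iff _).2 ⟨1, one_ne_zero, hP⟩
  set b := {X | X ∈ π ∧ X.submodule ≤ P.submodule ⊔ (Projectivization.mk K _ hn).submodule} with hb
  have hw : ∀ s : Fin 2 → F, s ≠ 0 → s 0 • (1 : K) + s 1 • x ≠ 0 := fun s hs h0 => hs (by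
    obtain ⟨h1, h2⟩ := smul_add_smul_eq_zero hdet h0
    ext i; fin_cases i <;> assumption)
  have hver := fun s : Fin 2 → F => hA.apply_veronese (d := 1) rfl s
    (w := s 0 • 1 + s 1 • x) (evalForm_algebraMap _ _ _).symm
  have hcurve : curvePoints (n := 3) (e.toLinearMap ∘ₗ A) = bbSet F b := by
    refine curvePoints_eq_bbSet (σ := σ) he A (fun s => s 0 • 1 + s 1 • x) hw ?_ ?_ ?_
      (hh.mem_line_iff hσ hdet hP hR)
    · intro s hs
      obtain ⟨h1, h2, h3⟩ := hver s
      rw [h1, h3]; ring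
    · intro s hs
      obtain ⟨h1, h2, h3⟩ := hver s
      rw [h2, h3]; ring
    · intro s hs h0
      obtain ⟨h1, h2, h3⟩ := hver s
      rw [h0, map_zero] at h3
      have := hw s hs
      exact mul_ne_zero (mul_ne_zero this ((map_ne_zero σ).2 this))
        ((map_ne_zero σ).2 ((map_ne_zero σ).2 this)) h3.symm
  have ht : tangentLine (n := 3) (e.toLinearMap ∘ₗ A) ![1, 0] ≤ tangentPlane F π P := by
    refine le_sSup ⟨b, ⟨P, hPπ, _, (hh.mem_iff _).2 ⟨x, hx0, hR⟩,
      ne_of_conj_det one_ne_zero hP hR hdet, rfl⟩, ⟨hPπ, le_sup_left⟩, e.toLinearMap ∘ₗ A, ?_,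
      hcurve, ![1, 0], fun h0 => one_ne_zero (congrFun h0 0), ?_, rfl⟩
    · rw [hh.splashPlanes_eq hσ he]
      exact hA.isSpecialCubicMap hσ hK hez hdet
    · obtain ⟨h1, h2, h3⟩ := hver ![1, 0]
      have hs1 : ((![1, 0] : Fin 2 → F) 0 • (1 : K) + (![1, 0] : Fin 2 → F) 1 • x) = 1 := by simp
      rw [hs1] at h1 h2 h3
      simp only [map_one, mul_one] at h1 h2 h3
      change e (A (veronese 3 ![1, 0])) ∈ bb F P
      rw [he, h1, h2, h3]
      convert hP using 2
      ext k; fin_cases k <;> simp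
  apply ht
  -- the derivative along the second parameter, corrected by a multiple of the point itself
  have hv0 : A (veronese 3 ![1, 0]) = (1, 1, 1) := by
    obtain ⟨h1, h2, h3⟩ := hver ![1, 0]
    have hs1 : ((![1, 0] : Fin 2 → F) 0 • (1 : K) + (![1, 0] : Fin 2 → F) 1 • x) = 1 := by simp
    rw [hs1] at h1 h2 h3
    simp only [map_one, mul_one] at h1 h2 h3
    ext
    · exact h1
    · exact h2
    · exact (algebraMap F K).injective (by rw [h3, map_one])
  have hdt : (fun i => algebraMap F K (veroneseDt (R := F) 3 ![1, 0] i)) = Pi.single 1 1 := by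
    ext i; fin_cases i <;> simp [veroneseDt]
  have htri : ∀ p q r : Fin 2 → K, p 0 = 1 → q 0 = 1 → r 0 = 1 →
      tri (n := 3) (d := 1) (Pi.single 1 1) p q r = p 1 + q 1 + r 1 := by
    intro p q r hp hq hr
    change ∑ i : Fin 2, ∑ j : Fin 2, ∑ l : Fin 2, p i * q j * r l *
      (Pi.single 1 1 : Fin 4 → K) (Fin.ofNat 4 (i + j + l)) = _
    simp only [Fin.sum_univ_two]
    simp [hp, hq, hr, Fin.ofNat]
    ring
  have hone : ∀ k, conj σ (1 : K) k = 1 := fun k => by fin_cases k <;> simp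
  have hform0 : ∀ k, conjForm (d := 1) σ ![1, x] k 0 = 1 := fun k => hone k
  have hform1 : ∀ k, conjForm (d := 1) σ ![1, x] k 1 = conj σ x k := fun k => rfl
  obtain ⟨d1, d2, d3⟩ := hA (veroneseDt 3 ![1, 0])
  rw [hdt, htri _ _ _ (hform0 _) (hform0 _) (hform0 _)] at d1 d2 d3
  simp only [hform1, conj_zero, conj_one, conj_two] at d1 d2 d3
  have hval : ((σ x - x, σ (σ x) - x, 0) : V6 F K) = A (veroneseDt 3 ![1, 0])
      - (A (veroneseDt 3 ![1, 0])).2.2 • A (veronese 3 ![1, 0]) := by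
    rw [hv0]
    ext
    · rw [Prod.fst_sub, Prod.smul_fst, Algebra.smul_def, d1, d3]; ring
    · rw [Prod.snd_sub, Prod.fst_sub, Prod.smul_snd, Prod.smul_fst, Algebra.smul_def, d2, d3]; ring
    · simp
  rw [hval, map_sub, map_smul]
  exact Submodule.sub_mem _ (Submodule.subset_span (by simp))
    (Submodule.smul_mem _ _ (Submodule.subset_span (by simp)))

/-- The cover given by `ρ = σ` is not the tangent cover. -/
theorem IsFrame.not_isTangentCover (hσ : IsCubicFrobenius σ) (hK : Module.finrank F K = 3)
    (hh : IsFrame σ π h) {e : V6 F K ≃ₗ[F] V6 F K} (hez : ∀ v, (e v).2.2 = v.2.2)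
    (he : ∀ (P : ℙ K (Fin 3 → K)) v, e v ∈ bb F P ↔
        h ![algebraMap F K v.2.2, v.1, v.2.1] ∈ P.submodule) :
    ¬ IsTangentCover π (planeFamily σ e σ) := by
  rintro ⟨-, ht⟩
  have hn : h (conj σ 1) ≠ 0 := by
    rw [Ne, LinearEquiv.map_eq_zero_iff]; exact conj_ne_zero one_ne_zero
  have hP := (mem_submodule_iff (P := Projectivization.mk K _ hn) hn).2 rfl
  obtain ⟨α, ⟨u, hu, rfl⟩, hα⟩ := ht _ ((hh.mem_iff _).2 ⟨1, one_ne_zero, hP⟩)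
  have key : ∀ x, u * (σ (σ x) - x) + σ u * (σ (σ x) - σ x) = 0 := fun x => by
    have h1 : e (σ x - x, σ (σ x) - x, 0) ∈ (coverPlane σ σ u).map e.toLinearMap :=
      hα ⟨hh.mem_tangentPlane hσ hK hez he hP x, hez _⟩
    rw [mem_map_equiv, mem_coverPlane] at h1
    have := h1.2
    simpa only [map_sub] using this
  have := (hσ.linear (a := -u) (b := -σ u) (c := u + σ u) fun x => by
    linear_combination key x).1
  exact hu (neg_eq_zero.1 this)

/-- In conjugate coordinates, the conic cover is the family of planes for `ρ = σ`. -/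
theorem IsFrame.conicCover_eq (hσ : IsCubicFrobenius σ) (hK : Module.finrank F K = 3)
    (hh : IsFrame σ π h) {e : V6 F K ≃ₗ[F] V6 F K} (hez : ∀ v, (e v).2.2 = v.2.2)
    (he : ∀ (P : ℙ K (Fin 3 → K)) v, e v ∈ bb F P ↔
        h ![algebraMap F K v.2.2, v.1, v.2.1] ∈ P.submodule)
    {X : Set (Submodule F (V6 F K))} (hX : IsConicCover π X) : X = planeFamily σ e σ := by
  obtain ⟨hX, T, hT, hne⟩ := hX
  have hT' := hT.1
  rw [hh.splashPlanes_eq hσ he] at hX hT'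
  rcases hT'.eq_planeFamily hσ hK with h1 | h1
  · rw [h1] at hT
    exact (hh.not_isTangentCover hσ hK hez he hT).elim
  · rcases hX.eq_planeFamily hσ hK with h2 | h2
    · exact h2
    · exact (hne (h2.trans h1.symm)).elim

end Tangent

/-! ### Ternary quadratic forms: irreducibility and normal form -/

section Quadratic

open MvPolynomial

theorem exists_eq_ternary {F : Type*} [Field F] {Q : MvPolynomial (Fin 3) F}
    (hQ : Q.IsHomogeneous 2) :
    ∃ q : Fin 6 → F, Q = ternary (fun i => C (q i)) X := by
  have h1 : Q ∈ homogeneousSubmodule (Fin 3) F 1 * homogeneousSubmodule (Fin 3) F 1 := by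
    rw [← sq, homogeneousSubmodule_one_pow]; exact hQ
  have hlin : ∀ l ∈ homogeneousSubmodule (Fin 3) F 1, ∃ a : Fin 3 → F,
      l = C (a 0) * X 0 + C (a 1) * X 1 + C (a 2) * X 2 := by
    intro l hl
    rw [homogeneousSubmodule_one_eq_span_X] at hl
    obtain ⟨a, rfl⟩ := (Submodule.mem_span_range_iff_exists_fun F).1 hl
    exact ⟨a, by simp [Fin.sum_univ_three, smul_eq_C_mul]⟩
  clear hQ
  induction h1 using Submodule.mul_induction_on' with
  | mem_mul_mem l hl m hm =>
    obtain ⟨a, rfl⟩ := hlin l hl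
    obtain ⟨b, rfl⟩ := hlin m hm
    refine ⟨![a 0 * b 0, a 1 * b 1, a 2 * b 2, a 1 * b 2 + a 2 * b 1, a 0 * b 2 + a 2 * b 0,
      a 0 * b 1 + a 1 * b 0], ?_⟩
    simp [ternary]
    ring
  | add P _ R _ hP hR =>
    obtain ⟨p, rfl⟩ := hP
    obtain ⟨r, rfl⟩ := hR
    refine ⟨p + r, ?_⟩
    simp [ternary]
    ring

theorem isHomogeneous_ternary {F : Type*} [Field F] (q : Fin 6 → F) :
    (ternary (fun i => C (q i)) X : MvPolynomial (Fin 3) F).IsHomogeneous 2 := by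
  have h1 : ∀ (a : F) (i j : Fin 3), (C a * (X i * X j) : MvPolynomial (Fin 3) F).IsHomogeneous 2 :=
    fun a i j => ((isHomogeneous_X F i).mul (isHomogeneous_X F j)).C_mul a
  have h2 : ∀ (a : F) (i : Fin 3), (C a * X i ^ 2 : MvPolynomial (Fin 3) F).IsHomogeneous 2 :=
    fun a i => by rw [sq]; exact h1 a i i
  exact (((((h2 _ _).add (h2 _ _)).add (h2 _ _)).add (h1 _ _ _)).add (h1 _ _ _)).add (h1 _ _ _)

theorem aeval_ternary {F R : Type*} [Field F] [CommRing R] [Algebra F R] (q : Fin 6 → F)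
    (v : Fin 3 → R) : aeval v (ternary (fun i => C (q i)) X : MvPolynomial (Fin 3) F) =
      ternary (fun i => algebraMap F R (q i)) v := by
  simp [ternary]

theorem ternary_comb {R : Type*} [CommRing R] (q : Fin 6 → R) (n : Fin 3 → Fin 3 → R)
    (v : Fin 3 → R) : ternary q (v 0 • n 0 + v 1 • n 1 + v 2 • n 2) =
      ternary ![ternary q (n 0), ternary q (n 1), ternary q (n 2), ternaryPolar q (n 1) (n 2),
        ternaryPolar q (n 0) (n 2), ternaryPolar q (n 0) (n 1)] v := by
  simp only [ternary, ternaryPolar, Pi.add_apply, Pi.smul_apply, smul_eq_mul, Matrix.cons_val]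
  ring

theorem exists_binary_factor {L : Type*} [Field L] [IsAlgClosed L] (α β γ : L) :
    ∃ a₀ a₁ b₀ b₁ : L, ∀ x y : L,
      α * x ^ 2 + β * (x * y) + γ * y ^ 2 = (a₀ * x + a₁ * y) * (b₀ * x + b₁ * y) := by
  by_cases hα : α = 0
  · exact ⟨0, 1, β, γ, fun x y => by rw [hα]; ring⟩
  · obtain ⟨r, hr⟩ := IsAlgClosed.exists_root
      (Polynomial.C α * Polynomial.X ^ 2 + Polynomial.C β * Polynomial.X + Polynomial.C γ) (by
        rw [Polynomial.degree_quadratic hα]; decide)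
    have hr' : α * r ^ 2 + β * r + γ = 0 := by simpa [Polynomial.IsRoot] using hr
    refine ⟨1, -r, α, α * r + β, fun x y => ?_⟩
    linear_combination y ^ 2 * hr'

/-- A quadratic form with a singular point factors over an algebraically closed field: it is a
binary form in two coordinates that vanish at that point. -/
theorem exists_ternary_factor {L : Type*} [Field L] [IsAlgClosed L] (q : Fin 6 → L)
    {p : Fin 3 → L} (hp : p ≠ 0) (h0 : ternary q p = 0) (h1 : ∀ v, ternaryPolar q p v = 0) :
    ∃ a b : Fin 3 → L, ∀ v, ternary q v =
      (a 0 * v 0 + a 1 * v 1 + a 2 * v 2) * (b 0 * v 0 + b 1 * v 1 + b 2 * v 2) := by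
  have hred : ∀ (v : Fin 3 → L) (c : L), ternary q v = ternary q (v - c • p) := by
    intro v c
    have h2 := h1 (v - c • p)
    have h3 : ternary q v = ternary q (c • p + (v - c • p)) := by congr 1; abel
    rw [h3, ternary_add, ternary_smul, h0]
    have h4 : ternaryPolar q (c • p) (v - c • p) = c * ternaryPolar q p (v - c • p) := by
      simp only [ternaryPolar, Pi.smul_apply, smul_eq_mul]; ring
    rw [h4, h2]; ring
  obtain ⟨i, hi⟩ := Function.ne_iff.1 hp
  have hi : p i ≠ 0 := hi
  have hq : ∀ v : Fin 3 → L, ternary q v = ternary q (v - (v i / p i) • p) := fun v => hred v _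
  fin_cases i
  · have hi : p 0 ≠ 0 := hi
    obtain ⟨a₀, a₁, b₀, b₁, hab⟩ := exists_binary_factor (q 1) (q 3) (q 2)
    refine ⟨![-(a₀ * p 1 + a₁ * p 2) / p 0, a₀, a₁], ![-(b₀ * p 1 + b₁ * p 2) / p 0, b₀, b₁],
      fun v => ?_⟩
    have h2 := hab (v 1 - v 0 / p 0 * p 1) (v 2 - v 0 / p 0 * p 2)
    have h3 : v 0 - v 0 / p 0 * p 0 = 0 := by rw [div_mul_cancel₀ _ hi, sub_self]
    rw [hq]
    simp only [ternary, Pi.sub_apply, Pi.smul_apply, smul_eq_mul, Fin.zero_eta, Matrix.cons_val]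
      at h2 h3 ⊢
    rw [h3]
    have h4 : ∀ a b : L, -(a * p 1 + b * p 2) / p 0 * v 0 + a * v 1 + b * v 2 =
      a * (v 1 - v 0 / p 0 * p 1) + b * (v 2 - v 0 / p 0 * p 2) := fun a b => by ring
    rw [h4, h4, ← h2]
    ring
  · have hi : p 1 ≠ 0 := hi
    obtain ⟨a₀, a₁, b₀, b₁, hab⟩ := exists_binary_factor (q 0) (q 4) (q 2)
    refine ⟨![a₀, -(a₀ * p 0 + a₁ * p 2) / p 1, a₁], ![b₀, -(b₀ * p 0 + b₁ * p 2) / p 1, b₁],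
      fun v => ?_⟩
    have h2 := hab (v 0 - v 1 / p 1 * p 0) (v 2 - v 1 / p 1 * p 2)
    have h3 : v 1 - v 1 / p 1 * p 1 = 0 := by rw [div_mul_cancel₀ _ hi, sub_self]
    rw [hq]
    simp only [ternary, Pi.sub_apply, Pi.smul_apply, smul_eq_mul, Fin.mk_one, Matrix.cons_val]
      at h2 h3 ⊢
    rw [h3]
    have h4 : ∀ a b : L, a * v 0 + -(a * p 0 + b * p 2) / p 1 * v 1 + b * v 2 =
      a * (v 0 - v 1 / p 1 * p 0) + b * (v 2 - v 1 / p 1 * p 2) := fun a b => by ring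
    rw [h4, h4, ← h2]
    ring
  · have hi : p 2 ≠ 0 := hi
    obtain ⟨a₀, a₁, b₀, b₁, hab⟩ := exists_binary_factor (q 0) (q 5) (q 1)
    refine ⟨![a₀, a₁, -(a₀ * p 0 + a₁ * p 1) / p 2], ![b₀, b₁, -(b₀ * p 0 + b₁ * p 1) / p 2],
      fun v => ?_⟩
    have h2 := hab (v 0 - v 2 / p 2 * p 0) (v 1 - v 2 / p 2 * p 1)
    have h3 : v 2 - v 2 / p 2 * p 2 = 0 := by rw [div_mul_cancel₀ _ hi, sub_self]
    rw [hq]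
    simp only [ternary, Pi.sub_apply, Pi.smul_apply, smul_eq_mul, Fin.reduceFinMk,
      Matrix.cons_val] at h2 h3 ⊢
    rw [h3]
    have h4 : ∀ a b : L, a * v 0 + b * v 1 + -(a * p 0 + b * p 1) / p 2 * v 2 =
      a * (v 0 - v 2 / p 2 * p 0) + b * (v 1 - v 2 / p 2 * p 1) := fun a b => by ring
    rw [h4, h4, ← h2]
    ring

/-- A conic given by an absolutely irreducible form has no singular point over the base field. -/
theorem IsIrreducibleQuadratic.not_singular {F : Type*} [Field F] {q : Fin 6 → F}
    (hQ : IsIrreducibleQuadratic F (ternary (fun i => C (q i)) X)) {p : Fin 3 → F} (hp : p ≠ 0)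
    (h0 : ternary q p = 0) (h1 : ∀ v, ternaryPolar q p v = 0) : False := by
  let L := AlgebraicClosure F
  let f := algebraMap F L
  have hp' : (fun i => f (p i)) ≠ 0 := fun h => hp (by
    ext i; exact f.injective (by rw [Pi.zero_apply, map_zero]; exact congrFun h i))
  have h1' : ∀ v : Fin 3 → L, ternaryPolar (fun i => f (q i)) (fun i => f (p i)) v = 0 := by
    have hb : ∀ i, ternaryPolar (fun i => f (q i)) (fun i => f (p i)) (Pi.single i 1) = 0 := by
      intro i
      have h2 : (Pi.single i 1 : Fin 3 → L) = fun j => f ((Pi.single i 1 : Fin 3 → F) j) := by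
        ext j
        by_cases hj : j = i
        · subst hj; simp
        · simp [hj]
      rw [h2, ← map_ternaryPolar, h1, map_zero]
    intro v
    have h3 : ternaryPolar (fun i => f (q i)) (fun i => f (p i)) v =
        v 0 * ternaryPolar (fun i => f (q i)) (fun i => f (p i)) (Pi.single 0 1)
        + v 1 * ternaryPolar (fun i => f (q i)) (fun i => f (p i)) (Pi.single 1 1)
        + v 2 * ternaryPolar (fun i => f (q i)) (fun i => f (p i)) (Pi.single 2 1) := by
      simp [ternaryPolar]; ring
    rw [h3, hb, hb, hb]; ring
  obtain ⟨a, b, hab⟩ := exists_ternary_factor (fun i => f (q i)) hp'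
    (by rw [← map_ternary, h0, map_zero]) h1'
  have hirr := hQ.2
  let lin : (Fin 3 → L) → MvPolynomial (Fin 3) L := fun a =>
    C (a 0) * X 0 + C (a 1) * X 1 + C (a 2) * X 2
  have hfac : MvPolynomial.map f (ternary (fun i => C (q i)) X) = lin a * lin b := by
    refine MvPolynomial.funext fun v => ?_
    have h2 : MvPolynomial.map f (ternary (fun i => C (q i)) X) =
        ternary (fun i => C (f (q i))) X := by simp [ternary]
    have h3 : eval v (ternary (fun i => C (f (q i))) X) = ternary (fun i => f (q i)) v := by
      simp [ternary]
    rw [h2, h3, hab]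
    simp [lin]
  have hnu : ∀ a, ¬ IsUnit (lin a) := fun a hu => by
    have := hu.map (eval (0 : Fin 3 → L))
    simp [lin] at this
  rcases hirr.isUnit_or_isUnit hfac with h | h
  · exact hnu _ h
  · exact hnu _ h

/-- A quadratic form that vanishes at three points but at none of the sums of two of them is
irreducible: of two linear factors, one would vanish at two of the points. -/
theorem irreducible_of_triangle {L : Type*} [Field L] {Q : MvPolynomial (Fin 3) L}
    (hQ : Q.IsHomogeneous 2) {x y z : Fin 3 → L} (hx : eval x Q = 0) (hy : eval y Q = 0)
    (hz : eval z Q = 0) (hxy : eval (x + y) Q ≠ 0) (hyz : eval (y + z) Q ≠ 0)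
    (hxz : eval (x + z) Q ≠ 0) : Irreducible Q := by
  have hQ0 : Q ≠ 0 := by rintro rfl; simp at hxy
  refine ⟨fun hu => ?_, fun p r hpr => ?_⟩
  · have := hu.map (eval x)
    rw [hx] at this
    exact not_isUnit_zero this
  have hp0 : p ≠ 0 := by rintro rfl; exact hQ0 (by rw [hpr, zero_mul])
  have hr0 : r ≠ 0 := by rintro rfl; exact hQ0 (by rw [hpr, mul_zero])
  have hdeg : p.totalDegree + r.totalDegree = 2 := by
    rw [← totalDegree_mul_of_isDomain hp0 hr0, ← hpr, hQ.totalDegree hQ0]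
  have hunit : ∀ p : MvPolynomial (Fin 3) L, p ≠ 0 → p.totalDegree = 0 → IsUnit p := by
    intro p hp h
    rw [totalDegree_eq_zero_iff_eq_C] at h
    rw [h]
    refine IsUnit.map C (isUnit_iff_ne_zero.2 fun h0 => hp ?_)
    rw [h, h0, C_0]
  by_cases hp1 : p.totalDegree = 0
  · exact Or.inl (hunit p hp0 hp1)
  by_cases hr1 : r.totalDegree = 0
  · exact Or.inr (hunit r hr0 hr1)
  exfalso
  have hdec : ∀ p : MvPolynomial (Fin 3) L, p.totalDegree = 1 →
      p = C (coeff 0 p) + homogeneousComponent 1 p := by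
    intro p hp
    conv_lhs => rw [← sum_homogeneousComponent p, hp]
    rw [Finset.sum_range_succ, Finset.sum_range_one, homogeneousComponent_zero]
  have hp2 := hdec p (by omega)
  have hr2 := hdec r (by omega)
  have hl := homogeneousComponent_isHomogeneous 1 p
  have hm := homogeneousComponent_isHomogeneous 1 r
  set l := homogeneousComponent 1 p
  set m := homogeneousComponent 1 r
  have hQlm : Q = l * m := by
    have h1 : Q = C (coeff 0 p * coeff 0 r) + (C (coeff 0 p) * m + C (coeff 0 r) * l) + l * m := by
      rw [hpr]
      conv_lhs => rw [hp2, hr2]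
      rw [C_mul]; ring
    have h2 := congrArg (homogeneousComponent 2) h1
    rw [homogeneousComponent_of_mem (n := 2) hQ, if_pos rfl, map_add, map_add,
      homogeneousComponent_of_mem (n := 0) (isHomogeneous_C _ _),
      homogeneousComponent_of_mem (n := 1) ((hm.C_mul _).add (hl.C_mul _)),
      homogeneousComponent_of_mem (n := 2) (hl.mul hm)] at h2
    simpa using h2
  have hadd : ∀ l : MvPolynomial (Fin 3) L, l.IsHomogeneous 1 → ∀ u v : Fin 3 → L,
      eval (u + v) l = eval u l + eval v l := by
    intro l hl u v
    have hl : l ∈ homogeneousSubmodule (Fin 3) L 1 := hl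
    rw [homogeneousSubmodule_one_eq_span_X] at hl
    obtain ⟨a, rfl⟩ := (Submodule.mem_span_range_iff_exists_fun L).1 hl
    simp [Fin.sum_univ_three, smul_eval]
    ring
  rw [hQlm, map_mul, mul_eq_zero] at hx hy hz
  rw [hQlm, map_mul, hadd l hl, hadd m hm] at hxy hyz hxz
  rcases hx with hx | hx <;> rcases hy with hy | hy <;> rcases hz with hz | hz <;>
    simp [hx, hy, hz] at hxy hyz hxz

/-- Over a finite field, an absolutely irreducible conic has a point, by the Chevalley–Warning
theorem, hence a parametrization: in suitable coordinates it has the equation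
`x₀ x₂ = κ x₁²`. -/
theorem IsIrreducibleQuadratic.exists_normalForm {F : Type*} [Field F] [Finite F] {q : Fin 6 → F}
    (hQ : IsIrreducibleQuadratic F (ternary (fun i => C (q i)) X)) :
    ∃ (m : Fin 3 → Fin 3 → F) (κ : F), κ ≠ 0 ∧
      (∀ v, ∃ x : Fin 3 → F, v = x 0 • m 0 + x 1 • m 1 + x 2 • m 2) ∧
      ternary q (m 0) = 0 ∧ ternary q (m 1) = -κ ∧ ternary q (m 2) = 0 ∧
      ternaryPolar q (m 0) (m 1) = 0 ∧ ternaryPolar q (m 0) (m 2) = 1 ∧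
      ternaryPolar q (m 1) (m 2) = 0 := by
  classical
  have := Fintype.ofFinite F
  obtain ⟨p, hp0, hp⟩ : ∃ p : Fin 3 → F, p ≠ 0 ∧ ternary q p = 0 := by
    obtain ⟨ℓ, hℓ⟩ := CharP.exists F
    have hℓp : Fact ℓ.Prime := ⟨CharP.char_is_prime F ℓ⟩
    have hdvd := char_dvd_card_solutions ℓ
      (f := (ternary (fun i => C (q i)) X : MvPolynomial (Fin 3) F))
      (lt_of_le_of_lt (isHomogeneous_ternary q).totalDegree_le (by simp))
    have hev : ∀ v : Fin 3 → F, eval v (ternary (fun i => C (q i)) X) = ternary q v := fun v => by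
      simp [ternary]
    by_contra! hno
    have hone : Fintype.card {x : Fin 3 → F // eval x (ternary (fun i => C (q i)) X) = 0} = 1 := by
      rw [Fintype.card_eq_one_iff]
      refine ⟨⟨0, by rw [hev]; simp [ternary]⟩, fun y => ?_⟩
      by_contra hy
      refine hno y.1 (fun h => hy (Subtype.ext h)) ?_
      rw [← hev]; exact y.2
    rw [hone] at hdvd
    exact hℓp.1.one_lt.ne' (Nat.dvd_one.1 hdvd)
  let B : (Fin 3 → F) → (Fin 3 → F) →ₗ[F] F := fun u =>
    { toFun := fun v => ternaryPolar q u v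
      map_add' := fun v w => by simp only [ternaryPolar, Pi.add_apply]; ring
      map_smul' := fun r v => by
        simp only [ternaryPolar, Pi.smul_apply, smul_eq_mul, RingHom.id_apply]; ring }
  have hB : ∀ u v, B u v = ternaryPolar q u v := fun _ _ => rfl
  have hsymm : ∀ u v, B u v = B v u := fun u v => by
    rw [hB, hB]; simp only [ternaryPolar]; ring
  have hself : ∀ u, B u u = 2 * ternary q u := fun u => by
    rw [hB]; simp only [ternaryPolar, ternary]; ring
  obtain ⟨v, hv⟩ : ∃ v, B p v ≠ 0 := by
    by_contra! h
    exact hQ.not_singular hp0 hp h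
  -- a second isotropic vector, forming a hyperbolic pair with `p`
  set r := (B p v)⁻¹ • v with hr
  have hpr : B p r = 1 := by rw [hr, map_smul, smul_eq_mul, inv_mul_cancel₀ hv]
  set m₂ := (-ternary q r) • p + r with hm₂
  have hpm : B p m₂ = 1 := by
    rw [hm₂, map_add, map_smul, hself, hp, hpr]; simp
  have hm₂0 : ternary q m₂ = 0 := by
    have h1 : ternaryPolar q ((-ternary q r) • p) r = -ternary q r * B p r := by
      rw [← hB, hsymm, map_smul, hsymm r p, smul_eq_mul]
    rw [hm₂, ternary_add, ternary_smul, hp, h1, hpr]; ring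
  obtain ⟨m₁, hm₁, hm₁0⟩ : ∃ m₁ ∈ LinearMap.ker ((B p).prod (B m₂)), m₁ ≠ 0 := by
    refine Submodule.exists_mem_ne_zero_of_ne_bot (LinearMap.ker_ne_bot_of_finrank_lt ?_)
    simp
  have hpm₁ : B p m₁ = 0 := congrArg Prod.fst hm₁
  have hmm₁ : B m₂ m₁ = 0 := congrArg Prod.snd hm₁
  have hli : LinearIndependent F ![p, m₁, m₂] := by
    rw [Fintype.linearIndependent_iff]
    intro g hg
    simp only [Fin.sum_univ_three, Matrix.cons_val] at hg
    have e1 := congrArg (B p) hg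
    have e2 := congrArg (B m₂) hg
    simp only [map_add, map_smul, smul_eq_mul, map_zero, hself, hp, hpm₁, hpm, hmm₁, hm₂0,
      hsymm m₂ p] at e1 e2
    have g2 : g 2 = 0 := by linear_combination e1
    have g0 : g 0 = 0 := by linear_combination e2
    rw [g2, g0, zero_smul, zero_smul, zero_add, add_zero] at hg
    have g1 : g 1 = 0 := (smul_eq_zero.1 hg).resolve_right hm₁0
    intro i
    fin_cases i <;> assumption
  have hspan : ∀ v, ∃ x : Fin 3 → F, v = x 0 • p + x 1 • m₁ + x 2 • m₂ := by
    intro v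
    have htop := hli.span_eq_top_of_card_eq_finrank' (by simp)
    have hv : v ∈ Submodule.span F (Set.range ![p, m₁, m₂]) := by rw [htop]; trivial
    obtain ⟨x, hx⟩ := (Submodule.mem_span_range_iff_exists_fun F).1 hv
    refine ⟨x, ?_⟩
    rw [← hx]
    simp [Fin.sum_univ_three]
  refine ⟨![p, m₁, m₂], -ternary q m₁, ?_, hspan, hp, by simp, hm₂0, hpm₁, hpm, ?_⟩
  · intro h0
    rw [neg_eq_zero] at h0
    refine hQ.not_singular hm₁0 h0 fun v => ?_
    obtain ⟨x, rfl⟩ := hspan v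
    rw [← hB, map_add, map_add, map_smul, map_smul, map_smul, hself, h0, hsymm m₁ p, hpm₁,
      hsymm m₁ m₂, hmm₁]
    simp
  · exact (hsymm _ _).trans hmm₁

end Quadratic

/-! ### Conics of an exterior subplane in conjugate coordinates -/

section ConicFrame

open MvPolynomial

variable {F K : Type*} [Field F] [Field K] [Algebra F K] {σ : K ≃ₐ[F] K}

theorem ternary_conj (q : Fin 6 → K) (w : K) : ternary q (conj σ w) =
    q 0 * w ^ 2 + q 1 * σ w ^ 2 + q 2 * σ (σ w) ^ 2 + q 3 * (σ w * σ (σ w)) + q 4 * (w * σ (σ w))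
      + q 5 * (w * σ w) := rfl

theorem ternary_single {R : Type*} [CommRing R] (q : Fin 6 → R) (i : Fin 3) :
    ternary q (Pi.single i 1) = q (Fin.castLE (by decide) i) := by
  fin_cases i <;> simp [ternary]

theorem ternary_comp (q : Fin 6 → K) (L : (Fin 3 → K) →ₗ[K] (Fin 3 → K)) (u : Fin 3 → K) :
    ternary q (L u) = ternary ![ternary q (L (Pi.single 0 1)), ternary q (L (Pi.single 1 1)),
      ternary q (L (Pi.single 2 1)), ternaryPolar q (L (Pi.single 1 1)) (L (Pi.single 2 1)),
      ternaryPolar q (L (Pi.single 0 1)) (L (Pi.single 2 1)),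
      ternaryPolar q (L (Pi.single 0 1)) (L (Pi.single 1 1))] u := by
  conv_lhs => rw [pi_eq_sum_univ' u, map_sum]
  rw [Fin.sum_univ_three, map_smul, map_smul, map_smul]
  exact ternary_comb q (fun i => L (Pi.single i 1)) u

/-- A quadratic form in the conjugates of `w` with values in `F` has conjugate coefficients. -/
theorem IsCubicFrobenius.conj_coeff (hσ : IsCubicFrobenius σ) {q : Fin 6 → K}
    (hq : ∀ w, σ (ternary q (conj σ w)) = ternary q (conj σ w)) :
    q 1 = σ (q 0) ∧ q 2 = σ (q 1) ∧ q 4 = σ (q 3) ∧ q 5 = σ (q 4) := by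
  obtain ⟨h0, h1, h2, h3, h4, h5⟩ := hσ.quadratic (σ (q 2) - q 0) (σ (q 0) - q 1) (σ (q 1) - q 2)
    (σ (q 5) - q 3) (σ (q 3) - q 4) (σ (q 4) - q 5) fun w => by
      have := hq w
      simp only [ternary_conj, map_add, map_mul, map_pow, hσ.cube] at this
      linear_combination this
  exact ⟨(sub_eq_zero.1 h1).symm, (sub_eq_zero.1 h2).symm, (sub_eq_zero.1 h4).symm,
    (sub_eq_zero.1 h5).symm⟩

theorem mem_image_zeroSet (g : GL3 K) (q : Fin 6 → F) {u : Fin 3 → K} (hu : u ≠ 0)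
    {P : ℙ K (Fin 3 → K)} (hP : g • u ∈ P.submodule) :
    P ∈ (fun P => g • P) '' zeroSet K (ternary (fun i => C (q i)) X) ↔
      ternary (fun i => algebraMap F K (q i)) u = 0 := by
  have hgP : g • g⁻¹ • P = P := smul_inv_smul g P
  have hu' : u ∈ (g⁻¹ • P).submodule := by
    rw [← mem_smul_submodule g, hgP]; exact hP
  constructor
  · rintro ⟨R, hR, rfl⟩
    have := hR u ((mem_smul_submodule g).1 hP)
    rwa [aeval_ternary] at this
  · intro h0
    refine ⟨g⁻¹ • P, fun v hv => ?_, hgP⟩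
    rw [submodule_eq_span hu hu', Submodule.mem_span_singleton] at hv
    obtain ⟨r, rfl⟩ := hv
    rw [aeval_ternary, ternary_smul, h0, mul_zero]

/-- In conjugate coordinates, a conic and its extension are the zero sets of a form `t`. -/
theorem IsConicWithExtension.exists_form (hσ : IsCubicFrobenius σ) (hK : Module.finrank F K = 3)
    {π : Set (ℙ K (Fin 3 → K))} (hext : IsExterior π) {B D : Set (ℙ K (Fin 3 → K))}
    (hB : IsConicWithExtension F π B D) :
    ∃ (c : (Fin 3 → F) ≃ₗ[F] K) (h : (Fin 3 → K) ≃ₗ[K] (Fin 3 → K)) (q : Fin 6 → F)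
      (t : Fin 6 → K), IsFrame σ π h ∧ IsIrreducibleQuadratic F (ternary (fun i => C (q i)) X) ∧
      (∀ v, ternary t (conj σ (c v)) = algebraMap F K (ternary q v)) ∧
      (∀ P, P ∈ B ↔ ∃ w, w ≠ 0 ∧ ternary t (conj σ w) = 0 ∧ h (conj σ w) ∈ P.submodule) ∧
      ∀ P u, u ≠ 0 → h u ∈ P.submodule → (P ∈ D ↔ ternary t u = 0) := by
  obtain ⟨g, Q, hQ, hπ, hB, hD⟩ := hB
  obtain ⟨q, rfl⟩ := exists_eq_ternary hQ.1
  obtain ⟨c, ν, h, -, hν, hg, hh⟩ := exists_isFrame hσ hK hext g hπ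
  have ht := ternary_comp (fun i => algebraMap F K (q i)) ν.symm.toLinearMap
  set t : Fin 6 → K := ![_, _, _, _, _, _] with ht_def
  clear_value t
  have hmem : ∀ P u, u ≠ 0 → h u ∈ P.submodule → (P ∈ D ↔ ternary t u = 0) := by
    intro P u hu hP
    rw [hD, mem_image_zeroSet g q (u := ν.symm u) (by simpa using hu), ← ht]
    · rfl
    · rw [← hg, LinearEquiv.apply_symm_apply]; exact hP
  refine ⟨c, h, q, t, hh, hQ, fun v => ?_, fun P => ?_, hmem⟩
  · rw [← ht, ← hν, map_ternary]
    rw [LinearEquiv.coe_coe, LinearEquiv.symm_apply_apply]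
  · rw [hB, Set.image_inter (MulAction.injective g), ← hπ, ← hD, Set.mem_inter_iff, hh.mem_iff]
    constructor
    · rintro ⟨⟨w, hw, hwP⟩, hPD⟩
      exact ⟨w, hw, (hmem P _ (conj_ne_zero hw) hwP).1 hPD, hwP⟩
    · rintro ⟨w, hw, h0, hwP⟩
      exact ⟨⟨w, hw, hwP⟩, (hmem P _ (conj_ne_zero hw) hwP).2 h0⟩

variable (σ) in
/-- The coefficients of the quadratic form `β X Y + σ(β) W Y + σ²(β) W X` in conjugate coordinates
`(W, X, Y)`. Its conic passes through the three coordinate points. -/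
def triangleForm (β : K) : Fin 6 → K := ![0, 0, 0, β, σ β, σ (σ β)]

/-- The Cremona transformation `w ↦ 1 / w` takes the conic of `triangleForm σ β` to a line. -/
theorem ternary_triangleForm_eq_zero_iff {β w : K} (hw : w ≠ 0) :
    ternary (triangleForm σ β) (conj σ w) = 0 ↔ conjTrace σ β w⁻¹ = 0 := by
  have h1 : σ w ≠ 0 := by simpa using hw
  have h2 : σ (σ w) ≠ 0 := by simpa using hw
  have : ternary (triangleForm σ β) (conj σ w) = w * σ w * σ (σ w) * conjTrace σ β w⁻¹ := by
    rw [ternary_conj]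
    simp [triangleForm, conjTrace]
    field_simp
  rw [this, mul_eq_zero, or_iff_right (mul_ne_zero (mul_ne_zero hw h1) h2)]

/-- A form `triangleForm σ β` with `β ≠ 0` defines an irreducible conic of `π` whose extension
contains the fixed points. -/
theorem exists_isSpecialConic (hσ : IsCubicFrobenius σ) (hK : Module.finrank F K = 3)
    {π : Set (ℙ K (Fin 3 → K))} (hπ : IsSubplane F π) (hext : IsExterior π) :
    ∃ h : (Fin 3 → K) ≃ₗ[K] (Fin 3 → K), IsFrame σ π h ∧
      ∀ (β : K) (B : Set (ℙ K (Fin 3 → K))), β ≠ 0 →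
      (∀ P, P ∈ B ↔ ∃ w, w ≠ 0 ∧ ternary (triangleForm σ β) (conj σ w) = 0 ∧
        h (conj σ w) ∈ P.submodule) → IsSpecialConic F π B := by
  have hfd : Module.Finite F K := Module.finite_of_finrank_pos (by omega)
  obtain ⟨g, hg⟩ := hπ
  obtain ⟨c, ν, h, -, hν, hgν, hh⟩ := exists_isFrame hσ hK hext g hg
  refine ⟨h, hh, fun β B hβ hB => ?_⟩
  have hβ1 : σ β ≠ 0 := by simpa using hβ
  have hβ2 : σ (σ β) ≠ 0 := by simpa using hβ
  set τ := triangleForm σ β with hτ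
  have hfix : ∀ w, σ (ternary τ (conj σ w)) = ternary τ (conj σ w) := fun w => by
    rw [ternary_conj]
    simp [hτ, triangleForm, hσ.cube]
    ring
  have hfix' : ∀ w w', σ (ternaryPolar τ (conj σ w) (conj σ w')) =
      ternaryPolar τ (conj σ w) (conj σ w') := fun w w' => by
    have h1 := ternary_add τ (conj σ w) (conj σ w')
    rw [← conj_add] at h1
    rw [← sub_eq_iff_eq_add'.2 h1, map_sub, map_add, hfix, hfix, hfix]
  -- descent of the coefficients to the base field
  obtain ⟨n, hn⟩ : ∃ n : Fin 3 → K, n = fun i => c (Pi.single i 1) := ⟨_, rfl⟩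
  have hsingle : ∀ i, ν (Pi.single i 1) = conj σ (n i) := fun i => by
    rw [hn, ← hν]
    congr 1
    ext j
    by_cases hj : j = i
    · subst hj; simp
    · simp [hj]
  have hcomp := ternary_comp τ ν.toLinearMap
  simp only [LinearEquiv.coe_coe, hsingle] at hcomp
  obtain ⟨a, ha⟩ : ∃ a : Fin 6 → F, ∀ u, ternary τ (ν u) =
      ternary (fun i => algebraMap F K (a i)) u := by
    choose f hf using fun w => hσ.fixed _ (hfix w)
    choose p hp using fun w w' => hσ.fixed _ (hfix' w w')
    refine ⟨![f (n 0), f (n 1), f (n 2), p (n 1) (n 2), p (n 0) (n 2), p (n 0) (n 1)], fun u => ?_⟩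
    rw [hcomp]
    congr 1
    ext i
    fin_cases i
    exacts [(hf _).symm, (hf _).symm, (hf _).symm, (hp _ _).symm, (hp _ _).symm, (hp _ _).symm]
  have hmem : ∀ P u, u ≠ 0 → h u ∈ P.submodule →
      (P ∈ (fun P => g • P) '' zeroSet K (ternary (fun i => C (a i)) X) ↔ ternary τ u = 0) := by
    intro P u hu hP
    rw [mem_image_zeroSet g a (u := ν.symm u) (by simpa using hu), ← ha,
      LinearEquiv.apply_symm_apply]
    rw [← hgν, LinearEquiv.apply_symm_apply]; exact hP
  refine ⟨(fun P => g • P) '' zeroSet K (ternary (fun i => C (a i)) X),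
    ⟨g, ternary (fun i => C (a i)) X, ⟨isHomogeneous_ternary a, ?_⟩, hg, ?_, rfl⟩, ?_⟩
  · let j : K →ₐ[F] AlgebraicClosure F := IsAlgClosed.lift
    have hev : ∀ u, eval (fun i => j (ν.symm u i))
        (MvPolynomial.map (algebraMap F (AlgebraicClosure F)) (ternary (fun i => C (a i)) X)) =
        j (ternary τ u) := by
      intro u
      have h1 := ha (ν.symm u)
      rw [LinearEquiv.apply_symm_apply] at h1
      rw [h1]
      have h2 := map_ternary (j : K →+* AlgebraicClosure F) (fun i => algebraMap F K (a i))
        (ν.symm u)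
      simp only [RingHom.coe_coe, AlgHom.commutes] at h2
      rw [h2]
      simp [ternary]
    have hadd : ∀ u v : Fin 3 → K, (fun i => j (ν.symm u i)) + (fun i => j (ν.symm v i)) =
        fun i => j (ν.symm (u + v) i) := fun u v => by
      ext i; simp
    refine irreducible_of_triangle ((isHomogeneous_ternary a).map _)
      (x := fun i => j (ν.symm (Pi.single 0 1) i)) (y := fun i => j (ν.symm (Pi.single 1 1) i))
      (z := fun i => j (ν.symm (Pi.single 2 1) i)) ?_ ?_ ?_ ?_ ?_ ?_
    · rw [hev, ternary_single]; exact map_zero j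
    · rw [hev, ternary_single]; exact map_zero j
    · rw [hev, ternary_single]; exact map_zero j
    · rw [hadd, hev, map_ne_zero]; simpa [ternary, hτ, triangleForm] using hβ
    · rw [hadd, hev, map_ne_zero]; simpa [ternary, hτ, triangleForm] using hβ
    · rw [hadd, hev, map_ne_zero]; simpa [ternary, hτ, triangleForm] using hβ
  · rw [Set.image_inter (MulAction.injective g), ← hg]
    ext P
    rw [hB, Set.mem_inter_iff, hh.mem_iff]
    constructor
    · rintro ⟨w, hw, h0, hwP⟩
      exact ⟨⟨w, hw, hwP⟩, (hmem P _ (conj_ne_zero hw) hwP).2 h0⟩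
    · rintro ⟨⟨w, hw, hwP⟩, hPD⟩
      exact ⟨w, hw, (hmem P _ (conj_ne_zero hw) hwP).1 hPD, hwP⟩
  · intro P hP
    obtain ⟨i, hi⟩ := hh.exists_of_mem_fixedPoints hσ hP
    refine (hmem P _ (fun h0 => one_ne_zero (α := K) (by simpa using congrFun h0 i)) hi).2 ?_
    rw [ternary_single]
    fin_cases i <;> rfl

end ConicFrame

/-! ### Special conics and special twisted cubics -/

section SpecialCubic

variable {F K : Type*} [Field F] [Field K] [Algebra F K] {σ : K ≃ₐ[F] K}

variable (F) in
/-- The coordinate change of `PG(6, q)` that takes the affine point `w` to the affine point `1 / w`,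
for affine points `w` of the form `(σ w / w, σ² w / w, 1)`. -/
def cremona (hσ : IsCubicFrobenius σ) : V6 F K ≃ₗ[F] V6 F K where
  toFun v := (σ v.2.1, σ (σ v.1), v.2.2)
  map_add' u v := by simp
  map_smul' r v := by simp
  invFun v := (σ v.2.1, σ (σ v.1), v.2.2)
  left_inv v := by simp [hσ.cube]
  right_inv v := by simp [hσ.cube]

theorem cremona_apply (hσ : IsCubicFrobenius σ) (v : V6 F K) :
    cremona F hσ v = (σ v.2.1, σ (σ v.1), v.2.2) := rfl

/-- The transformation `w ↦ 1 / w` exchanges the splash and the conic cover. -/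
theorem planeFamily_cremona (hσ : IsCubicFrobenius σ) (e : V6 F K ≃ₗ[F] V6 F K) :
    planeFamily σ ((cremona F hσ).trans e) AlgEquiv.refl = planeFamily σ e σ := by
  have key : ∀ u, u ≠ 0 → (coverPlane σ AlgEquiv.refl u).map ((cremona F hσ).trans e).toLinearMap =
      (coverPlane σ σ (u * σ u)).map e.toLinearMap := by
    intro u hu
    have hu1 : σ u ≠ 0 := by simpa using hu
    ext x
    obtain ⟨v, rfl⟩ := ((cremona F hσ).trans e).surjective x
    rw [mem_map_equiv, LinearEquiv.trans_apply, mem_map_equiv, mem_coverPlane, mem_coverPlane,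
      cremona_apply]
    refine and_congr_right fun _ => ?_
    simp only [map_mul, AlgEquiv.coe_refl, id]
    have h1 : u * σ u * σ (σ v.1) + σ u * σ (σ u) * σ (σ v.2.1) =
        σ u * (u * σ (σ v.1) + σ (σ u) * σ (σ v.2.1)) := by ring
    have h2 : σ (σ (u * v.2.1 + σ u * v.1)) = u * σ (σ v.1) + σ (σ u) * σ (σ v.2.1) := by
      simp only [map_add, map_mul, hσ.cube]; ring
    rw [h1, mul_eq_zero, or_iff_right hu1, ← h2, map_eq_zero, map_eq_zero]
  ext α
  constructor
  · rintro ⟨u, hu, rfl⟩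
    exact ⟨u * σ u, mul_ne_zero hu (by simpa using hu), key u hu⟩
  · rintro ⟨u, hu, rfl⟩
    have hu1 : σ u ≠ 0 := by simpa using hu
    have hu2 : σ (σ u) ≠ 0 := by simpa using hu
    -- the equation `x σ(x) = r u`, with `r` the norm of `u`, is solved by `x = u σ²(u)`
    refine ⟨u * σ (σ u), mul_ne_zero hu hu2, ?_⟩
    rw [key _ (mul_ne_zero hu hu2)]
    congr 1
    refine coverPlane_congr _ hu ?_ ?_
    · simp only [map_mul, hσ.cube]
      exact mul_ne_zero (mul_ne_zero hu hu2) (mul_ne_zero hu1 hu)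
    · simp only [map_mul, hσ.cube]; ring

variable {π : Set (ℙ K (Fin 3 → K))} {h : (Fin 3 → K) ≃ₗ[K] (Fin 3 → K)}
  {e : V6 F K ≃ₗ[F] V6 F K}

/-- A conic through the fixed points is represented by a twisted cubic that is special for the conic
cover: the image under `w ↦ 1 / w` of the twisted cubic of a line. -/
theorem isSpecialTwistedCubic_of_triangleForm (hσ : IsCubicFrobenius σ)
    (hK : Module.finrank F K = 3) (hez : ∀ v, (e v).2.2 = v.2.2)
    (he : ∀ (P : ℙ K (Fin 3 → K)) v, e v ∈ bb F P ↔
        h ![algebraMap F K v.2.2, v.1, v.2.1] ∈ P.submodule)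
    {β : K} (hβ : β ≠ 0) {B : Set (ℙ K (Fin 3 → K))}
    (hB : ∀ P, P ∈ B ↔ ∃ w, w ≠ 0 ∧ ternary (triangleForm σ β) (conj σ w) = 0 ∧
        h (conj σ w) ∈ P.submodule) :
    IsSpecialTwistedCubic (planeFamily σ e σ) (bbSet F B) := by
  obtain ⟨w₁, w₂, hdet, hw⟩ := exists_basis_conjTrace hσ hβ
  obtain ⟨A, hA⟩ := exists_isConjCurve hσ 3 (d := 1) ![w₁, w₂]
  have hspec := hA.isSpecialCubicMap hσ hK (e := (cremona F hσ).trans e)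
    (fun v => by rw [LinearEquiv.trans_apply, hez]; rfl) hdet
  rw [planeFamily_cremona] at hspec
  refine ⟨_, hspec, ?_⟩
  have hne : ∀ s : Fin 2 → F, s ≠ 0 → s 0 • w₁ + s 1 • w₂ ≠ 0 := fun s hs h0 => hs (by
    obtain ⟨h1, h2⟩ := smul_add_smul_eq_zero hdet h0
    ext i; fin_cases i <;> assumption)
  have hval := fun s => hA.apply_veronese (d := 1) rfl s (evalForm_algebraMap w₁ w₂ s).symm
  symm
  refine curvePoints_eq_bbSet (σ := σ) he ((cremona F hσ).toLinearMap ∘ₗ A)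
    (fun s => (s 0 • w₁ + s 1 • w₂)⁻¹) (fun s hs => inv_ne_zero (hne s hs)) ?_ ?_ ?_ fun P => ?_
  · intro s hs
    obtain ⟨h1, h2, h3⟩ := hval s
    have hs' := hne s hs
    generalize s 0 • w₁ + s 1 • w₂ = u at *
    have hu1 : σ u ≠ 0 := by simpa using hs'
    change _ * σ (A (veronese 3 s)).2.1 = _ * algebraMap F K (A (veronese 3 s)).2.2
    rw [h2, h3, map_inv₀]
    simp only [map_mul, hσ.cube]
    field_simp
  · intro s hs
    obtain ⟨h1, h2, h3⟩ := hval s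
    have hs' := hne s hs
    generalize s 0 • w₁ + s 1 • w₂ = u at *
    have hu2 : σ (σ u) ≠ 0 := by simpa using hs'
    change _ * σ (σ (A (veronese 3 s)).1) = _ * algebraMap F K (A (veronese 3 s)).2.2
    rw [h1, h3, map_inv₀, map_inv₀]
    simp only [map_mul, hσ.cube]
    field_simp
  · intro s hs h0
    obtain ⟨h1, h2, h3⟩ := hval s
    have h0 : (A (veronese 3 s)).2.2 = 0 := h0
    rw [h0, map_zero] at h3
    have hs' := hne s hs
    generalize s 0 • w₁ + s 1 • w₂ = u at *
    exact mul_ne_zero (mul_ne_zero hs' (by simpa using hs')) (by simpa using hs') h3.symm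
  · rw [hB]
    constructor
    · rintro ⟨w, hw0, hw1, hwP⟩
      rw [ternary_triangleForm_eq_zero_iff hw0, hw] at hw1
      obtain ⟨s, t, hst⟩ := hw1
      refine ⟨![s, t], fun h0 => inv_ne_zero hw0 ?_, ?_⟩
      · have hs : s = 0 := congrFun h0 0
        have ht : t = 0 := congrFun h0 1
        rw [hst, hs, ht]; simp
      · change h (conj σ (s • w₁ + t • w₂)⁻¹) ∈ _
        rw [← hst, inv_inv]; exact hwP
    · rintro ⟨s, hs, hP⟩
      refine ⟨_, inv_ne_zero (hne s hs), ?_, hP⟩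
      rw [ternary_triangleForm_eq_zero_iff (inv_ne_zero (hne s hs)), inv_inv, hw]
      exact ⟨_, _, rfl⟩

/-- A normal rational curve has as many points as a line. -/
theorem ncard_curvePoints {n : ℕ} (hn : n ≠ 0) {A : (Fin (n + 1) → F) →ₗ[F] V6 F K}
    (hA : Function.Injective A) : (curvePoints A).ncard = Nat.card (ℙ F (Fin 2 → F)) := by
  have hlast : ∀ x : Fin 2 → F, veronese n x (Fin.last n) = x 1 ^ n := fun x => by simp [veronese]
  have hfirst : ∀ x : Fin 2 → F, veronese n x 0 = x 0 ^ n := fun x => by simp [veronese]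
  have hsecond : ∀ x : Fin 2 → F, veronese n x ⟨1, by omega⟩ = x 0 ^ (n - 1) * x 1 := fun x => by
    simp [veronese]
  have hne : ∀ x : Fin 2 → F, x ≠ 0 → A (veronese n x) ≠ 0 := by
    intro x hx h0
    rw [← map_zero A] at h0
    have h0 := hA h0
    apply hx
    have e0 := congrFun h0 0
    have e1 := congrFun h0 (Fin.last n)
    rw [hfirst] at e0
    rw [hlast] at e1
    ext i
    fin_cases i
    · exact pow_eq_zero_iff hn |>.1 e0
    · exact pow_eq_zero_iff hn |>.1 e1
  let f : ℙ F (Fin 2 → F) → ℙ F (V6 F K) := fun p =>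
    Projectivization.mk F (A (veronese n p.rep)) (hne _ p.rep_nonzero)
  have hsmul : ∀ (c : F) (x : Fin 2 → F), veronese n (c • x) = c ^ n • veronese n x := by
    intro c x
    ext i
    have hi : c ^ n = c ^ (n - (i : ℕ)) * c ^ (i : ℕ) := by
      rw [← pow_add]; congr 1; have := i.is_lt; omega
    simp only [veronese, Pi.smul_apply, smul_eq_mul, mul_pow, hi]
    ring
  have hrange : curvePoints A = Set.range f := by
    ext p
    constructor
    · rintro ⟨x, hx, hp⟩
      refine ⟨Projectivization.mk F x hx, ?_⟩
      obtain ⟨a, ha⟩ := Projectivization.exists_smul_eq_mk_rep F x hx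
      refine eq_of_mem_submodule (hne x hx) ?_ (by rw [hp]; exact Submodule.mem_span_singleton_self _)
      have h1 : (a : F) ^ n ≠ 0 := pow_ne_zero _ a.ne_zero
      have h2 : A (veronese n (Projectivization.mk F x hx).rep) = (a : F) ^ n • A (veronese n x) := by
        rw [← ha, ← map_smul, ← hsmul]; rfl
      rw [Projectivization.submodule_mk, h2, Submodule.mem_span_singleton]
      exact ⟨((a : F) ^ n)⁻¹, by rw [smul_smul, inv_mul_cancel₀ h1, one_smul]⟩
    · rintro ⟨p, rfl⟩
      exact ⟨p.rep, p.rep_nonzero, Projectivization.submodule_mk _ _⟩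
  have hinj : Function.Injective f := by
    intro p r hpr
    obtain ⟨c, hc⟩ := (Projectivization.mk_eq_mk_iff' _ _ _ _ _).1 hpr
    rw [← map_smul] at hc
    have hc := hA hc
    have e0 := congrFun hc 0
    have e1 := congrFun hc ⟨1, by omega⟩
    rw [Pi.smul_apply, hfirst, hfirst, smul_eq_mul] at e0
    rw [Pi.smul_apply, hsecond, hsecond, smul_eq_mul] at e1
    have hp := p.rep_nonzero
    have hr := r.rep_nonzero
    rw [← p.mk_rep, ← r.mk_rep, Projectivization.mk_eq_mk_iff']
    generalize p.rep = x at *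
    generalize r.rep = y at *
    have hc0 : c ≠ 0 := by
      rintro rfl
      rw [zero_smul] at hc
      exact hne x hp (by rw [← hc, map_zero])
    by_cases hx : x 0 = 0
    · rw [hx, zero_pow hn, mul_eq_zero, or_iff_right hc0] at e0
      have hy := (pow_eq_zero_iff hn).1 e0
      have hy1 : y 1 ≠ 0 := fun h0 => hr (by ext i; fin_cases i <;> assumption)
      refine ⟨x 1 / y 1, ?_⟩
      ext i
      fin_cases i
      · simp [hx, hy]
      · simp [hy1]
    · have hy : y 0 ≠ 0 := by
        intro h0
        rw [h0, zero_pow hn, mul_zero] at e0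
        exact hx ((pow_eq_zero_iff hn).1 e0.symm)
      refine ⟨x 0 / y 0, ?_⟩
      ext i
      fin_cases i
      · simp [hy]
      · simp only [Fin.mk_one, Pi.smul_apply, smul_eq_mul]
        have hn1 : ∀ a : F, a ^ n = a ^ (n - 1) * a := fun a => by
          rw [← pow_succ]; congr 1; omega
        rw [hn1, hn1] at e0
        have hp0 : x 0 ^ (n - 1) ≠ 0 := pow_ne_zero _ hx
        have hq0 : y 0 ^ (n - 1) ≠ 0 := pow_ne_zero _ hy
        rw [div_mul_eq_mul_div, div_eq_iff hy]
        apply mul_left_cancel₀ (mul_ne_zero hp0 (mul_ne_zero hc0 hq0))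
        linear_combination (x 0 ^ (n - 1) * x 0) * e1 - (x 0 ^ (n - 1) * x 1) * e0
  rw [hrange, ← Set.image_univ, Set.ncard_image_of_injective _ hinj, Set.ncard_univ]

theorem eq_of_mem_bb (he : ∀ (P : ℙ K (Fin 3 → K)) v, e v ∈ bb F P ↔
        h ![algebraMap F K v.2.2, v.1, v.2.1] ∈ P.submodule) {P R : ℙ K (Fin 3 → K)} {w : K}
    (hw : w ≠ 0) (hP : h (conj σ w) ∈ P.submodule) {v : V6 F K}
    (hv1 : w * v.1 = σ w * algebraMap F K v.2.2)
    (hv2 : w * v.2.1 = σ (σ w) * algebraMap F K v.2.2) (hz : v.2.2 ≠ 0)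
    (hR : e v ∈ bb F R) : P = R := by
  have hP' : e v ∈ bb F P := by
    rw [bb_eq_span he hw hP hv1 hv2 hz]; exact Submodule.mem_span_singleton_self _
  rw [he] at hP' hR
  refine eq_of_mem_submodule (fun h0 => hz ?_) hP' hR
  rw [LinearEquiv.map_eq_zero_iff] at h0
  simpa using congrFun h0 0

/-- The 3-space of a twisted cubic that is special for the conic cover has an equation
`u b + σ(u) σ(a) + κ z = 0`. -/
theorem IsSpecialCubicMap.exists_equation (hK : Module.finrank F K = 3)
    (hez : ∀ v, (e v).2.2 = v.2.2) {A : (Fin 4 → F) →ₗ[F] V6 F K}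
    (hA : IsSpecialCubicMap (planeFamily σ e σ) A) :
    ∃ u κ : K, u ≠ 0 ∧ ∀ v, e v ∈ LinearMap.range A →
      u * v.2.1 + σ u * σ v.1 + κ * algebraMap F K v.2.2 = 0 := by
  have hfd : Module.Finite F K := Module.finite_of_finrank_pos (by omega)
  obtain ⟨hinj, ⟨_, ⟨u, hu, rfl⟩, hle⟩, hnle, -⟩ := hA
  obtain ⟨x, hx, hxz⟩ := Set.not_subset.1 hnle
  obtain ⟨y, rfl⟩ := e.surjective x
  have hyz : y.2.2 ≠ 0 := fun h0 => hxz ((hez y).trans h0)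
  have hyz' : algebraMap F K y.2.2 ≠ 0 := by simpa using hyz
  set α := (coverPlane σ σ u).map e.toLinearMap with hα
  have hyα : e y ∉ α := fun h0 => hyz (by
    rw [hα, mem_map_equiv] at h0; exact h0.1)
  have hlt : α < α ⊔ Submodule.span F {e y} := by
    refine lt_of_le_of_ne le_sup_left fun h0 => hyα ?_
    rw [h0]
    exact le_sup_right (a := α) (Submodule.mem_span_singleton_self _)
  have hαrank : Module.finrank F α = 3 := by
    rw [hα, LinearEquiv.finrank_map_eq, finrank_coverPlane _ hu, hK]
  have heq : α ⊔ Submodule.span F {e y} = LinearMap.range A := by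
    refine Submodule.eq_of_le_of_finrank_le
      (sup_le hle ((Submodule.span_singleton_le_iff_mem _ _).2 hx)) ?_
    rw [LinearMap.finrank_range_of_inj hinj, Module.finrank_fin_fun]
    have := Submodule.finrank_lt_finrank_of_lt hlt
    omega
  refine ⟨u, -(u * y.2.1 + σ u * σ y.1) / algebraMap F K y.2.2, hu, fun v hv => ?_⟩
  rw [← heq, Submodule.mem_sup] at hv
  obtain ⟨a, ha, b, hb, hab⟩ := hv
  obtain ⟨a, rfl⟩ := e.surjective a
  obtain ⟨r, rfl⟩ := Submodule.mem_span_singleton.1 hb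
  rw [hα, mem_map_equiv, mem_coverPlane] at ha
  rw [← map_smul, ← map_add, e.injective.eq_iff] at hab
  obtain ⟨ha0, ha1⟩ := ha
  subst hab
  simp only [Prod.fst_add, Prod.snd_add, Prod.smul_fst, Prod.smul_snd, ha0, smul_eq_mul, zero_add]
  simp only [Algebra.smul_def, map_add, map_mul, AlgEquiv.commutes]
  field_simp
  linear_combination ha1

/-- A set of points of `π` represented by a twisted cubic that is special for the conic cover is
the conic of a form `triangleForm σ β`. -/
theorem IsSpecialCubicMap.exists_triangleForm [Finite F] (hσ : IsCubicFrobenius σ)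
    (hK : Module.finrank F K = 3) (hez : ∀ v, (e v).2.2 = v.2.2)
    (he : ∀ (P : ℙ K (Fin 3 → K)) v, e v ∈ bb F P ↔
        h ![algebraMap F K v.2.2, v.1, v.2.1] ∈ P.submodule)
    {B : Set (ℙ K (Fin 3 → K))} (hBπ : ∀ P ∈ B, ∃ w, w ≠ 0 ∧ h (conj σ w) ∈ P.submodule)
    {A : (Fin 4 → F) →ₗ[F] V6 F K} (hA : IsSpecialCubicMap (planeFamily σ e σ) A)
    (hAB : bbSet F B = curvePoints (n := 3) A) :
    ∃ β : K, β ≠ 0 ∧ ∀ P, P ∈ B ↔ ∃ w, w ≠ 0 ∧ ternary (triangleForm σ β) (conj σ w) = 0 ∧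
        h (conj σ w) ∈ P.submodule := by
  have hinj := hA.1
  obtain ⟨u, κ, hu, hκ⟩ := hA.exists_equation hK hez
  -- the affine point `w`, and its representative in `PG(6, q)`
  let pt : K → V6 F K := fun w => (σ w / w, σ (σ w) / w, 1)
  have hpt1 : ∀ w, w ≠ 0 → w * (pt w).1 = σ w * algebraMap F K (pt w).2.2 := fun w hw => by
    simp only [pt, map_one]; field_simp
  have hpt2 : ∀ w, w ≠ 0 → w * (pt w).2.1 = σ (σ w) * algebraMap F K (pt w).2.2 := fun w hw => by
    simp only [pt, map_one]; field_simp
  have hspan : ∀ P w, w ≠ 0 → h (conj σ w) ∈ P.submodule →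
      bb F P = Submodule.span F {e (pt w)} := fun P w hw hP =>
    bb_eq_span he hw hP (hpt1 w hw) (hpt2 w hw) one_ne_zero
  have hpt0 : ∀ w, e (pt w) ≠ 0 := fun w h0 => by
    rw [LinearEquiv.map_eq_zero_iff] at h0
    exact one_ne_zero (α := F) (congrArg (fun v : V6 F K => v.2.2) h0)
  have hline : ∀ P ∈ B, ∀ w, w ≠ 0 → h (conj σ w) ∈ P.submodule →
      u * w⁻¹ + σ u * σ w⁻¹ + κ * σ (σ w⁻¹) = 0 := by
    intro P hP w hw hwP
    have h1 : Projectivization.mk F _ (hpt0 w) ∈ curvePoints (n := 3) A := by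
      rw [← hAB]
      exact ⟨P, hP, by rw [Projectivization.submodule_mk, hspan P w hw hwP]⟩
    obtain ⟨x, -, hx⟩ := h1
    rw [Projectivization.submodule_mk] at hx
    have h2 : e (pt w) ∈ Submodule.span F {A (veronese 3 x)} := by
      rw [← hx]; exact Submodule.mem_span_singleton_self _
    obtain ⟨r, hr⟩ := Submodule.mem_span_singleton.1 h2
    have h3 := hκ (pt w) ⟨r • veronese 3 x, by rw [map_smul, hr]⟩
    have hw1 : σ w ≠ 0 := by simpa using hw
    have hw2 : σ (σ w) ≠ 0 := by simpa using hw
    simp only [pt, map_div₀, map_one] at h3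
    simp only [map_inv₀]
    field_simp at h3 ⊢
    linear_combination h3
  -- two points of the curve determine the line that it becomes under `w ↦ 1 / w`
  have hpoint : ∀ x : Fin 2 → F, x ≠ 0 → A (veronese 3 x) ≠ 0 → ∃ P ∈ B, ∃ w, w ≠ 0 ∧
      h (conj σ w) ∈ P.submodule ∧ A (veronese 3 x) ∈ bb F P := by
    intro x hx hx0
    have h1 : Projectivization.mk F _ hx0 ∈ bbSet F B := by
      rw [hAB]; exact ⟨x, hx, Projectivization.submodule_mk _ _⟩
    obtain ⟨P, hP, hle⟩ := h1
    obtain ⟨w, hw, hwP⟩ := hBπ P hP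
    refine ⟨P, hP, w, hw, hwP, ?_⟩
    rwa [Projectivization.submodule_mk, Submodule.span_singleton_le_iff_mem] at hle
  have hv0 : veronese 3 ![(1 : F), 0] = Pi.single 0 1 := by
    ext i; fin_cases i <;> simp [veronese]
  have hv1 : veronese 3 ![(0 : F), 1] = Pi.single 3 1 := by
    ext i; fin_cases i <;> simp [veronese]
  obtain ⟨P₁, hP₁, w₁, hw₁, hwP₁, hA₁⟩ := hpoint ![1, 0] (by simp) (by
    rw [hv0, Ne, map_eq_zero_iff A hinj]; simp)
  obtain ⟨P₂, hP₂, w₂, hw₂, hwP₂, hA₂⟩ := hpoint ![0, 1] (by simp) (by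
    rw [hv1, Ne, map_eq_zero_iff A hinj]; simp)
  have hne : P₁ ≠ P₂ := by
    rintro rfl
    rw [hspan P₁ w₁ hw₁ hwP₁, Submodule.mem_span_singleton] at hA₁ hA₂
    obtain ⟨r, hr⟩ := hA₁
    obtain ⟨s, hs⟩ := hA₂
    have h1 : A (s • veronese 3 ![1, 0] - r • veronese 3 ![0, 1]) = 0 := by
      rw [map_sub, map_smul, map_smul, ← hr, ← hs, smul_smul, smul_smul, mul_comm, sub_self]
    rw [map_eq_zero_iff A hinj, hv0, hv1] at h1
    have h2 : s = 0 := by simpa using congrFun h1 0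
    rw [h2, zero_smul, hv1, eq_comm, map_eq_zero_iff A hinj] at hs
    simp at hs
  have hdet := conj_det_ne_zero_of_ne hσ hw₁ hw₂ hwP₁ hwP₂ hne
  have e1 := hline P₁ hP₁ w₁ hw₁ hwP₁
  have e2 := hline P₂ hP₂ w₂ hw₂ hwP₂
  have hdet' : w₁⁻¹ * σ w₂⁻¹ - σ w₁⁻¹ * w₂⁻¹ ≠ 0 := by
    have h1 : σ w₁ ≠ 0 := by simpa using hw₁
    have h2 : σ w₂ ≠ 0 := by simpa using hw₂
    have : w₁⁻¹ * σ w₂⁻¹ - σ w₁⁻¹ * w₂⁻¹ =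
        -(w₁ * σ w₂ - σ w₁ * w₂) / (w₁ * w₂ * σ w₁ * σ w₂) := by
      simp only [map_inv₀]; field_simp; ring
    rw [this]
    exact div_ne_zero (neg_ne_zero.2 hdet)
      (mul_ne_zero (mul_ne_zero (mul_ne_zero hw₁ hw₂) h1) h2)
  generalize w₁⁻¹ = v₁ at *
  generalize w₂⁻¹ = v₂ at *
  set β := σ v₁ * σ (σ v₂) - σ (σ v₁) * σ v₂ with hβdef
  have hβ : β ≠ 0 := by
    have : σ (v₁ * σ v₂ - σ v₁ * v₂) ≠ 0 := (map_ne_zero σ).2 hdet'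
    rwa [map_sub, map_mul, map_mul] at this
  have hβ1 : σ β = σ (σ v₁) * v₂ - v₁ * σ (σ v₂) := by
    simp only [hβdef, map_sub, map_mul, hσ.cube]
  have hβ2 : σ (σ β) = v₁ * σ v₂ - σ v₁ * v₂ := by
    rw [hβ1]; simp only [map_sub, map_mul, hσ.cube]
  have hσu : u * σ β = σ u * β := by
    rw [hβ1, hβdef]; linear_combination σ (σ v₁) * e2 - σ (σ v₂) * e1
  have hκβ : u * σ (σ β) = κ * β := by
    rw [hβ2, hβdef]; linear_combination σ v₂ * e1 - σ v₁ * e2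
  have hsub : ∀ P ∈ B, ∃ w, w ≠ 0 ∧ ternary (triangleForm σ β) (conj σ w) = 0 ∧
      h (conj σ w) ∈ P.submodule := by
    intro P hP
    obtain ⟨w, hw, hwP⟩ := hBπ P hP
    refine ⟨w, hw, ?_, hwP⟩
    rw [ternary_triangleForm_eq_zero_iff hw, conjTrace]
    have h1 := hline P hP w hw hwP
    apply mul_left_cancel₀ hu
    linear_combination β * h1 + σ w⁻¹ * hσu + σ (σ w⁻¹) * hκβ
  refine ⟨β, hβ, fun P => ⟨hsub P, ?_⟩⟩
  -- both sets are represented by twisted cubics, so they have the same number of points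
  rintro ⟨w, hw, hw0, hwP⟩
  obtain ⟨A', ⟨hinj', -⟩, hA'⟩ := isSpecialTwistedCubic_of_triangleForm hσ hK hez he hβ
    (B := {P | ∃ w, w ≠ 0 ∧ ternary (triangleForm σ β) (conj σ w) = 0 ∧
      h (conj σ w) ∈ P.submodule}) fun P => Iff.rfl
  have hfd : Module.Finite F K := Module.finite_of_finrank_pos (by omega)
  have : Finite K := Module.finite_of_finite F
  have : Finite (ℙ F (V6 F K)) := inferInstance
  have hBB : bbSet F B = bbSet F {P | ∃ w, w ≠ 0 ∧ ternary (triangleForm σ β) (conj σ w) = 0 ∧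
      h (conj σ w) ∈ P.submodule} := by
    refine Set.eq_of_subset_of_ncard_le ?_ ?_ (Set.toFinite _)
    · rintro p ⟨P, hP, hp⟩
      exact ⟨P, hsub P hP, hp⟩
    · rw [hAB, hA', ncard_curvePoints (by decide) hinj, ncard_curvePoints (by decide) hinj']
  have hmem : Projectivization.mk F _ (hpt0 w) ∈ bbSet F B := by
    rw [hBB]
    exact ⟨P, ⟨w, hw, hw0, hwP⟩, by rw [Projectivization.submodule_mk, hspan P w hw hwP]⟩
  obtain ⟨R, hR, hle⟩ := hmem
  rw [Projectivization.submodule_mk, Submodule.span_singleton_le_iff_mem] at hle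
  rw [eq_of_mem_bb he hw hwP (hpt1 w hw) (hpt2 w hw) one_ne_zero hle]
  exact hR

end SpecialCubic

/-! ### Conics with no fixed point on their extension -/

section Sextic

open MvPolynomial

variable {F K : Type*} [Field F] [Field K] [Algebra F K] {σ : K ≃ₐ[F] K}
  {h : (Fin 3 → K) ≃ₗ[K] (Fin 3 → K)} {e : V6 F K ≃ₗ[F] V6 F K}

theorem evalForm_two (ω : Fin 3 → K) (s : Fin 2 → F) :
    evalForm (d := 2) ω (fun i => algebraMap F K (s i)) =
      s 0 ^ 2 • ω 0 + (s 0 * s 1) • ω 1 + s 1 ^ 2 • ω 2 := by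
  change ∑ i : Fin 3, ω i * veronese 2 _ i = _
  simp [Fin.sum_univ_three, veronese, Algebra.smul_def]
  ring

/-- A conic whose extension does not contain the fixed points, with a parametrization of degree 2 by
its normal form, is represented by a normal rational curve of degree 6. -/
theorem isNormalRationalCurve_of_ne_zero [Finite F] (hσ : IsCubicFrobenius σ)
    (he : ∀ (P : ℙ K (Fin 3 → K)) v, e v ∈ bb F P ↔
        h ![algebraMap F K v.2.2, v.1, v.2.1] ∈ P.submodule)
    (c : (Fin 3 → F) ≃ₗ[F] K) {q : Fin 6 → F} {t : Fin 6 → K}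
    (hQ : IsIrreducibleQuadratic F (ternary (fun i => C (q i)) X))
    (ht : ∀ v, ternary t (conj σ (c v)) = algebraMap F K (ternary q v)) (ht0 : t 0 ≠ 0)
    {B : Set (ℙ K (Fin 3 → K))}
    (hB : ∀ P, P ∈ B ↔ ∃ w, w ≠ 0 ∧ ternary t (conj σ w) = 0 ∧ h (conj σ w) ∈ P.submodule) :
    IsNormalRationalCurve 6 (bbSet F B) := by
  obtain ⟨m, κ, hκ, hspan, hm0, hm1, hm2, hm01, hm02, hm12⟩ := hQ.exists_normalForm
  have hpolar : ∀ u v, ternaryPolar t (conj σ (c u)) (conj σ (c v)) =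
      algebraMap F K (ternaryPolar q u v) := by
    intro u v
    have h1 := ternary_add t (conj σ (c u)) (conj σ (c v))
    have h2 := ternary_add q u v
    rw [← conj_add, ← map_add, ht, ht, ht, h2, map_add, map_add] at h1
    exact (add_left_cancel h1).symm
  have hq : ∀ x y z : F, ternary q (x • m 0 + y • m 1 + z • m 2) = x * z - κ * y ^ 2 := by
    intro x y z
    have h1 := ternary_comb q m ![x, y, z]
    simp only [Matrix.cons_val, hm0, hm1, hm2, hm01, hm02, hm12] at h1
    rw [h1]
    simp [ternary]
    ring
  have hindep : ∀ x y z : F, x • m 0 + y • m 1 + z • m 2 = 0 → x = 0 ∧ z = 0 := by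
    intro x y z h0
    have h1 := hq (x + 1) y z
    have h2 := hq x y (z + 1)
    have h3 := hq x y z
    have e1 : (x + 1) • m 0 + y • m 1 + z • m 2 = m 0 + (x • m 0 + y • m 1 + z • m 2) := by
      rw [add_smul, one_smul]; abel
    have e2 : x • m 0 + y • m 1 + (z + 1) • m 2 = m 2 + (x • m 0 + y • m 1 + z • m 2) := by
      rw [add_smul, one_smul]; abel
    rw [e1, h0, add_zero, hm0] at h1
    rw [e2, h0, add_zero, hm2] at h2
    have h4 : ternary q 0 = 0 := by simp [ternary]
    rw [h0, h4] at h3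
    exact ⟨by linear_combination h3 - h2, by linear_combination h3 - h1⟩
  let ω : Fin 3 → K := ![c (κ • m 0), c (m 1), c (m 2)]
  obtain ⟨A, hA⟩ := exists_isConjCurve hσ 6 (d := 2) ω
  have heval : ∀ s : Fin 2 → F, evalForm (d := 2) ω (fun i => algebraMap F K (s i)) =
      c ((κ * s 0 ^ 2) • m 0 + (s 0 * s 1) • m 1 + s 1 ^ 2 • m 2) := by
    intro s
    rw [evalForm_two, mul_comm κ]
    simp only [ω, Matrix.cons_val, map_add, map_smul, smul_smul]
  have hne : ∀ s : Fin 2 → F, s ≠ 0 →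
      evalForm (d := 2) ω (fun i => algebraMap F K (s i)) ≠ 0 := by
    intro s hs h0
    rw [heval, LinearEquiv.map_eq_zero_iff] at h0
    obtain ⟨h1, h2⟩ := hindep _ _ _ h0
    refine hs ?_
    ext i
    fin_cases i
    · exact pow_eq_zero_iff two_ne_zero |>.1 ((mul_eq_zero.1 h1).resolve_left hκ)
    · exact pow_eq_zero_iff two_ne_zero |>.1 h2
  have hinj : Function.Injective A := by
    refine hA.injective_of_conic hσ t ht0 ω ?_ ?_ ?_ ?_ ?_ ?_
    · intro w
      obtain ⟨v, rfl⟩ := c.surjective w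
      obtain ⟨x, rfl⟩ := hspan v
      refine ⟨![x 0 / κ, x 1, x 2], ?_⟩
      simp only [Fin.sum_univ_three, ω, Matrix.cons_val, ← Algebra.smul_def, map_add, map_smul,
        smul_smul, div_mul_cancel₀ _ hκ]
    · change ternary t (conj σ (c (κ • m 0))) = 0
      rw [ht, ternary_smul, hm0, mul_zero, map_zero]
    · change ternaryPolar t (conj σ (c (κ • m 0))) (conj σ (c (m 1))) = 0
      have : ternaryPolar q (κ • m 0) (m 1) = κ * ternaryPolar q (m 0) (m 1) := by
        simp only [ternaryPolar, Pi.smul_apply, smul_eq_mul]; ring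
      rw [hpolar, this, hm01, mul_zero, map_zero]
    · change ternaryPolar t (conj σ (c (κ • m 0))) (conj σ (c (m 2))) +
        ternary t (conj σ (c (m 1))) = 0
      have : ternaryPolar q (κ • m 0) (m 2) = κ * ternaryPolar q (m 0) (m 2) := by
        simp only [ternaryPolar, Pi.smul_apply, smul_eq_mul]; ring
      rw [hpolar, ht, this, hm02, hm1, ← map_add, mul_one, add_neg_cancel, map_zero]
    · change ternaryPolar t (conj σ (c (m 1))) (conj σ (c (m 2))) = 0
      rw [hpolar, hm12, map_zero]
    · change ternary t (conj σ (c (m 2))) = 0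
      rw [ht, hm2, map_zero]
  refine ⟨e.toLinearMap ∘ₗ A, e.injective.comp hinj, ?_⟩
  have hval := fun s => hA.apply_veronese (d := 2) rfl s rfl
  symm
  refine curvePoints_eq_bbSet (σ := σ) he A
    (fun s => evalForm (d := 2) ω fun i => algebraMap F K (s i)) hne ?_ ?_ ?_ fun P => ?_
  · intro s _
    obtain ⟨h1, -, h3⟩ := hval s
    rw [h1, h3]; ring
  · intro s _
    obtain ⟨-, h2, h3⟩ := hval s
    rw [h2, h3]; ring
  · intro s hs h0
    obtain ⟨-, -, h3⟩ := hval s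
    rw [h0, map_zero] at h3
    have hs' := hne s hs
    generalize evalForm (d := 2) ω (fun i => algebraMap F K (s i)) = w at *
    exact mul_ne_zero (mul_ne_zero hs' (by simpa using hs')) (by simpa using hs') h3.symm
  · rw [hB]
    constructor
    · rintro ⟨w, hw, hw0, hwP⟩
      obtain ⟨v, rfl⟩ := c.surjective w
      obtain ⟨x, rfl⟩ := hspan v
      rw [ht, hq, map_eq_zero] at hw0
      have hscale : ∀ (s : Fin 2 → F) (r : F),
          (κ * s 0 ^ 2) • m 0 + (s 0 * s 1) • m 1 + s 1 ^ 2 • m 2 =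
            r • (x 0 • m 0 + x 1 • m 1 + x 2 • m 2) →
          h (conj σ (evalForm (d := 2) ω fun i => algebraMap F K (s i))) ∈ P.submodule := by
        intro s r hs
        rw [heval, hs, map_smul, conj_smul, map_smul]
        exact Submodule.smul_mem _ _ hwP
      by_cases hx : x 2 = 0
      · rw [hx, mul_zero, zero_sub, neg_eq_zero, mul_eq_zero, or_iff_right hκ,
          pow_eq_zero_iff two_ne_zero] at hw0
        have hx0 : x 0 ≠ 0 := fun h0 => hw (by rw [h0, hw0, hx]; simp)
        refine ⟨![1, 0], by simp, hscale _ (κ / x 0) ?_⟩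
        simp [hx, hw0, smul_smul, hx0]
      · refine ⟨![x 1, x 2], fun h0 => hx (congrFun h0 1), hscale _ (x 2) ?_⟩
        simp only [Matrix.cons_val, smul_add, smul_smul]
        congr 3
        · linear_combination -hw0
        · ring
        · ring
    · rintro ⟨s, hs, hP⟩
      refine ⟨_, hne s hs, ?_, hP⟩
      rw [heval, ht, hq, map_eq_zero]
      ring

end Sextic

/-! ### The correspondence -/

section Correspondence

open MvPolynomial

variable {F K : Type*} [Field F] [Field K] [Algebra F K] {σ : K ≃ₐ[F] K}

/-- An irreducible conic whose equation in conjugate coordinates has no term in `W²` has no terms in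
`X²` and `Y²` either, by conjugation. -/
theorem eq_triangleForm [Finite F] (hσ : IsCubicFrobenius σ) (c : (Fin 3 → F) ≃ₗ[F] K)
    {q : Fin 6 → F} {t : Fin 6 → K}
    (hQ : IsIrreducibleQuadratic F (ternary (fun i => C (q i)) X))
    (ht : ∀ v, ternary t (conj σ (c v)) = algebraMap F K (ternary q v)) (ht0 : t 0 = 0) :
    t = triangleForm σ (t 3) ∧ t 3 ≠ 0 := by
  obtain ⟨h1, h2, h4, h5⟩ := hσ.conj_coeff (q := t) fun w => by
    obtain ⟨v, rfl⟩ := c.surjective w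
    rw [ht, AlgEquiv.commutes]
  have heq : t = triangleForm σ (t 3) := by
    rw [ht0, map_zero] at h1
    rw [h1, map_zero] at h2
    ext i
    fin_cases i
    exacts [ht0, h1, h2, rfl, h4, h5.trans (congrArg σ h4)]
  refine ⟨heq, fun h3 => ?_⟩
  obtain ⟨m, κ, hκ, -, -, hm1, -⟩ := hQ.exists_normalForm
  have := ht (m 1)
  rw [heq, h3, hm1, map_neg, eq_comm, neg_eq_iff_eq_neg] at this
  exact hκ (by simpa [ternary, triangleForm] using this)

end Correspondence

end BruckBose

theorem corollary3p7 {F K : Type*} [Field F] [Finite F] [Field K] [Algebra F K]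
    (hK : Module.finrank F K = 3)
    (π : Set (ℙ K (Fin 3 → K))) (hπ : BruckBose.IsSubplane F π) (hext : BruckBose.IsExterior π)
    (CC : Set (Submodule F (BruckBose.V6 F K))) (hCC : BruckBose.IsConicCover π CC)
    (C : Set (ℙ K (Fin 3 → K))) (hC : BruckBose.IsConic F π C) :
    (BruckBose.IsSpecialConic F π C ↔ BruckBose.IsSpecialTwistedCubic CC (BruckBose.bbSet F C)) ∧
    (¬ BruckBose.IsSpecialConic F π C →
      BruckBose.IsNormalRationalCurve 6 (BruckBose.bbSet F C)) := by
  open BruckBose in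
  obtain ⟨σ, hσ⟩ := exists_isCubicFrobenius hK
  obtain ⟨D, hD⟩ := hC
  refine ⟨⟨?_, ?_⟩, ?_⟩
  · rintro ⟨D, hD, hfix⟩
    obtain ⟨c, h, q, t, hh, hQ, ht, hmem, hmemD⟩ := hD.exists_form hσ hK hext
    obtain ⟨e, hez, he⟩ := hh.exists_equiv hK
    have hsingle : (Pi.single 0 1 : Fin 3 → K) ≠ 0 := by simp
    have hne : h (Pi.single 0 1) ≠ 0 := by rwa [Ne, LinearEquiv.map_eq_zero_iff]
    have hP := (mem_submodule_iff (P := Projectivization.mk K _ hne) hne).2 rfl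
    have h0 := (hmemD _ _ hsingle hP).1 (hfix (hh.mem_fixedPoints hσ hP))
    rw [ternary_single] at h0
    obtain ⟨heq, h3⟩ := eq_triangleForm hσ c hQ ht h0
    rw [hh.conicCover_eq hσ hK hez he hCC]
    refine isSpecialTwistedCubic_of_triangleForm hσ hK hez he h3 ?_
    rw [← heq]
    exact hmem
  · rintro ⟨A, hA, hAC⟩
    obtain ⟨h, hh, hspec⟩ := exists_isSpecialConic hσ hK hπ hext
    obtain ⟨e, hez, he⟩ := hh.exists_equiv hK
    rw [hh.conicCover_eq hσ hK hez he hCC] at hA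
    have hCπ : ∀ P ∈ C, ∃ w, w ≠ 0 ∧ h (conj σ w) ∈ P.submodule := by
      obtain ⟨g, Q, -, hg, hC, -⟩ := hD
      intro P hP
      rw [← hh.mem_iff P, hg]
      rw [hC] at hP
      exact Set.image_mono Set.inter_subset_left hP
    obtain ⟨β, hβ, hB⟩ := hA.exists_triangleForm hσ hK hez he hCπ hAC
    exact hspec β C hβ hB
  · intro hns
    obtain ⟨c, h, q, t, hh, hQ, ht, hmem, hmemD⟩ := hD.exists_form hσ hK hext
    obtain ⟨e, hez, he⟩ := hh.exists_equiv hK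
    refine isNormalRationalCurve_of_ne_zero hσ he c hQ ht (fun h0 => hns ⟨D, hD, ?_⟩) hmem
    obtain ⟨heq, -⟩ := eq_triangleForm hσ c hQ ht h0
    intro P hP
    obtain ⟨i, hi⟩ := hh.exists_of_mem_fixedPoints hσ hP
    refine (hmemD P _ (fun h0 => one_ne_zero (α := K) (by simpa using congrFun h0 i)) hi).2 ?_
    rw [ternary_single, heq]
    fin_cases i <;> rfl
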